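/- **Setting.** Let $d\in\mathbb N$, $T>0$. For a metric space $X$ (here $X=\mathbb R^d$ or $\mathbb R^{2d}$) let $\mathcal P_1(X)$ be the set of Borel probability measures on $X$ with finite first moment, with the Wasserstein distance $d_1(m,m')=\inf_\lambda\int d(x,y)\,d\lambda(x,y)$, the infimum being over all measures $\lambda$ on $X\times X$ with marginals $m,m'$. Fix $M_0>0$, a Lagrangian $L_0:\mathbb R^d\times\mathbb R^d\times\mathcal P_1(\mathbb R^d)\to\mathbb R$, a terminal cost $g:\mathbb R^d\times\mathcal P_1(\mathbb R^d)\to\mathbb R$ and a measure $\mu_0$ on $\mathbb R^{2d}$ such that: * **(M1)** $L_0$ is continuous in all variables; for every $m$ the map $(x,v)\mapsto L_0(x,v,m)$ is of class $C^2$, and its second derivative is continuous in $(x,v,m)$. * **(M2)** For all $(x,v,m)$: $D_v^2L_0\ge \frac1{M_0}\mathrm{Id}$, $|D_xL_0|\le M_0(1+|v|^2)$, $|D_vL_0|\le M_0(1+|v|)$. * **(M3)** There are $\theta,\omega_0:[0,\infty)\to[0,\infty)$, $\theta$ nondecreasing and $\omega_0(r)\to 0$ as $r\to0$, with $|L_0(x,v,m_1)-L_0(x,v,m_2)|\le\theta(|x|)\,\omega_0(d_1(m_1,m_2))$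 for all $x,v,m_1,m_2$. * **(BC1)** $\mu_0$ is a probability measure, absolutely continuous with respect to Lebesgue measure, with compact support. * **(BC2)** For every $m$, $g(\cdot,m)$ is bounded and $C^1$ with bounded, uniformly continuous derivative, and $M_0\ge\max\{\frac12,\frac12\|Dg(\cdot,m)\|_\infty\}$; for every $x$, $g(x,\cdot)$ is uniformly continuous on $(\mathcal P_1(\mathbb R^d),d_1)$. Let $\Gamma_t(x)$ be the set of $C^1$ curves $\gamma:[0,T]\to\mathbb R^d$ with $\gamma(t)=x$, and $\Gamma_t(x,v)$ the set of those with moreover $\dot\gamma(t)=v$. For every $\varepsilon>0$ let $(u^\varepsilon,\mu^\varepsilon)\in W^{1,\infty}_{loc}([0,T]\times\mathbb R^{2d})\times C([0,T];\mathcal P_1(\mathbb R^{2d}))$ be a solution of $$\begin{cases}-\partial_tu^\varepsilon+\frac1{2\varepsilon}|D_vu^\varepsilon|^2-\langle D_xu^\varepsilon,v\rangle-L_0(x,v,m^\varepsilon_t)=0,\\ \partial_t\mu^\varepsilon_t+\langle D_x\mu^\varepsilon_t,v\rangle-\frac1\varepsilon\mathrm{div}_v(\mu^\varepsilon_tD_vu^\varepsilon)=0,\\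 \mu^\varepsilon_0=\mu_0,\quad u^\varepsilon(T,x,v)=g(x,m^\varepsilon_T),\end{cases}$$ where $m^\varepsilon_t$ is the image of $\mu^\varepsilon_t$ under $(x,v)\mapsto x$, the first equation holds in the viscosity sense and the second in the sense of distributions, such that for every $t\in[0,T]$ the measure $\mu^\varepsilon_t$ is the image of $\mu_0$ under the flow $\dot\gamma=v$, $\dot v=-\frac1\varepsilon D_vu^\varepsilon(t,\gamma,v)$ (defined for $\mu_0$-a.e. initial point), and $$u^\varepsilon(t,x,v)=\inf_{\gamma\in\Gamma_t(x,v)}J^\varepsilon_{t,T}(\gamma),\qquad J^\varepsilon_{t,T}(\gamma)=\int_t^T\Big(\frac\varepsilon2|\ddot\gamma(s)|^2+L_0(\gamma(s),\dot\gamma(s),m^\varepsilon_s)\Big)ds+g(\gamma(T),m^\varepsilon_T)$$ if $\gamma\in H^2(0,T;\mathbb R^d)$, and $J^\varepsilon_{t,T}(\gamma)=+\infty$ otherwise. Let $\varepsilon_k>0$, $\varepsilon_k\to0$, and $m^0\in C([0,T];\mathcal P_1(\mathbb R^d))$ be such that $\sup_{s\in[0,T]}d_1(m^{\varepsilon_k}_s,m^0_s)\to0$,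 and put $$u^0(t,x)=\inf_{\gamma\in\Gamma_t(x)}\Big\{\int_t^TL_0(\gamma(s),\dot\gamma(s),m^0_s)\,ds+g(\gamma(T),m^0_T)\Big\}.\tag{1}$$ **Proposition.** Let $(t,x,v)\in[0,T]\times\mathbb R^{2d}$ be such that $u^0:[0,T]\times\mathbb R^d\to\mathbb R$ is differentiable at $(t,x)$ (relative to $[0,T]\times\mathbb R^d$), and for every $k$ let $\gamma^{\varepsilon_k}$ be a minimizer for $u^{\varepsilon_k}(t,x,v)$. Then the whole sequence $\gamma^{\varepsilon_k}$ converges uniformly on $[t,T]$ to a curve $\gamma^0\in AC([0,T];\mathbb R^d)$; moreover $\gamma^0\in\Gamma_t(x)$, it attains the infimum in (1), and it is the unique minimizer, i.e. every minimizer of (1) in $\Gamma_t(x)$ coincides with $\gamma^0$ on $[t,T]$. -/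

import Mathlib

open MeasureTheory Set Filter Topology
open scoped ENNReal ContDiff

noncomputable section

namespace SingularMFG

/-- The Euclidean space `ℝ^d`. -/
abbrev E (d : ℕ) : Type := EuclideanSpace ℝ (Fin d)

/-- `P_1(X)`: the Borel probability measures on `X` with finite first moment. -/
def P1 (X : Type) [PseudoEMetricSpace X] [MeasurableSpace X] : Type :=
  {m : Measure X // IsProbabilityMeasure m ∧ ∃ x₀ : X, ∫⁻ x, edist x₀ x ∂m < ⊤}

/-- The Wasserstein distance `d_1`: the infimum of the transport cost over all transport plans
(measures on the product with the given marginals). -/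
def W1 {X : Type} [PseudoEMetricSpace X] [MeasurableSpace X] (m m' : P1 X) : ℝ :=
  (⨅ (lam : Measure (X × X)) (_ : lam.map Prod.fst = m.1 ∧ lam.map Prod.snd = m'.1),
    ∫⁻ p, edist p.1 p.2 ∂lam).toReal

/-- The space marginal `π_1 ♯ μ` of a measure on `ℝ^d × ℝ^d`. -/
def P1.fst {d : ℕ} (μ : P1 (E d × E d)) : P1 (E d) :=
  ⟨μ.1.map Prod.fst, by
    obtain ⟨μ, hμ, x₀, hx₀⟩ := μ
    refine ⟨Measure.isProbabilityMeasure_map measurable_fst.aemeasurable, x₀.1, ?_⟩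
    rw [lintegral_map (by fun_prop) measurable_fst]
    refine lt_of_le_of_lt (lintegral_mono fun x => ?_) hx₀
    rw [Prod.edist_eq]
    exact le_max_left _ _⟩

/-- `m ∈ C([0,T]; P_1(X))`. Flows of measures are indexed by `ℝ`; only times in `[0,T]` matter. -/
def ContinuousFlow {X : Type} [PseudoEMetricSpace X] [MeasurableSpace X]
    (T : ℝ) (m : ℝ → P1 X) : Prop :=
  ∀ s ∈ Icc 0 T, ∀ η > 0, ∃ δ > 0, ∀ r ∈ Icc 0 T, |r - s| < δ → W1 (m r) (m s) < η

/-- Joint continuity in `(x, v, m) ∈ ℝ^d × ℝ^d × P_1(ℝ^d)`. -/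
def JointlyContinuous {d : ℕ} {V : Type} [PseudoMetricSpace V]
    (F : E d → E d → P1 (E d) → V) : Prop :=
  ∀ x v m, ∀ η > 0, ∃ δ > 0, ∀ y w n,
    dist y x < δ → dist w v < δ → W1 n m < δ → dist (F y w n) (F x v m) < η

/-! ### Assumptions on the data -/

/-- Regularity of the Lagrangian: continuous in all variables, of class `C²` in `(x,v)`, with
second derivative in `(x,v)` continuous in all variables. -/
structure LagrangianRegular {d : ℕ} (L : E d → E d → P1 (E d) → ℝ) : Prop where
  cont : JointlyContinuous L
  smooth : ∀ m, ContDiff ℝ 2 (fun q : E d × E d => L q.1 q.2 m)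
  cont_second : JointlyContinuous fun x v m =>
    fderiv ℝ (fderiv ℝ (fun q : E d × E d => L q.1 q.2 m)) (x, v)

/-- Uniform convexity in the velocity and growth of the first derivatives. -/
structure LagrangianConvexGrowth {d : ℕ} (M₀ : ℝ) (L : E d → E d → P1 (E d) → ℝ) : Prop where
  pos : 0 < M₀
  convex : ∀ x v m w, (1 / M₀) * ‖w‖ ^ 2 ≤ fderiv ℝ (fderiv ℝ (fun v' => L x v' m)) v w w
  grad_x : ∀ x v m, ‖fderiv ℝ (fun y => L y v m) x‖ ≤ M₀ * (1 + ‖v‖ ^ 2)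
  grad_v : ∀ x v m, ‖fderiv ℝ (fun v' => L x v' m) v‖ ≤ M₀ * (1 + ‖v‖)

/-- Continuity of the Lagrangian in the measure. Of the modulus `θ` only monotonicity is required,
and of the modulus `ω₀` only that it tends to `0` at `0`. -/
def LagrangianMeasureModulus {d : ℕ} (L : E d → E d → P1 (E d) → ℝ) : Prop :=
  ∃ θ ω₀ : ℝ → ℝ, (∀ r, 0 ≤ r → 0 ≤ θ r) ∧ (∀ r, 0 ≤ r → 0 ≤ ω₀ r) ∧
    MonotoneOn θ (Ici 0) ∧ Tendsto ω₀ (𝓝[≥] 0) (𝓝 0) ∧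
    ∀ x v m₁ m₂, |L x v m₁ - L x v m₂| ≤ θ ‖x‖ * ω₀ (W1 m₁ m₂)

/-- The initial distribution is a compactly supported probability measure on `ℝ^d × ℝ^d`,
absolutely continuous with respect to Lebesgue measure. -/
structure InitialDatum {d : ℕ} (μ₀ : Measure (E d × E d)) : Prop where
  prob : IsProbabilityMeasure μ₀
  ac : μ₀ ≪ volume
  compact_support : ∃ K : Set (E d × E d), IsCompact K ∧ μ₀ Kᶜ = 0

/-- The terminal cost: `g(·,m) ∈ C¹_b` with `M₀ ≥ max {1/2, ‖Dg(·,m)‖_∞ / 2}`, and `g(x,·)` is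
uniformly continuous. -/
structure TerminalCost {d : ℕ} (M₀ : ℝ) (g : E d → P1 (E d) → ℝ) : Prop where
  smooth : ∀ m, ContDiff ℝ 1 (fun x => g x m)
  bounded : ∀ m, ∃ C, ∀ x, |g x m| ≤ C
  grad_uc : ∀ m, UniformContinuous (fderiv ℝ (fun x => g x m))
  half_le : 1 / 2 ≤ M₀
  grad_le : ∀ m x, 1 / 2 * ‖fderiv ℝ (fun y => g y m) x‖ ≤ M₀
  unif_cont : ∀ x, ∀ η > 0, ∃ δ > 0, ∀ m m', W1 m m' < δ → |g x m - g x m'| < η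

/-! ### Curves and value functions -/

/-- The velocity of a curve `γ : [0,T] → ℝ^d` (one-sided at the endpoints). -/
def vel {d : ℕ} (T : ℝ) (γ : ℝ → E d) (s : ℝ) : E d := derivWithin γ (Icc 0 T) s

/-- The acceleration of a curve `γ : [0,T] → ℝ^d`. -/
def acc {d : ℕ} (T : ℝ) (γ : ℝ → E d) (s : ℝ) : E d := derivWithin (vel T γ) (Icc 0 T) s

/-- `Γ_t(x)`: the `C¹` curves on `[0,T]` with `γ(t) = x`. -/
def curves {d : ℕ} (T t : ℝ) (x : E d) : Set (ℝ → E d) :=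
  {γ | ContDiffOn ℝ 1 γ (Icc 0 T) ∧ γ t = x}

/-- `Γ_t(x,v)`: the `C¹` curves on `[0,T]` with `γ(t) = x` and `γ'(t) = v`. -/
def curvesVel {d : ℕ} (T t : ℝ) (x v : E d) : Set (ℝ → E d) :=
  {γ | γ ∈ curves T t x ∧ vel T γ t = v}

/-- A `C¹` curve `γ` belongs to `H²(0,T)`: its velocity is the integral of its acceleration, which
is square integrable. -/
def IsH2 {d : ℕ} (T : ℝ) (γ : ℝ → E d) : Prop :=
  MemLp (acc T γ) 2 (volume.restrict (Icc 0 T)) ∧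
    ∀ s ∈ Icc 0 T, vel T γ s = vel T γ 0 + ∫ r in (0 : ℝ)..s, acc T γ r

/-- The curves of `Γ_t(x,v)` at which the functional `J^ε` is finite, that is, those in `H²`. -/
def admissible {d : ℕ} (T t : ℝ) (x v : E d) : Set (ℝ → E d) :=
  {γ | γ ∈ curvesVel T t x v ∧ IsH2 T γ}

/-- The functional `J^ε_{t,T}` on `H²` curves (it is `+∞` on the others), for a flow `m`. -/
def costEps {d : ℕ} (T ε : ℝ) (L : E d → E d → P1 (E d) → ℝ) (g : E d → P1 (E d) → ℝ)
    (m : ℝ → P1 (E d)) (t : ℝ) (γ : ℝ → E d) : ℝ :=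
  (∫ s in t..T, (ε / 2 * ‖acc T γ s‖ ^ 2 + L (γ s) (vel T γ s) (m s))) + g (γ T) (m T)

/-- The functional of the limit problem. -/
def costLim {d : ℕ} (T : ℝ) (L : E d → E d → P1 (E d) → ℝ) (g : E d → P1 (E d) → ℝ)
    (m : ℝ → P1 (E d)) (t : ℝ) (γ : ℝ → E d) : ℝ :=
  (∫ s in t..T, L (γ s) (vel T γ s) (m s)) + g (γ T) (m T)

/-- `u⁰(t,x)`: the infimum of the limit functional over `Γ_t(x)`. -/
def valueLim {d : ℕ} (T : ℝ) (L : E d → E d → P1 (E d) → ℝ) (g : E d → P1 (E d) → ℝ)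
    (m : ℝ → P1 (E d)) (t : ℝ) (x : E d) : ℝ :=
  sInf (costLim T L g m t '' curves T t x)

/-- `γ` is a minimizer for `u^ε(t,x,v)`. -/
def IsMinimizerEps {d : ℕ} (T ε : ℝ) (L : E d → E d → P1 (E d) → ℝ) (g : E d → P1 (E d) → ℝ)
    (m : ℝ → P1 (E d)) (t : ℝ) (x v : E d) (γ : ℝ → E d) : Prop :=
  γ ∈ admissible T t x v ∧ IsMinOn (costEps T ε L g m t) (admissible T t x v) γ

/-- `γ` is a minimizer for `u⁰(t,x)`. -/
def IsMinimizerLim {d : ℕ} (T : ℝ) (L : E d → E d → P1 (E d) → ℝ) (g : E d → P1 (E d) → ℝ)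
    (m : ℝ → P1 (E d)) (t : ℝ) (x : E d) (γ : ℝ → E d) : Prop :=
  γ ∈ curves T t x ∧ IsMinOn (costLim T L g m t) (curves T t x) γ

/-! ### The mean field game system with control of the acceleration -/

/-- `u` is a viscosity solution on `(0,T) × ℝ^d × ℝ^d` of
`-∂_t u + |D_v u|² / (2ε) - ⟨D_x u, v⟩ - L(x, v, m_t) = 0`. -/
def IsViscositySolution {d : ℕ} (T ε : ℝ) (L : E d → E d → P1 (E d) → ℝ)
    (m : ℝ → P1 (E d)) (u : ℝ → E d → E d → ℝ) : Prop :=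
  ∀ φ : ℝ × E d × E d → ℝ, ContDiff ℝ 1 φ → ∀ t ∈ Ioo 0 T, ∀ x v : E d,
    (IsLocalMax (fun q : ℝ × E d × E d => u q.1 q.2.1 q.2.2 - φ q) (t, x, v) →
      -fderiv ℝ φ (t, x, v) (1, 0, 0) + 1 / (2 * ε) * ‖fderiv ℝ (fun w => φ (t, x, w)) v‖ ^ 2
        - fderiv ℝ φ (t, x, v) (0, v, 0) - L x v (m t) ≤ 0) ∧
    (IsLocalMin (fun q : ℝ × E d × E d => u q.1 q.2.1 q.2.2 - φ q) (t, x, v) →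
      0 ≤ -fderiv ℝ φ (t, x, v) (1, 0, 0) + 1 / (2 * ε) * ‖fderiv ℝ (fun w => φ (t, x, w)) v‖ ^ 2
        - fderiv ℝ φ (t, x, v) (0, v, 0) - L x v (m t))

/-- The gradient `D_v u(t,x,v)`. -/
def gradV {d : ℕ} (u : ℝ → E d → E d → ℝ) (t : ℝ) (z : E d × E d) : E d :=
  gradient (fun w => u t z.1 w) z.2

/-- `μ` solves, in the sense of distributions on `[0,T) × ℝ^d × ℝ^d`, the continuity equation
`∂_t μ + ⟨D_x μ, v⟩ - (1/ε) div_v (μ D_v u) = 0` with initial datum `μ₀`. -/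
def SolvesContinuityEquation {d : ℕ} (T ε : ℝ) (μ₀ : Measure (E d × E d))
    (u : ℝ → E d → E d → ℝ) (μ : ℝ → P1 (E d × E d)) : Prop :=
  ∀ φ : ℝ × E d × E d → ℝ, ContDiff ℝ ∞ φ → HasCompactSupport φ →
    tsupport φ ⊆ Iio T ×ˢ univ →
    (∫ s in (0 : ℝ)..T, ∫ z : E d × E d,
        fderiv ℝ φ (s, z) (1, z.2, -(1 / ε) • gradV u s z) ∂(μ s).1)
      + ∫ z : E d × E d, φ (0, z) ∂μ₀ = 0

/-- For every `t ∈ [0,T]`, `μ_t` is the image of `μ₀` under the flow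
`γ' = v`, `v' = -(1/ε) D_v u(t, γ, v)`, defined for `μ₀`-almost every initial point. -/
def IsFlowImage {d : ℕ} (T ε : ℝ) (μ₀ : Measure (E d × E d))
    (u : ℝ → E d → E d → ℝ) (μ : ℝ → P1 (E d × E d)) : Prop :=
  ∃ Φ : ℝ → E d × E d → E d × E d,
    (∀ t ∈ Icc 0 T, AEMeasurable (Φ t) μ₀ ∧ (μ t).1 = μ₀.map (Φ t)) ∧
    ∀ᵐ z ∂μ₀, Φ 0 z = z ∧ ContinuousOn (fun t => Φ t z) (Icc 0 T) ∧
      ∀ t ∈ Ioo 0 T, DifferentiableAt ℝ (fun w => u t (Φ t z).1 w) (Φ t z).2 ∧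
        HasDerivAt (fun s => Φ s z) ((Φ t z).2, -(1 / ε) • gradV u t (Φ t z)) t

/-- `(u, μ)` is a solution in `W^{1,∞}_loc([0,T] × ℝ^{2d}) × C([0,T]; P_1(ℝ^{2d}))` of the mean
field game system with parameter `ε`, where `u` is the value function of the control problem and
`μ` is transported by the optimal flow. -/
structure IsMFGSolution {d : ℕ} (T ε : ℝ) (L : E d → E d → P1 (E d) → ℝ)
    (g : E d → P1 (E d) → ℝ) (μ₀ : Measure (E d × E d))
    (u : ℝ → E d → E d → ℝ) (μ : ℝ → P1 (E d × E d)) : Prop where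
  continuous : ContinuousFlow T μ
  initial : (μ 0).1 = μ₀
  terminal : ∀ x v, u T x v = g x (μ T).fst
  lipschitz : ∀ R : ℝ, ∃ K, LipschitzOnWith K (fun q : ℝ × E d × E d => u q.1 q.2.1 q.2.2)
    (Icc 0 T ×ˢ Metric.closedBall 0 R ×ˢ Metric.closedBall 0 R)
  hamilton_jacobi : IsViscositySolution T ε L (fun s => (μ s).fst) u
  continuity_equation : SolvesContinuityEquation T ε μ₀ u μ
  value : ∀ t ∈ Icc 0 T, ∀ x v,
    IsGLB (costEps T ε L g (fun s => (μ s).fst) t '' admissible T t x v) (u t x v)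
  flow : IsFlowImage T ε μ₀ u μ

end SingularMFG

end

open SingularMFG

/-! ### Pointwise estimates for a Tonelli Lagrangian, its velocities and momenta -/

section Pointwise

variable {V : Type*} [NormedAddCommGroup V] [InnerProductSpace ℝ V]

/-! Freeze the limit flow: put ℓ(s,x,v) = L(x,v,m⁰_s), G = g(·,m⁰_T), U = u⁰(t,·), and describe a
curve c by its initial point and its L² velocity f. Its momentum is P(s) = -(DG(c(T)) + ∫_s^T D_xℓ),
and the Euler–Lagrange equation says that the defect D_vℓ - P vanishes. Classically, if U is
differentiable at x, translating a minimizer gives P(t) = -DU(x). All minimizers from x then solve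
the same Cauchy problem for (c,P), so there is at most one.

The proof makes this argument quantitative for near minimizers, with completeness in place of weak
compactness of curves. By Ekeland's principle in L², a curve whose action is within δ² of U(x) is
δ-close to one whose defect is at most δ in L² (`exists_approx_extremal`). Translating such an
approximate extremal and using differentiability of U forces its initial momentum close to -DU(x)
(`exists_initial_momentum_close`). Grönwall's inequality for (c,P), with the defect as a forcing
term, shows that two approximate extremals with close initial momenta stay close
(`exists_extremal_close`). Hence near minimizers from x are uniformly close to one another
(`near_minimizers_close`).

Everything follows from this. Approximate extremals with δ → 0 form a Cauchy sequence, and the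
Legendre transform turns the limit of (c,P) into a continuous velocity, so the infimum is attained
by a C¹ curve (`exists_continuous_minimizer`). Exact minimizers are near minimizers at every level,
whence uniqueness. The minimizers of the perturbed problems form a minimizing sequence of the limit
problem (`eventually_action_vel_le`): a velocity in L² can be approximated by C¹ velocities with
initial value v, so the constraint γ'(t) = v costs nothing in the limit and the acceleration of a
fixed competitor is killed by ε. Thus the whole sequence converges. -/

/-- A time-dependent Lagrangian, uniformly convex in the velocity, with its partial derivatives,
and a Lipschitz terminal cost of class `C¹`. -/
structure TonelliProblem (M : ℝ) (ℓ : ℝ → V → V → ℝ) (Dx Dv : ℝ → V → V → V →L[ℝ] ℝ)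
    (G : V → ℝ) (DG : V → V →L[ℝ] ℝ) : Prop where
  pos : 0 < M
  cont : Continuous fun q : ℝ × V × V => ℓ q.1 q.2.1 q.2.2
  cont_dx : Continuous fun q : ℝ × V × V => Dx q.1 q.2.1 q.2.2
  cont_dv : Continuous fun q : ℝ × V × V => Dv q.1 q.2.1 q.2.2
  hasFDerivAt : ∀ s x v, HasFDerivAt (fun q : V × V => ℓ s q.1 q.2)
    ((Dx s x v).coprod (Dv s x v)) (x, v)
  strong_mono : ∀ s x v w, (1 / M) * ‖w - v‖ ^ 2 ≤ (Dv s x w - Dv s x v) (w - v)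
  lip : ∀ R : ℝ, ∃ C : ℝ, 0 ≤ C ∧ ∀ s x y v w, ‖x‖ ≤ R → ‖y‖ ≤ R → ‖v‖ ≤ R → ‖w‖ ≤ R →
    ‖Dx s x v - Dx s y w‖ ≤ C * (‖x - y‖ + ‖v - w‖) ∧
    ‖Dv s x v - Dv s y w‖ ≤ C * (‖x - y‖ + ‖v - w‖)
  dx_le : ∀ s x v, ‖Dx s x v‖ ≤ M * (1 + ‖v‖ ^ 2)
  dv_le : ∀ s x v, ‖Dv s x v‖ ≤ M * (1 + ‖v‖)
  bdd : ∃ A : ℝ, 0 ≤ A ∧ ∀ s, |ℓ s 0 0| ≤ A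
  hasFDerivAt_terminal : ∀ x, HasFDerivAt G (DG x) x
  dg_le : ∀ x, ‖DG x‖ ≤ 2 * M
  dg_uc : UniformContinuous DG

namespace TonelliProblem

variable {M : ℝ} {ℓ : ℝ → V → V → ℝ} {Dx Dv : ℝ → V → V → V →L[ℝ] ℝ}
  {G : V → ℝ} {DG : V → V →L[ℝ] ℝ}

lemma hasFDerivAt_left (h : TonelliProblem M ℓ Dx Dv G DG) (s : ℝ) (x v : V) :
    HasFDerivAt (fun y => ℓ s y v) (Dx s x v) x := by
  have h1 := HasFDerivAt.comp (f := fun y : V => (y, v)) x (h.hasFDerivAt s x v)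
    (hasFDerivAt_prodMk_left x v)
  simpa [Function.comp_def, ContinuousLinearMap.coprod_comp_inl] using h1

lemma hasFDerivAt_right (h : TonelliProblem M ℓ Dx Dv G DG) (s : ℝ) (x v : V) :
    HasFDerivAt (fun w => ℓ s x w) (Dv s x v) v := by
  have h1 := HasFDerivAt.comp (f := fun w : V => (x, w)) v (h.hasFDerivAt s x v)
    (hasFDerivAt_prodMk_right x v)
  simpa [Function.comp_def, ContinuousLinearMap.coprod_comp_inr] using h1

lemma abs_sub_le_left (h : TonelliProblem M ℓ Dx Dv G DG) (s : ℝ) (x y v : V) :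
    |ℓ s x v - ℓ s y v| ≤ M * (1 + ‖v‖ ^ 2) * ‖x - y‖ :=
  convex_univ.norm_image_sub_le_of_norm_hasFDerivWithin_le (𝕜 := ℝ)
    (fun z _ => (h.hasFDerivAt_left s z v).hasFDerivWithinAt) (fun z _ => h.dx_le s z v)
    (mem_univ y) (mem_univ x)

lemma abs_sub_le_right (h : TonelliProblem M ℓ Dx Dv G DG) (s : ℝ) (x v w : V) :
    |ℓ s x v - ℓ s x w| ≤ M * (1 + ‖v‖ + ‖w‖) * ‖v - w‖ := by
  have hM := h.pos
  refine (convex_closedBall (0 : V) (‖v‖ + ‖w‖)).norm_image_sub_le_of_norm_hasFDerivWithin_le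
    (𝕜 := ℝ) (fun z _ => (h.hasFDerivAt_right s x z).hasFDerivWithinAt) (fun z hz => ?_) ?_ ?_
  · rw [mem_closedBall_zero_iff] at hz
    refine (h.dv_le s x z).trans (mul_le_mul_of_nonneg_left (by linarith) hM.le)
  · simp
  · simp

lemma abs_terminal_sub_le (h : TonelliProblem M ℓ Dx Dv G DG) (x y : V) :
    |G x - G y| ≤ 2 * M * ‖x - y‖ :=
  convex_univ.norm_image_sub_le_of_norm_hasFDerivWithin_le (𝕜 := ℝ)
    (fun z _ => (h.hasFDerivAt_terminal z).hasFDerivWithinAt) (fun z _ => h.dg_le z)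
    (mem_univ y) (mem_univ x)

lemma abs_le (h : TonelliProblem M ℓ Dx Dv G DG) {A : ℝ} (hA : ∀ s, |ℓ s 0 0| ≤ A) (s : ℝ)
    (x v : V) : |ℓ s x v| ≤ A + M * ‖x‖ + M * (1 + ‖v‖) * ‖v‖ := by
  have h1 := _root_.abs_le.1 (h.abs_sub_le_right s x v 0)
  have h2 := _root_.abs_le.1 (h.abs_sub_le_left s x 0 0)
  have h3 := _root_.abs_le.1 (hA s)
  simp only [norm_zero, sub_zero, add_zero, ne_eq, OfNat.ofNat_ne_zero, not_false_eq_true,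
    zero_pow, mul_one] at h1 h2
  rw [_root_.abs_le]
  constructor <;> linarith [h1.1, h1.2, h2.1, h2.2, h3.1, h3.2]

/-- Along the segment from v to w, subtract the tangent line and the parabola from ℓ. Strong
monotonicity of D_vℓ makes the remainder φ nondecreasing on [0,1]. -/
lemma quadratic_lower (h : TonelliProblem M ℓ Dx Dv G DG) (s : ℝ) (x v w : V) :
    ℓ s x v + Dv s x v (w - v) + 1 / (2 * M) * ‖w - v‖ ^ 2 ≤ ℓ s x w := by
  have hM := h.pos
  set φ : ℝ → ℝ := fun τ =>
    ℓ s x (v + τ • (w - v)) - τ * Dv s x v (w - v) - τ ^ 2 * (1 / (2 * M) * ‖w - v‖ ^ 2)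
  have hd : ∀ τ, HasDerivAt φ (Dv s x (v + τ • (w - v)) (w - v) - Dv s x v (w - v)
      - 2 * τ * (1 / (2 * M) * ‖w - v‖ ^ 2)) τ := by
    intro τ
    have h1 : HasDerivAt (fun τ : ℝ => v + τ • (w - v)) (w - v) τ := by
      simpa using ((hasDerivAt_id τ).smul_const (w - v)).const_add v
    have h2 := (h.hasFDerivAt_right s x (v + τ • (w - v))).comp_hasDerivAt τ h1
    have h3 : HasDerivAt (fun τ : ℝ => τ * Dv s x v (w - v)) (Dv s x v (w - v)) τ := by
      simpa using (hasDerivAt_id τ).mul_const (Dv s x v (w - v))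
    have h4 : HasDerivAt (fun τ : ℝ => τ ^ 2 * (1 / (2 * M) * ‖w - v‖ ^ 2))
        (2 * τ * (1 / (2 * M) * ‖w - v‖ ^ 2)) τ := by
      simpa using (hasDerivAt_pow 2 τ).mul_const (1 / (2 * M) * ‖w - v‖ ^ 2)
    exact (h2.sub h3).sub h4
  have hmono : MonotoneOn φ (Icc 0 1) := by
    refine monotoneOn_of_deriv_nonneg (convex_Icc 0 1)
      (fun τ _ => (hd τ).continuousAt.continuousWithinAt)
      (fun τ _ => (hd τ).differentiableAt.differentiableWithinAt) (fun τ hτ => ?_)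
    rw [interior_Icc] at hτ
    rw [(hd τ).deriv]
    have h1 := h.strong_mono s x v (v + τ • (w - v))
    rw [add_sub_cancel_left, map_smul, norm_smul, smul_eq_mul, Real.norm_eq_abs,
      abs_of_pos hτ.1] at h1
    have h2 : τ * (1 / M * τ * ‖w - v‖ ^ 2) ≤ τ * ((Dv s x (v + τ • (w - v)) - Dv s x v) (w - v)) := by
      refine le_trans (le_of_eq ?_) h1
      ring
    have h3 := le_of_mul_le_mul_left h2 hτ.1
    rw [sub_apply] at h3
    have h4 : 2 * τ * (1 / (2 * M) * ‖w - v‖ ^ 2) = 1 / M * τ * ‖w - v‖ ^ 2 := by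
      field_simp
    rw [h4]
    linarith
  have := hmono (left_mem_Icc.2 zero_le_one) (right_mem_Icc.2 zero_le_one) zero_le_one
  simp only [φ, zero_smul, add_zero, one_smul, add_sub_cancel] at this
  linarith

/-- Expand at zero velocity, where both first derivatives are bounded by M; hence only linear losses
in ‖x‖ and ‖v‖. -/
lemma coercive (h : TonelliProblem M ℓ Dx Dv G DG) {A : ℝ} (hA : ∀ s, |ℓ s 0 0| ≤ A) (s : ℝ)
    (x v : V) : -A - M * ‖x‖ - M * ‖v‖ + 1 / (2 * M) * ‖v‖ ^ 2 ≤ ℓ s x v := by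
  have h1 := h.quadratic_lower s x 0 v
  have h2 := _root_.abs_le.1 (h.abs_sub_le_left s x 0 0)
  have h3 := _root_.abs_le.1 (hA s)
  have h4 := _root_.abs_le.1 ((Dv s x 0).le_of_opNorm_le (h.dv_le s x 0) v)
  simp only [norm_zero, sub_zero, add_zero, ne_eq, OfNat.ofNat_ne_zero, not_false_eq_true,
    zero_pow, mul_one] at h1 h2 h4
  linarith [h2.1, h3.1, h4.1]

/-- Strong monotonicity makes the inverse of v ↦ D_vℓ Lipschitz with constant M. This replaces
regularity of the Hamiltonian throughout. -/
lemma norm_sub_le_dv (h : TonelliProblem M ℓ Dx Dv G DG) (s : ℝ) (x v w : V) :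
    ‖w - v‖ ≤ M * ‖Dv s x w - Dv s x v‖ := by
  have hM := h.pos
  rcases (norm_nonneg (w - v)).eq_or_lt with h0 | h0
  · rw [← h0]; positivity
  have h1 := (h.strong_mono s x v w).trans
    ((le_abs_self _).trans ((Dv s x w - Dv s x v).le_opNorm (w - v)))
  have h2 : 1 / M * ‖w - v‖ ≤ ‖Dv s x w - Dv s x v‖ :=
    le_of_mul_le_mul_right (by linarith) h0
  have h3 := mul_le_mul_of_nonneg_left h2 hM.le
  rwa [← mul_assoc, mul_one_div_cancel hM.ne', one_mul] at h3

lemma norm_le_dv (h : TonelliProblem M ℓ Dx Dv G DG) (s : ℝ) (x v : V) :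
    ‖v‖ ≤ M * (‖Dv s x v‖ + M) := by
  have h1 := h.norm_sub_le_dv s x 0 v
  have h2 := h.dv_le s x 0
  rw [norm_zero, add_zero, mul_one] at h2
  rw [sub_zero] at h1
  refine h1.trans (mul_le_mul_of_nonneg_left ?_ h.pos.le)
  exact (norm_sub_le _ _).trans (by linarith)

/-- Velocities of approximate extremals are only in L². This bounds them by a bounded momentum P and
the defect, the quantity that is small in L². -/
lemma norm_le_of_momentum (h : TonelliProblem M ℓ Dx Dv G DG) {R : ℝ} {s : ℝ} {x v : V}
    {P : V →L[ℝ] ℝ} (hP : ‖P‖ ≤ R) :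
    ‖v‖ ≤ M * (R + M + 1) * (1 + ‖Dv s x v - P‖) := by
  have hM := h.pos
  have hR : 0 ≤ R := (norm_nonneg P).trans hP
  have h1 := h.norm_le_dv s x v
  have h2 : ‖Dv s x v‖ ≤ ‖Dv s x v - P‖ + ‖P‖ := by
    simpa using norm_add_le (Dv s x v - P) P
  have h3 := norm_nonneg (Dv s x v - P)
  calc ‖v‖ ≤ M * (‖Dv s x v‖ + M) := h1
    _ ≤ M * ((R + M + 1) * (1 + ‖Dv s x v - P‖)) := by
        gcongr
        nlinarith
    _ = _ := by ring

/-- Where the defect is at most 1 the velocity is bounded and D_xℓ is locally Lipschitz; where it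
exceeds 1 the quadratic growth of D_xℓ is absorbed by the squared defect. Both contributions are
integrable with small integral. -/
lemma exists_dx_shift_le (h : TonelliProblem M ℓ Dx Dv G DG) (R : ℝ) :
    ∃ C : ℝ, 0 ≤ C ∧ ∀ s x y v (P : V →L[ℝ] ℝ), ‖x‖ ≤ R → ‖y‖ ≤ R → ‖P‖ ≤ R →
      ‖Dx s y v - Dx s x v‖ ≤ C * (‖y - x‖ + ‖Dv s x v - P‖ ^ 2) := by
  have hM := h.pos
  rcases lt_or_ge R 0 with hR | hR
  · exact ⟨0, le_rfl, fun s x y v P hx => absurd (norm_nonneg x) (by linarith)⟩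
  set K := M * (R + M + 1) with hK
  have hK0 : 0 ≤ K := by positivity
  obtain ⟨C, hC0, hC⟩ := h.lip (max R (2 * K))
  refine ⟨max C (2 * M * (1 + 4 * K ^ 2)), le_max_of_le_left hC0,
    fun s x y v P hx hy hP => ?_⟩
  set e := ‖Dv s x v - P‖ with he
  have he0 : 0 ≤ e := norm_nonneg _
  have hv : ‖v‖ ≤ K * (1 + e) := h.norm_le_of_momentum hP
  rcases le_or_gt e 1 with h1 | h1
  · have hv' : ‖v‖ ≤ max R (2 * K) := le_max_of_le_right (by nlinarith)
    have := (hC s y x v v (le_max_of_le_left hy) (le_max_of_le_left hx) hv' hv').1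
    rw [sub_self, norm_zero, add_zero] at this
    refine this.trans (mul_le_mul (le_max_left _ _) (by linarith [sq_nonneg e])
      (norm_nonneg _) (le_max_of_le_left hC0))
  · have hv' : ‖v‖ ≤ 2 * K * e := hv.trans (by nlinarith)
    have hv2 : ‖v‖ ^ 2 ≤ 4 * K ^ 2 * e ^ 2 := by
      calc ‖v‖ ^ 2 ≤ (2 * K * e) ^ 2 := by gcongr
        _ = _ := by ring
    have he2 : 1 ≤ e ^ 2 := by nlinarith
    calc ‖Dx s y v - Dx s x v‖ ≤ ‖Dx s y v‖ + ‖Dx s x v‖ := norm_sub_le _ _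
      _ ≤ M * (1 + ‖v‖ ^ 2) + M * (1 + ‖v‖ ^ 2) := add_le_add (h.dx_le _ _ _) (h.dx_le _ _ _)
      _ ≤ M * (e ^ 2 + 4 * K ^ 2 * e ^ 2) + M * (e ^ 2 + 4 * K ^ 2 * e ^ 2) := by gcongr
      _ = (2 * M * (1 + 4 * K ^ 2)) * e ^ 2 := by ring
      _ ≤ max C (2 * M * (1 + 4 * K ^ 2)) * (‖y - x‖ + e ^ 2) :=
        mul_le_mul (le_max_right _ _) (by linarith [norm_nonneg (y - x)]) (sq_nonneg e)
          (le_max_of_le_left hC0)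

-- Lipschitz estimate for the system satisfied by (c,P), with the defects as perturbations: the
-- input of Grönwall's inequality. The dichotomy on the size of the defects makes up for derivatives
-- that are only locally Lipschitz.
set_option maxHeartbeats 1000000 in
lemma exists_compare (h : TonelliProblem M ℓ Dx Dv G DG) (R : ℝ) :
    ∃ C : ℝ, 0 ≤ C ∧ ∀ s x y v w (P Q : V →L[ℝ] ℝ), ‖x‖ ≤ R → ‖y‖ ≤ R → ‖P‖ ≤ R → ‖Q‖ ≤ R →
      ‖v - w‖ ≤ C * (‖x - y‖ + ‖P - Q‖ + ‖Dv s x v - P‖ + ‖Dv s y w - Q‖) ∧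
      ‖Dx s x v - Dx s y w‖ ≤ C * (‖x - y‖ + ‖P - Q‖ + ‖Dv s x v - P‖ + ‖Dv s y w - Q‖
        + ‖Dv s x v - P‖ ^ 2 + ‖Dv s y w - Q‖ ^ 2) := by
  have hM := h.pos
  rcases lt_or_ge R 0 with hR | hR
  · exact ⟨0, le_rfl, fun s x y v w P Q hx => absurd (norm_nonneg x) (by linarith)⟩
  obtain ⟨K, hK⟩ : ∃ K, K = M * (R + M + 1) := ⟨_, rfl⟩
  have hK0 : 0 ≤ K := by rw [hK]; positivity
  obtain ⟨C, hC0, hC⟩ := h.lip (max R (2 * K))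
  -- In `C₁` and `C₂` the first summand serves the case of both defects at most 1, the second the
  -- opposite case.
  obtain ⟨C₁, hC₁⟩ : ∃ C₁, C₁ = M * (1 + C) + 3 * K := ⟨_, rfl⟩
  have hC₁0 : 0 ≤ C₁ := by rw [hC₁]; positivity
  obtain ⟨C₂, hC₂⟩ : ∃ C₂, C₂ = C * (1 + C₁) + 2 * M * (2 + 4 * K ^ 2) := ⟨_, rfl⟩
  have hC₂0 : 0 ≤ C₂ := by rw [hC₂]; positivity
  refine ⟨max C₁ C₂, le_max_of_le_left hC₁0, fun s x y v w P Q hx hy hP hQ => ?_⟩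
  have hv : ‖v‖ ≤ K * (1 + ‖Dv s x v - P‖) := hK ▸ h.norm_le_of_momentum hP
  have hw : ‖w‖ ≤ K * (1 + ‖Dv s y w - Q‖) := hK ▸ h.norm_le_of_momentum hQ
  have hmon := h.norm_sub_le_dv s x w v
  have htri : ‖Dv s x v - Dv s x w‖ ≤
      ‖P - Q‖ + ‖Dv s x v - P‖ + ‖Dv s y w - Q‖ + ‖Dv s y w - Dv s x w‖ := by
    have : Dv s x v - Dv s x w = (P - Q) + (Dv s x v - P) - (Dv s y w - Q)
        + (Dv s y w - Dv s x w) := by abel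
    rw [this]
    refine (norm_add_le _ _).trans (add_le_add ((norm_sub_le _ _).trans
      (add_le_add (norm_add_le _ _) le_rfl)) le_rfl)
  have hdx1 := h.dx_le s x v
  have hdx2 := h.dx_le s y w
  have he0 := norm_nonneg (Dv s x v - P)
  have hf0 := norm_nonneg (Dv s y w - Q)
  have hX0 := norm_nonneg (x - y)
  have hY0 := norm_nonneg (P - Q)
  have hCx := hC s y x w w
  have hCv := hC s x y v w
  rw [sub_self, norm_zero, add_zero, norm_sub_rev y x] at hCx
  generalize ‖Dv s x v - P‖ = e at *
  generalize ‖Dv s y w - Q‖ = f at *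
  generalize ‖x - y‖ = X at *
  generalize ‖P - Q‖ = Y at *
  suffices H : ‖v - w‖ ≤ C₁ * (X + Y + e + f) ∧
      ‖Dx s x v - Dx s y w‖ ≤ C₂ * (X + Y + e + f + e ^ 2 + f ^ 2) by
    refine ⟨H.1.trans ?_, H.2.trans ?_⟩ <;> gcongr
    · exact le_max_left _ _
    · exact le_max_right _ _
  by_cases hef : e ≤ 1 ∧ f ≤ 1
  · have hv' : ‖v‖ ≤ max R (2 * K) := le_max_of_le_right (by nlinarith [hef.1])
    have hw' : ‖w‖ ≤ max R (2 * K) := le_max_of_le_right (by nlinarith [hef.2])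
    have hx' := le_max_of_le_left (b := R) (c := 2 * K) hx
    have hy' := le_max_of_le_left (b := R) (c := 2 * K) hy
    have h1 := (hCx hy' hx' hw' hw').2
    have h2 := (hCv hx' hy' hv' hw').1
    have h3 : ‖v - w‖ ≤ C₁ * (X + Y + e + f) := by
      calc ‖v - w‖ ≤ M * (Y + e + f + C * X) :=
            hmon.trans (mul_le_mul_of_nonneg_left (htri.trans (by gcongr)) hM.le)
        _ ≤ M * ((1 + C) * (X + Y + e + f)) := by
            gcongr
            nlinarith [mul_nonneg hC0 hY0, mul_nonneg hC0 he0, mul_nonneg hC0 hf0]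
        _ = M * (1 + C) * (X + Y + e + f) := by ring
        _ ≤ C₁ * (X + Y + e + f) := by
            gcongr
            linarith
    refine ⟨h3, h2.trans ?_⟩
    calc C * (X + ‖v - w‖) ≤ C * (X + C₁ * (X + Y + e + f)) := by gcongr
      _ ≤ C * ((1 + C₁) * (X + Y + e + f + e ^ 2 + f ^ 2)) := by
          gcongr
          nlinarith [mul_nonneg hC₁0 (sq_nonneg e), mul_nonneg hC₁0 (sq_nonneg f),
            sq_nonneg e, sq_nonneg f]
      _ = C * (1 + C₁) * (X + Y + e + f + e ^ 2 + f ^ 2) := by ring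
      _ ≤ C₂ * (X + Y + e + f + e ^ 2 + f ^ 2) := by
          gcongr
          rw [hC₂]
          have : 0 ≤ 2 * M * (2 + 4 * K ^ 2) := by positivity
          linarith
  · have h1 : 1 ≤ e + f := by
      by_contra hc
      exact hef ⟨by linarith, by linarith⟩
    have h2 : 1 ≤ e ^ 2 + f ^ 2 := by
      by_contra hc
      refine hef ⟨?_, ?_⟩ <;> nlinarith
    have hv2 : ‖v‖ ^ 2 ≤ K ^ 2 * (2 + 2 * e ^ 2) := by
      calc ‖v‖ ^ 2 ≤ (K * (1 + e)) ^ 2 := by gcongr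
        _ = K ^ 2 * (1 + e) ^ 2 := by ring
        _ ≤ _ := by gcongr; nlinarith [sq_nonneg (1 - e)]
    have hw2 : ‖w‖ ^ 2 ≤ K ^ 2 * (2 + 2 * f ^ 2) := by
      calc ‖w‖ ^ 2 ≤ (K * (1 + f)) ^ 2 := by gcongr
        _ = K ^ 2 * (1 + f) ^ 2 := by ring
        _ ≤ _ := by gcongr; nlinarith [sq_nonneg (1 - f)]
    constructor
    · calc ‖v - w‖ ≤ ‖v‖ + ‖w‖ := norm_sub_le _ _
        _ ≤ K * (1 + e) + K * (1 + f) := add_le_add hv hw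
        _ = K * (2 + e + f) := by ring
        _ ≤ K * (3 * (X + Y + e + f)) := by gcongr; linarith
        _ = 3 * K * (X + Y + e + f) := by ring
        _ ≤ C₁ * (X + Y + e + f) := by
            gcongr
            rw [hC₁]
            have : 0 ≤ M * (1 + C) := by positivity
            linarith
    · calc ‖Dx s x v - Dx s y w‖ ≤ ‖Dx s x v‖ + ‖Dx s y w‖ := norm_sub_le _ _
        _ ≤ M * (1 + ‖v‖ ^ 2) + M * (1 + ‖w‖ ^ 2) := add_le_add hdx1 hdx2
        _ ≤ M * (1 + K ^ 2 * (2 + 2 * e ^ 2)) + M * (1 + K ^ 2 * (2 + 2 * f ^ 2)) := by gcongr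
        _ = M * (2 + K ^ 2 * (4 + 2 * (e ^ 2 + f ^ 2))) := by ring
        _ ≤ M * (2 * (e ^ 2 + f ^ 2) + K ^ 2 * (4 * (e ^ 2 + f ^ 2) + 2 * (e ^ 2 + f ^ 2))) := by
            gcongr
            · linarith
            · linarith
        _ ≤ (2 * M * (2 + 4 * K ^ 2)) * (e ^ 2 + f ^ 2) := by
            have : 0 ≤ M * (2 + 2 * K ^ 2) * (e ^ 2 + f ^ 2) := by positivity
            linarith
        _ ≤ C₂ * (X + Y + e + f + e ^ 2 + f ^ 2) := by
            gcongr
            · rw [hC₂]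
              have : 0 ≤ C * (1 + C₁) := by positivity
              linarith
            · linarith

end TonelliProblem

end Pointwise

/-! ### Curves with L² velocity -/

section Curves

variable {V : Type*} [NormedAddCommGroup V]

variable {a b : ℝ} {f f' : ℝ → V}

lemma MeasureTheory.MemLp.intervalIntegrable_of_two (hab : a ≤ b)
    (hf : MemLp f 2 (volume.restrict (Ioc a b))) : IntervalIntegrable f volume a b := by
  rw [intervalIntegrable_iff_integrableOn_Ioc_of_le hab]
  exact hf.integrable one_le_two

lemma MeasureTheory.MemLp.intervalIntegrable_norm_sq (hab : a ≤ b)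
    (hf : MemLp f 2 (volume.restrict (Ioc a b))) :
    IntervalIntegrable (fun s => ‖f s‖ ^ 2) volume a b := by
  rw [intervalIntegrable_iff_integrableOn_Ioc_of_le hab]
  exact hf.integrable_norm_pow two_ne_zero

lemma intervalIntegral_norm_sq_nonneg (hab : a ≤ b) (f : ℝ → V) :
    0 ≤ ∫ s in a..b, ‖f s‖ ^ 2 :=
  intervalIntegral.integral_nonneg hab fun _ _ => by positivity

lemma intervalIntegral_norm_nonneg (hab : a ≤ b) (f : ℝ → V) : 0 ≤ ∫ s in a..b, ‖f s‖ :=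
  intervalIntegral.integral_nonneg hab fun _ _ => norm_nonneg _

/-- Young's inequality with a free weight τ in place of Cauchy–Schwarz, so that no square roots
appear later. -/
lemma intervalIntegral_norm_le_young (hab : a ≤ b)
    (hf : MemLp f 2 (volume.restrict (Ioc a b))) {τ : ℝ} (hτ : 0 < τ) :
    ∫ s in a..b, ‖f s‖ ≤ ((∫ s in a..b, ‖f s‖ ^ 2) / τ + τ * (b - a)) / 2 := by
  have h1 : ∫ s in a..b, ‖f s‖ ≤ ∫ s in a..b, (‖f s‖ ^ 2 / τ + τ) / 2 := by
    refine intervalIntegral.integral_mono_on hab (hf.intervalIntegrable_of_two hab).norm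
      ((((hf.intervalIntegrable_norm_sq hab).div_const τ).add intervalIntegrable_const).div_const 2)
      fun s _ => ?_
    have : 0 ≤ (‖f s‖ - τ) ^ 2 / τ := by positivity
    have h2 : (‖f s‖ - τ) ^ 2 / τ = ‖f s‖ ^ 2 / τ + τ - 2 * ‖f s‖ := by field_simp; ring
    linarith
  refine h1.trans (le_of_eq ?_)
  rw [intervalIntegral.integral_div, intervalIntegral.integral_add
    ((hf.intervalIntegrable_norm_sq hab).div_const τ) intervalIntegrable_const,
    intervalIntegral.integral_div, intervalIntegral.integral_const, smul_eq_mul]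
  ring

lemma intervalIntegral_norm_le_of_sq_le (hab : a ≤ b)
    (hf : MemLp f 2 (volume.restrict (Ioc a b))) {τ : ℝ} (hτ : 0 < τ)
    (h : ∫ s in a..b, ‖f s‖ ^ 2 ≤ τ ^ 2) : ∫ s in a..b, ‖f s‖ ≤ τ * (1 + (b - a)) := by
  refine (intervalIntegral_norm_le_young hab hf hτ).trans ?_
  have : (∫ s in a..b, ‖f s‖ ^ 2) / τ ≤ τ := by
    rw [div_le_iff₀ hτ]; nlinarith
  nlinarith [mul_nonneg hτ.le (sub_nonneg.2 hab)]

lemma IntervalIntegrable.mono_left_of_mem (hf : IntervalIntegrable f volume a b) {s : ℝ}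
    (hs : s ∈ Icc a b) : IntervalIntegrable f volume a s :=
  hf.mono_set (by
    rw [uIcc_of_le hs.1, uIcc_of_le (hs.1.trans hs.2)]; exact Icc_subset_Icc_right hs.2)

lemma IntervalIntegrable.mono_right_of_mem (hf : IntervalIntegrable f volume a b) {s : ℝ}
    (hs : s ∈ Icc a b) : IntervalIntegrable f volume s b :=
  hf.mono_set (by
    rw [uIcc_of_le hs.2, uIcc_of_le (hs.1.trans hs.2)]; exact Icc_subset_Icc_left hs.1)

lemma aestronglyMeasurable_comp_curve {W : Type*} [TopologicalSpace W]
    [TopologicalSpace.PseudoMetrizableSpace W] {Φ : ℝ × V × V → W} (hΦ : Continuous Φ)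
    {c : ℝ → V} (hc : ContinuousOn c (Icc a b))
    (hf : AEStronglyMeasurable f (volume.restrict (Ioc a b))) :
    AEStronglyMeasurable (fun s => Φ (s, c s, f s)) (volume.restrict (Ioc a b)) := by
  have h1 : AEStronglyMeasurable c (volume.restrict (Ioc a b)) :=
    (hc.aestronglyMeasurable_of_isCompact isCompact_Icc measurableSet_Icc).mono_measure
      (Measure.restrict_mono Ioc_subset_Icc_self le_rfl)
  exact hΦ.comp_aestronglyMeasurable (aestronglyMeasurable_id.prodMk (h1.prodMk hf))

lemma intervalIntegrable_of_quadratic_bound {W : Type*} [NormedAddCommGroup W] (hab : a ≤ b)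
    (hf : MemLp f 2 (volume.restrict (Ioc a b))) {k : ℝ → W}
    (hk : AEStronglyMeasurable k (volume.restrict (Ioc a b))) {C : ℝ}
    (hC : ∀ s ∈ Ioc a b, ‖k s‖ ≤ C * (1 + ‖f s‖ ^ 2)) : IntervalIntegrable k volume a b := by
  refine ((intervalIntegrable_const (c := (1 : ℝ))).add
    (hf.intervalIntegrable_norm_sq hab)).const_mul C |>.mono_fun' (by rwa [uIoc_of_le hab]) ?_
  rw [uIoc_of_le hab]
  exact (ae_restrict_mem measurableSet_Ioc).mono fun s hs => hC s hs

variable [NormedSpace ℝ V]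

/-- The curve with initial position `y` at time `a` and velocity `f`. -/
noncomputable def curveOf (a : ℝ) (y : V) (f : ℝ → V) (s : ℝ) : V := y + ∫ r in a..s, f r

lemma curveOf_self (a : ℝ) (y : V) (f : ℝ → V) : curveOf a y f a = y := by
  simp [curveOf]

lemma norm_intervalIntegral_le_of_mem (hf : IntervalIntegrable f volume a b) {s : ℝ}
    (hs : s ∈ Icc a b) : ‖∫ r in a..s, f r‖ ≤ ∫ r in a..b, ‖f r‖ := by
  refine (intervalIntegral.norm_integral_le_integral_norm hs.1).trans ?_
  exact intervalIntegral.integral_mono_interval le_rfl hs.1 hs.2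
    (Eventually.of_forall fun _ => norm_nonneg _) hf.norm

lemma norm_intervalIntegral_le_of_mem' (hf : IntervalIntegrable f volume a b) {s : ℝ}
    (hs : s ∈ Icc a b) : ‖∫ r in s..b, f r‖ ≤ ∫ r in a..b, ‖f r‖ := by
  refine (intervalIntegral.norm_integral_le_integral_norm hs.2).trans ?_
  exact intervalIntegral.integral_mono_interval hs.1 hs.2 le_rfl
    (Eventually.of_forall fun _ => norm_nonneg _) hf.norm

lemma norm_curveOf_le (hf : IntervalIntegrable f volume a b) (y : V) {s : ℝ}
    (hs : s ∈ Icc a b) : ‖curveOf a y f s‖ ≤ ‖y‖ + ∫ r in a..b, ‖f r‖ :=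
  (norm_add_le _ _).trans (add_le_add le_rfl (norm_intervalIntegral_le_of_mem hf hs))

lemma norm_curveOf_sub_le (hf : IntervalIntegrable f volume a b)
    (hf' : IntervalIntegrable f' volume a b) (y : V) {s : ℝ} (hs : s ∈ Icc a b) :
    ‖curveOf a y f s - curveOf a y f' s‖ ≤ ∫ r in a..b, ‖f r - f' r‖ := by
  rw [curveOf, curveOf, add_sub_add_left_eq_sub,
    ← intervalIntegral.integral_sub (hf.mono_left_of_mem hs) (hf'.mono_left_of_mem hs)]
  exact norm_intervalIntegral_le_of_mem (hf.sub hf') hs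

lemma continuousOn_curveOf (hab : a ≤ b) (hf : IntervalIntegrable f volume a b) (y : V) :
    ContinuousOn (curveOf a y f) (Icc a b) := by
  have := intervalIntegral.continuousOn_primitive_interval' hf left_mem_uIcc
  rw [uIcc_of_le hab] at this
  exact continuousOn_const.add this

lemma curveOf_add_smul (y : V) (hf : IntervalIntegrable f volume a b)
    (hf' : IntervalIntegrable f' volume a b) (τ : ℝ) {s : ℝ} (hs : s ∈ Icc a b) :
    curveOf a y (fun r => f r + τ • f' r) s = curveOf a y f s + τ • ∫ r in a..s, f' r := by
  rw [curveOf, curveOf, intervalIntegral.integral_add (hf.mono_left_of_mem hs)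
    (show IntervalIntegrable (fun r => τ • f' r) volume a s from
      (hf'.mono_left_of_mem hs).smul τ), intervalIntegral.integral_smul, add_assoc]

/-- Fubini on the triangle r ≤ s. It plays the role of integration by parts: the variation of the
position is rewritten in terms of the variation of the velocity. -/
lemma intervalIntegral_triangle_swap [CompleteSpace V] (hab : a ≤ b) {A : ℝ → V →L[ℝ] ℝ}
    (hA : IntervalIntegrable A volume a b) (hf : IntervalIntegrable f volume a b) :
    ∫ s in a..b, A s (∫ r in a..s, f r) = ∫ r in a..b, (∫ s in r..b, A s) (f r) := by
  have hA' := (intervalIntegrable_iff_integrableOn_Ioc_of_le hab).1 hA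
  have hf' := (intervalIntegrable_iff_integrableOn_Ioc_of_le hab).1 hf
  set ν := volume.restrict (Ioc a b) with hν
  set k : ℝ × ℝ → ℝ := {p : ℝ × ℝ | p.2 ≤ p.1}.indicator fun p => A p.1 (f p.2) with hk
  have hmeas : MeasurableSet {p : ℝ × ℝ | p.2 ≤ p.1} := measurableSet_le measurable_snd measurable_fst
  have hint : Integrable (Function.uncurry fun s r => k (s, r)) (ν.prod ν) := by
    refine Integrable.indicator ?_ hmeas
    refine ((Integrable.mul_prod hA'.norm hf'.norm)).mono' ?_ (Eventually.of_forall fun p => ?_)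
    · exact (ContinuousLinearMap.id ℝ (V →L[ℝ] ℝ)).aestronglyMeasurable_comp₂
        hA'.aestronglyMeasurable.comp_fst hf'.aestronglyMeasurable.comp_snd
    · exact (A p.1).le_opNorm (f p.2)
  have hswap := integral_integral_swap hint
  rw [intervalIntegral.integral_of_le hab, intervalIntegral.integral_of_le hab]
  have h1 : ∀ s ∈ Ioc a b, A s (∫ r in a..s, f r) = ∫ r, k (s, r) ∂ν := by
    intro s hs
    have hs' : s ∈ Icc a b := Ioc_subset_Icc_self hs
    rw [← ContinuousLinearMap.intervalIntegral_comp_comm _ (hf.mono_left_of_mem hs'),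
      intervalIntegral.integral_of_le hs.1.le]
    have : (fun r => k (s, r)) = (Iic s).indicator fun r => A s (f r) := by
      ext r; simp [hk, indicator]
    rw [this, integral_indicator measurableSet_Iic, hν, Measure.restrict_restrict measurableSet_Iic]
    congr 2
    ext r
    simp only [mem_inter_iff, mem_Iic, mem_Ioc]
    constructor
    · rintro ⟨h1, h2⟩; exact ⟨h2, h1, h2.trans hs.2⟩
    · rintro ⟨h1, h2, h3⟩; exact ⟨h2, h1⟩
  have h2 : ∀ r ∈ Ioc a b, (∫ s in r..b, A s) (f r) = ∫ s, k (s, r) ∂ν := by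
    intro r hr
    have hr' : r ∈ Icc a b := Ioc_subset_Icc_self hr
    rw [ContinuousLinearMap.intervalIntegral_apply (hA.mono_right_of_mem hr'),
      -- The slice of the triangle over r is the closed interval [r,b], whereas interval integrals
      -- live on (r,b].
      intervalIntegral.integral_of_le hr.2, ← integral_Icc_eq_integral_Ioc]
    have : (fun s => k (s, r)) = (Ici r).indicator fun s => A s (f r) := by
      ext s; simp [hk, indicator]
    rw [this, integral_indicator measurableSet_Ici, hν, Measure.restrict_restrict measurableSet_Ici]
    congr 2
    ext s
    simp only [mem_inter_iff, mem_Ici, mem_Ioc, mem_Icc]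
    constructor
    · rintro ⟨h1, h2⟩; exact ⟨h1, lt_of_lt_of_le hr.1 h1, h2⟩
    · rintro ⟨h1, h2, h3⟩; exact ⟨h1, h3⟩
  rw [setIntegral_congr_fun measurableSet_Ioc h1, setIntegral_congr_fun measurableSet_Ioc h2]
  exact hswap

end Curves

/-! ### The action functional: coercivity, local Lipschitz bound, first variation -/

section Action

variable {V : Type*} [NormedAddCommGroup V] [InnerProductSpace ℝ V]

/-- The action of the curve with initial position `y` and velocity `f`. -/
noncomputable def action (ℓ : ℝ → V → V → ℝ) (G : V → ℝ) (a b : ℝ) (y : V) (f : ℝ → V) : ℝ :=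
  (∫ s in a..b, ℓ s (curveOf a y f s) (f s)) + G (curveOf a y f b)

/-- The adjoint state attached to a curve by the integrated Euler–Lagrange equation. -/
noncomputable def momentum (Dx : ℝ → V → V → V →L[ℝ] ℝ) (DG : V → V →L[ℝ] ℝ) (a b : ℝ) (y : V)
    (f : ℝ → V) (s : ℝ) : V →L[ℝ] ℝ :=
  -(DG (curveOf a y f b) + ∫ r in s..b, Dx r (curveOf a y f r) (f r))

/-- Coercivity of integral functionals whose integrand grows quadratically in the velocity. -/
lemma exists_integral_coercive {a b M : ℝ} (hab : a ≤ b) (hM : 0 < M) (A κ : ℝ) (y : V)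
    (hκ : 0 < κ) :
    ∃ K, ∀ (f : ℝ → V) (k : ℝ → ℝ), MemLp f 2 (volume.restrict (Ioc a b)) →
      IntervalIntegrable k volume a b →
      (∀ s ∈ Icc a b, -A - M * ‖curveOf a y f s‖ - M * ‖f s‖ + 1 / (2 * M) * ‖f s‖ ^ 2 ≤ k s) →
      1 / (4 * M) * (∫ s in a..b, ‖f s‖ ^ 2) + κ * (∫ s in a..b, ‖f s‖)
        ≤ (∫ s in a..b, k s) + K := by
  set β := b - a with hβ
  have hβ0 : 0 ≤ β := sub_nonneg.2 hab
  -- All linear losses in ∫‖f‖: M β from the position, M from the velocity, and κ for the surplus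
  -- requested.
  set σ := M * β + M + κ with hσ
  have hσ0 : 0 < σ := by positivity
  refine ⟨σ * (2 * M * σ * β) / 2 + (A + M * ‖y‖) * β, fun f k hf hk hle => ?_⟩
  have hfi := hf.intervalIntegrable_of_two hab
  set N := ∫ s in a..b, ‖f s‖
  have h1 : ∫ s in a..b, ((-A - M * (‖y‖ + N)) - M * ‖f s‖ + 1 / (2 * M) * ‖f s‖ ^ 2)
      ≤ ∫ s in a..b, k s := by
    refine intervalIntegral.integral_mono_on hab
      ((intervalIntegrable_const.sub (hfi.norm.const_mul M)).add
        ((hf.intervalIntegrable_norm_sq hab).const_mul _)) hk fun s hs => ?_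
    refine le_trans ?_ (hle s hs)
    have := mul_le_mul_of_nonneg_left (norm_curveOf_le hfi y hs) hM.le
    linarith
  rw [intervalIntegral.integral_add (intervalIntegrable_const.sub (hfi.norm.const_mul M))
    ((hf.intervalIntegrable_norm_sq hab).const_mul _),
    intervalIntegral.integral_sub intervalIntegrable_const (hfi.norm.const_mul M),
    intervalIntegral.integral_const, intervalIntegral.integral_const_mul,
    intervalIntegral.integral_const_mul, smul_eq_mul, ← hβ] at h1
  -- With this weight, σ ∫‖f‖ costs exactly 1/(4M) ∫‖f‖², half of the available quadratic term.
  have h2 := intervalIntegral_norm_le_young hab hf (τ := 2 * M * σ) (by positivity)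
  have h3 := mul_le_mul_of_nonneg_left h2 hσ0.le
  have h4 : σ * (((∫ s in a..b, ‖f s‖ ^ 2) / (2 * M * σ) + 2 * M * σ * β) / 2)
      = 1 / (4 * M) * (∫ s in a..b, ‖f s‖ ^ 2) + σ * (2 * M * σ * β) / 2 := by
    field_simp
    ring
  rw [h4] at h3
  have h5 : 1 / (2 * M) * (∫ s in a..b, ‖f s‖ ^ 2)
      = 1 / (4 * M) * (∫ s in a..b, ‖f s‖ ^ 2) + 1 / (4 * M) * (∫ s in a..b, ‖f s‖ ^ 2) := by
    field_simp
    ring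
  have h6 : σ * N = M * β * N + M * N + κ * N := by rw [hσ]; ring
  have h7 : β * (-A - M * (‖y‖ + N)) = -((A + M * ‖y‖) * β) - M * β * N := by ring
  have h8 : (∫ s in a..b, ‖f s‖) = N := rfl
  rw [h8] at *
  linarith

namespace TonelliProblem

variable {M : ℝ} {ℓ : ℝ → V → V → ℝ} {Dx Dv : ℝ → V → V → V →L[ℝ] ℝ}
  {G : V → ℝ} {DG : V → V →L[ℝ] ℝ} {a b : ℝ} {f f' : ℝ → V}

lemma intervalIntegrable_lagrangian (h : TonelliProblem M ℓ Dx Dv G DG) (hab : a ≤ b)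
    (hf : MemLp f 2 (volume.restrict (Ioc a b))) {c : ℝ → V} (hc : ContinuousOn c (Icc a b)) :
    IntervalIntegrable (fun s => ℓ s (c s) (f s)) volume a b := by
  obtain ⟨A, hA0, hA⟩ := h.bdd
  obtain ⟨B, hB⟩ := isCompact_Icc.exists_bound_of_continuousOn hc
  have hM := h.pos
  refine intervalIntegrable_of_quadratic_bound hab hf
    (aestronglyMeasurable_comp_curve h.cont hc hf.1) (C := A + M * |B| + 2 * M) fun s hs => ?_
  have h1 := hB s (Ioc_subset_Icc_self hs)
  have h2 : ‖c s‖ ≤ |B| := h1.trans (le_abs_self B)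
  refine (h.abs_le hA s (c s) (f s)).trans ?_
  have h3 := mul_le_mul_of_nonneg_left h2 hM.le
  nlinarith [sq_nonneg (‖f s‖ - 1), norm_nonneg (f s), mul_nonneg hA0 (sq_nonneg ‖f s‖),
    mul_nonneg (mul_nonneg hM.le (abs_nonneg B)) (sq_nonneg ‖f s‖),
    mul_nonneg hM.le (sq_nonneg (‖f s‖ - 1)), mul_nonneg hM.le (sq_nonneg ‖f s‖)]

lemma intervalIntegrable_dx (h : TonelliProblem M ℓ Dx Dv G DG) (hab : a ≤ b)
    (hf : MemLp f 2 (volume.restrict (Ioc a b))) {c : ℝ → V} (hc : ContinuousOn c (Icc a b)) :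
    IntervalIntegrable (fun s => Dx s (c s) (f s)) volume a b :=
  intervalIntegrable_of_quadratic_bound hab hf
    (aestronglyMeasurable_comp_curve h.cont_dx hc hf.1) fun s _ => h.dx_le s (c s) (f s)

lemma memLp_dv (h : TonelliProblem M ℓ Dx Dv G DG)
    (hf : MemLp f 2 (volume.restrict (Ioc a b))) {c : ℝ → V} (hc : ContinuousOn c (Icc a b)) :
    MemLp (fun s => Dv s (c s) (f s)) 2 (volume.restrict (Ioc a b)) := by
  have hM := h.pos
  have h1 : MemLp (fun s => M * (1 + ‖f s‖)) 2 (volume.restrict (Ioc a b)) :=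
    ((memLp_const (1 : ℝ)).add hf.norm).const_mul M
  refine h1.mono (aestronglyMeasurable_comp_curve h.cont_dv hc hf.1)
    (Eventually.of_forall fun s => ?_)
  rw [Real.norm_of_nonneg (by positivity)]
  exact h.dv_le s (c s) (f s)

lemma intervalIntegrable_curve (h : TonelliProblem M ℓ Dx Dv G DG) (hab : a ≤ b) (y : V)
    (hf : MemLp f 2 (volume.restrict (Ioc a b))) :
    IntervalIntegrable (fun s => ℓ s (curveOf a y f s) (f s)) volume a b :=
  h.intervalIntegrable_lagrangian hab hf
    (continuousOn_curveOf hab (hf.intervalIntegrable_of_two hab) y)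

lemma exists_action_coercive (h : TonelliProblem M ℓ Dx Dv G DG) (hab : a ≤ b) (y : V) :
    ∃ K, ∀ f : ℝ → V, MemLp f 2 (volume.restrict (Ioc a b)) →
      1 / (4 * M) * (∫ s in a..b, ‖f s‖ ^ 2) ≤ action ℓ G a b y f + K := by
  obtain ⟨A, hA0, hA⟩ := h.bdd
  have hM := h.pos
  -- The surplus 2M is the Lipschitz constant of G and pays for the terminal cost.
  obtain ⟨K, hK⟩ := exists_integral_coercive hab hM A (2 * M) y (by positivity)
  refine ⟨K - G y, fun f hf => ?_⟩
  have hfi := hf.intervalIntegrable_of_two hab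
  have h1 := hK f _ hf (h.intervalIntegrable_curve hab y hf) fun s _ => h.coercive hA s _ _
  have h2 := _root_.abs_le.1 (h.abs_terminal_sub_le (curveOf a y f b) y)
  have h3 : ‖curveOf a y f b - y‖ ≤ ∫ s in a..b, ‖f s‖ := by
    rw [curveOf, add_sub_cancel_left]
    exact norm_intervalIntegral_le_of_mem hfi (right_mem_Icc.2 hab)
  have h4 := mul_le_mul_of_nonneg_left h3 (by positivity : 0 ≤ 2 * M)
  unfold action
  linarith [h2.1]

/-- Local Lipschitz continuity of the action on L². Positions differ uniformly by O(τ), which meets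
the quadratic bound on D_xℓ; the velocity difference is split by Young's inequality with weight τ.
It yields the continuity needed for Ekeland's principle and for density arguments. -/
lemma abs_action_sub_le (h : TonelliProblem M ℓ Dx Dv G DG) (hab : a ≤ b) (y : V)
    (hf : MemLp f 2 (volume.restrict (Ioc a b))) (hf' : MemLp f' 2 (volume.restrict (Ioc a b)))
    {τ : ℝ} (hτ : 0 < τ) (hff' : ∫ s in a..b, ‖f s - f' s‖ ^ 2 ≤ τ ^ 2) :
    |action ℓ G a b y f - action ℓ G a b y f'| ≤ 10 * M * (1 + (b - a)) ^ 2 *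
      (1 + (∫ s in a..b, ‖f s‖ ^ 2) + ∫ s in a..b, ‖f' s‖ ^ 2) * τ := by
  have hM := h.pos
  have hfi := hf.intervalIntegrable_of_two hab
  have hfi' := hf'.intervalIntegrable_of_two hab
  have hf2 := hf.intervalIntegrable_norm_sq hab
  have hf2' := hf'.intervalIntegrable_norm_sq hab
  have hd2 : IntervalIntegrable (fun s => ‖f s - f' s‖ ^ 2) volume a b :=
    (hf.sub hf').intervalIntegrable_norm_sq hab
  have hD := intervalIntegral_norm_le_of_sq_le hab (hf.sub hf') hτ hff'
  have hcd : ∀ s ∈ Icc a b, ‖curveOf a y f s - curveOf a y f' s‖ ≤ τ * (1 + (b - a)) :=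
    fun s hs => (norm_curveOf_sub_le hfi hfi' y hs).trans hD
  set β := b - a with hβ
  have hβ0 : 0 ≤ β := sub_nonneg.2 hab
  set N := ∫ s in a..b, ‖f s‖ ^ 2 with hN
  set N' := ∫ s in a..b, ‖f' s‖ ^ 2 with hN'
  have hN0 : 0 ≤ N := intervalIntegral_norm_sq_nonneg hab f
  have hN0' : 0 ≤ N' := intervalIntegral_norm_sq_nonneg hab f'
  set c := curveOf a y f
  set c' := curveOf a y f'
  have hpt : ∀ s ∈ Icc a b, ‖ℓ s (c s) (f s) - ℓ s (c' s) (f' s)‖ ≤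
      M * τ * (5 / 2 + β) * (1 + ‖f s‖ ^ 2 + ‖f' s‖ ^ 2) + M / (2 * τ) * ‖f s - f' s‖ ^ 2 := by
    intro s hs
    have h1 := h.abs_sub_le_left s (c s) (c' s) (f s)
    have h2 := h.abs_sub_le_right s (c' s) (f s) (f' s)
    have h3 := hcd s hs
    have h4 : M * (1 + ‖f s‖ ^ 2) * ‖c s - c' s‖ ≤ M * (1 + ‖f s‖ ^ 2) * (τ * (1 + β)) := by
      gcongr
    have h5 : (1 + ‖f s‖ + ‖f' s‖) * ‖f s - f' s‖ ≤
        3 * τ / 2 * (1 + ‖f s‖ ^ 2 + ‖f' s‖ ^ 2) + 1 / (2 * τ) * ‖f s - f' s‖ ^ 2 := by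
      generalize ‖f s‖ = p
      generalize ‖f' s‖ = q
      generalize ‖f s - f' s‖ = d
      have h6 : 0 ≤ (τ * (1 + p + q) - d) ^ 2 / (2 * τ) := by positivity
      have h7 : (τ * (1 + p + q) - d) ^ 2 / (2 * τ)
          = τ / 2 * (1 + p + q) ^ 2 + 1 / (2 * τ) * d ^ 2 - (1 + p + q) * d := by
        field_simp; ring
      have h8 : (1 + p + q) ^ 2 ≤ 3 * (1 + p ^ 2 + q ^ 2) := by
        nlinarith [sq_nonneg (1 - p), sq_nonneg (1 - q), sq_nonneg (p - q)]
      have h9 := mul_le_mul_of_nonneg_left h8 (by positivity : 0 ≤ τ / 2)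
      linarith
    have h6 := mul_le_mul_of_nonneg_left h5 hM.le
    have h7 : ‖ℓ s (c s) (f s) - ℓ s (c' s) (f' s)‖ ≤
        |ℓ s (c s) (f s) - ℓ s (c' s) (f s)| + |ℓ s (c' s) (f s) - ℓ s (c' s) (f' s)| :=
      abs_sub_le _ _ _
    have h8 : 0 ≤ M * (τ * (1 + β)) * ‖f' s‖ ^ 2 := by positivity
    have h9 : M / (2 * τ) = M * (1 / (2 * τ)) := by ring
    rw [h9]
    linarith
  have hI := intervalIntegral.norm_integral_le_of_norm_le hab
    (Eventually.of_forall fun s hs => hpt s (Ioc_subset_Icc_self hs))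
    ((((intervalIntegrable_const (c := (1 : ℝ))).add hf2).add hf2').const_mul
      (M * τ * (5 / 2 + β)) |>.add (hd2.const_mul (M / (2 * τ))))
  rw [intervalIntegral.integral_add ((((intervalIntegrable_const).add hf2).add hf2').const_mul
      _) (hd2.const_mul _), intervalIntegral.integral_const_mul,
    intervalIntegral.integral_const_mul, intervalIntegral.integral_add
      (intervalIntegrable_const.add hf2) hf2', intervalIntegral.integral_add
      intervalIntegrable_const hf2, intervalIntegral.integral_const, smul_eq_mul, mul_one,
    intervalIntegral.integral_sub (h.intervalIntegrable_curve hab y hf)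
      (h.intervalIntegrable_curve hab y hf')] at hI
  have hG := h.abs_terminal_sub_le (c b) (c' b)
  have hG' := mul_le_mul_of_nonneg_left (hcd b (right_mem_Icc.2 hab)) (by positivity : 0 ≤ 2 * M)
  have hlast : M / (2 * τ) * (∫ s in a..b, ‖f s - f' s‖ ^ 2) ≤ M * τ / 2 := by
    refine (mul_le_mul_of_nonneg_left hff' (by positivity)).trans (le_of_eq ?_)
    field_simp
  rw [Real.norm_eq_abs, ← hβ, ← hN, ← hN'] at hI
  have htri : |action ℓ G a b y f - action ℓ G a b y f'| ≤
      |(∫ s in a..b, ℓ s (c s) (f s)) - ∫ s in a..b, ℓ s (c' s) (f' s)| + |G (c b) - G (c' b)| := by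
    unfold action
    rw [add_sub_add_comm]
    exact abs_add_le _ _
  have hfin : M * τ * (5 / 2 + β) * (β + N + N') + M * τ / 2 + 2 * M * (τ * (1 + β))
      ≤ 10 * M * (1 + β) ^ 2 * (1 + N + N') * τ := by
    have h1 : (5 / 2 + β) * (β + N + N') + 1 / 2 + 2 * (1 + β) ≤
        10 * (1 + β) ^ 2 * (1 + N + N') := by
      generalize hS : N + N' = S
      have hS0 : 0 ≤ S := by rw [← hS]; positivity
      rw [add_assoc β, add_assoc 1, hS]
      nlinarith [mul_nonneg hβ0 hS0, mul_nonneg (mul_nonneg hβ0 hβ0) hS0, mul_nonneg hβ0 hβ0]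
    have h2 := mul_le_mul_of_nonneg_left h1 (by positivity : 0 ≤ M * τ)
    linarith
  linarith

lemma aestronglyMeasurable_primitive {η : ℝ → V} (hab : a ≤ b)
    (hη : IntervalIntegrable η volume a b) :
    AEStronglyMeasurable (fun s => ∫ r in a..s, η r) (volume.restrict (Ioc a b)) := by
  have := intervalIntegral.continuousOn_primitive_interval' hη left_mem_uIcc
  rw [uIcc_of_le hab] at this
  exact (this.aestronglyMeasurable_of_isCompact isCompact_Icc measurableSet_Icc).mono_measure
    (Measure.restrict_mono Ioc_subset_Icc_self le_rfl)

/-- Differentiation under the integral sign; for |τ| < 1 the quadratic growth of the derivatives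
gives an integrable majorant. -/
lemma hasDerivAt_action (h : TonelliProblem M ℓ Dx Dv G DG) (hab : a ≤ b) (y : V) {η : ℝ → V}
    (hf : MemLp f 2 (volume.restrict (Ioc a b))) (hη : MemLp η 2 (volume.restrict (Ioc a b))) :
    HasDerivAt (fun τ : ℝ => action ℓ G a b y fun s => f s + τ • η s)
      ((∫ s in a..b, (Dx s (curveOf a y f s) (f s) (∫ r in a..s, η r)
        + Dv s (curveOf a y f s) (f s) (η s)))
        + DG (curveOf a y f b) (∫ r in a..b, η r)) 0 := by
  have hM := h.pos
  have hfi := hf.intervalIntegrable_of_two hab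
  have hηi := hη.intervalIntegrable_of_two hab
  have hcc := continuousOn_curveOf hab hfi y
  set c := curveOf a y f with hc
  set N : ℝ → V := fun s => ∫ r in a..s, η r with hN
  have hNm := aestronglyMeasurable_primitive hab hηi
  have hNc : ContinuousOn N (Icc a b) := by
    have := intervalIntegral.continuousOn_primitive_interval' hηi left_mem_uIcc
    rwa [uIcc_of_le hab] at this
  set B := ∫ r in a..b, ‖η r‖ with hB
  have hB0 : 0 ≤ B := intervalIntegral_norm_nonneg hab η
  have hNB : ∀ s ∈ Icc a b, ‖N s‖ ≤ B := fun s hs => norm_intervalIntegral_le_of_mem hηi hs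
  have hline : ∀ s τ, HasDerivAt (fun τ : ℝ => (c s + τ • N s, f s + τ • η s)) (N s, η s) τ := by
    intro s τ
    have h1 : HasDerivAt (fun τ : ℝ => c s + τ • N s) (N s) τ := by
      simpa using ((hasDerivAt_id τ).smul_const (N s)).const_add (c s)
    have h2 : HasDerivAt (fun τ : ℝ => f s + τ • η s) (η s) τ := by
      simpa using ((hasDerivAt_id τ).smul_const (η s)).const_add (f s)
    exact h1.prodMk h2
  have hcτ : ∀ τ : ℝ, ContinuousOn (fun s => c s + τ • N s) (Icc a b) :=
    fun τ => hcc.add (hNc.const_smul τ)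
  have hfτ : ∀ τ : ℝ, MemLp (fun s => f s + τ • η s) 2 (volume.restrict (Ioc a b)) :=
    fun τ => hf.add (hη.const_smul τ)
  have hmain : HasDerivAt (fun τ : ℝ => ∫ s in a..b, ℓ s (c s + τ • N s) (f s + τ • η s))
      (∫ s in a..b, (Dx s (c s) (f s) (N s) + Dv s (c s) (f s) (η s))) 0 := by
    have key := intervalIntegral.hasDerivAt_integral_of_dominated_loc_of_deriv_le (μ := volume)
      (F := fun (τ : ℝ) s => ℓ s (c s + τ • N s) (f s + τ • η s))
      (F' := fun (τ : ℝ) s => Dx s (c s + τ • N s) (f s + τ • η s) (N s)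
        + Dv s (c s + τ • N s) (f s + τ • η s) (η s))
      (a := a) (b := b) (x₀ := (0 : ℝ)) (s := Metric.ball 0 1)
      -- `B` bounds the primitive of η and multiplies the D_xℓ term; the 2 comes from the D_vℓ term.
      (bound := fun s => M * (B + 2) * (1 + 2 * ‖f s‖ ^ 2 + 2 * ‖η s‖ ^ 2))
      (Metric.ball_mem_nhds _ one_pos) ?_ ?_ ?_ ?_ ?_ ?_
    · simpa using key.2
    · refine Eventually.of_forall fun τ => ?_
      rw [uIoc_of_le hab]
      exact aestronglyMeasurable_comp_curve h.cont (hcτ τ) (hfτ τ).1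
    · exact h.intervalIntegrable_lagrangian hab (hfτ 0) (hcτ 0)
    · rw [uIoc_of_le hab]
      exact ((ContinuousLinearMap.id ℝ (V →L[ℝ] ℝ)).aestronglyMeasurable_comp₂
        (aestronglyMeasurable_comp_curve h.cont_dx (hcτ 0) (hfτ 0).1) hNm).add
        ((ContinuousLinearMap.id ℝ (V →L[ℝ] ℝ)).aestronglyMeasurable_comp₂
        (aestronglyMeasurable_comp_curve h.cont_dv (hcτ 0) (hfτ 0).1) hη.1)
    · refine Eventually.of_forall fun s hs τ hτ => ?_
      rw [uIoc_of_le hab] at hs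
      rw [mem_ball_zero_iff, Real.norm_eq_abs] at hτ
      have hv : ‖f s + τ • η s‖ ≤ ‖f s‖ + ‖η s‖ := by
        refine (norm_add_le _ _).trans (add_le_add le_rfl ?_)
        rw [norm_smul, Real.norm_eq_abs]
        exact mul_le_of_le_one_left (norm_nonneg _) hτ.le
      have h1 := ((Dx s (c s + τ • N s) (f s + τ • η s)).le_opNorm (N s)).trans
        (mul_le_mul (h.dx_le _ _ _) (hNB s (Ioc_subset_Icc_self hs)) (norm_nonneg _)
          (by positivity))
      have h2 := (Dv s (c s + τ • N s) (f s + τ • η s)).le_of_opNorm_le (h.dv_le _ _ _) (η s)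
      refine (norm_add_le _ _).trans ((add_le_add h1 h2).trans ?_)
      have hq := norm_nonneg (f s + τ • η s)
      generalize ‖f s + τ • η s‖ = q at *
      have hp := norm_nonneg (f s)
      have he := norm_nonneg (η s)
      generalize ‖f s‖ = p at *
      generalize ‖η s‖ = e at *
      have hq2 : q ^ 2 ≤ 2 * p ^ 2 + 2 * e ^ 2 := by nlinarith [sq_nonneg (p - e)]
      have h3 : (1 + q ^ 2) * B ≤ (1 + 2 * p ^ 2 + 2 * e ^ 2) * B :=
        mul_le_mul_of_nonneg_right (by linarith) hB0
      have h4 : (1 + q) * e ≤ 2 * (1 + 2 * p ^ 2 + 2 * e ^ 2) := by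
        nlinarith [mul_le_mul_of_nonneg_right hv he, sq_nonneg (p - e), sq_nonneg (e - 1)]
      have h5 := mul_le_mul_of_nonneg_left (add_le_add h3 h4) hM.le
      linarith
    · exact (((intervalIntegrable_const (c := (1 : ℝ))).add
        ((hf.intervalIntegrable_norm_sq hab).const_mul 2)).add
        ((hη.intervalIntegrable_norm_sq hab).const_mul 2)).const_mul _
    · refine Eventually.of_forall fun s hs τ hτ => ?_
      have := (h.hasFDerivAt s _ _).comp_hasDerivAt τ (hline s τ)
      rw [ContinuousLinearMap.coprod_apply] at this
      exact this
  have hterm : HasDerivAt (fun τ : ℝ => G (c b + τ • N b)) (DG (c b) (N b)) 0 := by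
    have h1 : HasDerivAt (fun τ : ℝ => c b + τ • N b) (N b) 0 := by
      simpa using ((hasDerivAt_id (0 : ℝ)).smul_const (N b)).const_add (c b)
    have h2 := (h.hasFDerivAt_terminal (c b + (0 : ℝ) • N b)).comp_hasDerivAt (0 : ℝ) h1
    rw [zero_smul, add_zero] at h2
    exact h2
  refine (hmain.add hterm).congr_of_eventuallyEq (Eventually.of_forall fun τ => ?_)
  have hcurve : ∀ s ∈ Icc a b, curveOf a y (fun r => f r + τ • η r) s = c s + τ • N s :=
    fun s hs => curveOf_add_smul y hfi hηi τ hs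
  simp only [action, Pi.add_apply]
  rw [hcurve b (right_mem_Icc.2 hab)]
  congr 1
  refine intervalIntegral.integral_congr fun s hs => ?_
  rw [uIcc_of_le hab] at hs
  simp only [hcurve s hs]

end TonelliProblem

end Action

/-! ### Ekeland's variational principle -/

section Ekeland

/-- Ekeland's variational principle for continuous functions bounded below. -/
theorem ekeland_variational_principle {X : Type*} [MetricSpace X] [CompleteSpace X] {F : X → ℝ}
    (hF : Continuous F) (hb : BddBelow (range F)) {δ : ℝ} (hδ : 0 < δ) (x₀ : X) :
    ∃ z, F z + δ * dist z x₀ ≤ F x₀ ∧ ∀ y, F z ≤ F y + δ * dist y z := by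
  -- Lower sets of Ekeland's partial order.
  set S : X → Set X := fun x => {y | F y + δ * dist y x ≤ F x} with hS
  have hself : ∀ x, x ∈ S x := fun x => by simp [hS]
  have hbS : ∀ x, BddBelow (F '' S x) := fun x => hb.mono (image_subset_range _ _)
  have htrans : ∀ {x y z}, y ∈ S x → z ∈ S y → z ∈ S x := by
    intro x y z hy hz
    have h1 := mul_le_mul_of_nonneg_left (dist_triangle z y x) hδ.le
    simp only [hS, mem_ofPred_eq] at hy hz ⊢
    linarith
  -- Each point of the sequence nearly minimizes F on the lower set of its predecessor.
  have hnext : ∀ (n : ℕ) x, ∃ y ∈ S x, F y < sInf (F '' S x) + (1 / 2) ^ n := by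
    intro n x
    obtain ⟨_, ⟨y, hy, rfl⟩, hlt⟩ := exists_lt_of_csInf_lt
      (Set.Nonempty.image F ⟨x, hself x⟩)
      (lt_add_of_pos_right (sInf (F '' S x)) (by positivity : (0 : ℝ) < (1 / 2) ^ n))
    exact ⟨y, hy, hlt⟩
  choose nxt hnxt hnxt_lt using hnext
  set u : ℕ → X := fun n => Nat.rec x₀ (fun k x => nxt k x) n with hu
  have hsucc : ∀ n, u (n + 1) = nxt n (u n) := fun n => rfl
  have hmem : ∀ n m, n ≤ m → u m ∈ S (u n) := by
    intro n m hnm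
    induction m, hnm using Nat.le_induction with
    | base => exact hself _
    | succ m _ ih => exact htrans ih (by rw [hsucc]; exact hnxt m (u m))
  have hanti : Antitone fun n => F (u n) := fun n m hnm => by
    have := hmem n m hnm
    simp only [hS, mem_ofPred_eq] at this
    nlinarith [mul_nonneg hδ.le (dist_nonneg (x := u m) (y := u n))]
  have hbu : BddBelow (range fun n => F (u n)) := hb.mono (range_comp_subset_range u F)
  have hlim := tendsto_atTop_ciInf hanti hbu
  have hcauchy : CauchySeq u := by
    rw [Metric.cauchySeq_iff']
    intro η hη
    have hev := hlim.eventually (gt_mem_nhds (lt_add_of_pos_right (⨅ n, F (u n))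
      (mul_pos hδ hη)))
    obtain ⟨n, hn⟩ := hev.exists
    refine ⟨n, fun m hm => ?_⟩
    have h1 := hmem n m hm
    simp only [hS, mem_ofPred_eq] at h1
    have h2 := ciInf_le hbu m
    exact lt_of_mul_lt_mul_left (by linarith) hδ.le
  obtain ⟨z, hz⟩ := cauchySeq_tendsto_of_complete hcauchy
  have hFz : Tendsto (fun n => F (u n)) atTop (𝓝 (F z)) := (hF.tendsto z).comp hz
  have hzS : ∀ n, z ∈ S (u n) := by
    intro n
    have hcl : IsClosed (S (u n)) :=
      isClosed_le (hF.add (continuous_const.mul (continuous_id.dist continuous_const)))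
        continuous_const
    exact hcl.mem_of_tendsto hz ((eventually_ge_atTop n).mono fun m hm => hmem n m hm)
  refine ⟨z, hzS 0, fun y => ?_⟩
  by_contra! hlt
  -- A violating y lies in every `S (u n)`, so F at the next point is at most F y + 2⁻ⁿ. In the
  -- limit F z ≤ F y, which contradicts the strict decrease.
  have hyz : y ∈ S z := hlt.le
  have hle : F z ≤ F y := by
    have h1 : Tendsto (fun n => F y + (1 / 2 : ℝ) ^ n) atTop (𝓝 (F y + 0)) :=
      tendsto_const_nhds.add (tendsto_pow_atTop_nhds_zero_of_lt_one (by norm_num) (by norm_num))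
    rw [add_zero] at h1
    refine le_of_tendsto_of_tendsto' ((tendsto_add_atTop_iff_nat 1).2 hFz) h1 fun n => ?_
    have h2 := (hnxt_lt n (u n)).le
    have h3 := csInf_le (hbS (u n)) (mem_image_of_mem F (htrans (hzS n) hyz))
    change F (nxt n (u n)) ≤ _
    linarith
  nlinarith [mul_nonneg hδ.le (dist_nonneg (x := y) (y := z))]

end Ekeland

/-! ### Approximate Euler–Lagrange equation for near minimizers -/

section EulerLagrange

variable {V : Type*} [NormedAddCommGroup V] [InnerProductSpace ℝ V] {a b : ℝ} {f f' : ℝ → V}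

lemma curveOf_congr_ae (hff' : f =ᵐ[volume.restrict (Ioc a b)] f') (y : V) {s : ℝ}
    (hs : s ∈ Icc a b) : curveOf a y f s = curveOf a y f' s := by
  rw [curveOf, curveOf, intervalIntegral.integral_of_le hs.1, intervalIntegral.integral_of_le hs.1]
  congr 1
  exact integral_congr_ae (ae_restrict_of_ae_restrict_of_subset (Ioc_subset_Ioc_right hs.2) hff')

/-- The action descends to L² classes, so that Ekeland's principle can be applied on the complete
space `Lp`. -/
lemma action_congr_ae (hab : a ≤ b) (ℓ : ℝ → V → V → ℝ) (G : V → ℝ)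
    (hff' : f =ᵐ[volume.restrict (Ioc a b)] f') (y : V) :
    action ℓ G a b y f = action ℓ G a b y f' := by
  unfold action
  rw [curveOf_congr_ae hff' y (right_mem_Icc.2 hab), intervalIntegral.integral_of_le hab,
    intervalIntegral.integral_of_le hab]
  congr 1
  refine integral_congr_ae ?_
  filter_upwards [hff', ae_restrict_mem measurableSet_Ioc] with s h1 h2
  rw [h1, curveOf_congr_ae hff' y (Ioc_subset_Icc_self h2)]

lemma norm_toLp_sub_sq (hab : a ≤ b) (hf : MemLp f 2 (volume.restrict (Ioc a b)))
    (hf' : MemLp f' 2 (volume.restrict (Ioc a b))) :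
    ‖hf.toLp f - hf'.toLp f'‖ ^ 2 = ∫ s in a..b, ‖f s - f' s‖ ^ 2 := by
  rw [← MemLp.toLp_sub, ← real_inner_self_eq_norm_sq, L2.inner_def,
    intervalIntegral.integral_of_le hab]
  refine integral_congr_ae ?_
  filter_upwards [(hf.sub hf').coeFn_toLp] with s hs
  rw [hs, real_inner_self_eq_norm_sq, Pi.sub_apply]

namespace TonelliProblem

variable {M : ℝ} {ℓ : ℝ → V → V → ℝ} {Dx Dv : ℝ → V → V → V →L[ℝ] ℝ}
  {G : V → ℝ} {DG : V → V →L[ℝ] ℝ}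

lemma intervalIntegrable_dx_curve (h : TonelliProblem M ℓ Dx Dv G DG) (hab : a ≤ b) (y : V)
    (hf : MemLp f 2 (volume.restrict (Ioc a b))) :
    IntervalIntegrable (fun s => Dx s (curveOf a y f s) (f s)) volume a b :=
  h.intervalIntegrable_dx hab hf (continuousOn_curveOf hab (hf.intervalIntegrable_of_two hab) y)

/-- The momentum is defined from the terminal condition; this forward form is what Grönwall's
inequality uses. -/
lemma momentum_eq (h : TonelliProblem M ℓ Dx Dv G DG) (hab : a ≤ b) (y : V)
    (hf : MemLp f 2 (volume.restrict (Ioc a b))) {s : ℝ} (hs : s ∈ Icc a b) :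
    momentum Dx DG a b y f s =
      momentum Dx DG a b y f a + ∫ r in a..s, Dx r (curveOf a y f r) (f r) := by
  have hi := h.intervalIntegrable_dx_curve hab y hf
  unfold momentum
  rw [← intervalIntegral.integral_add_adjacent_intervals (hi.mono_left_of_mem hs)
    (hi.mono_right_of_mem hs)]
  abel

lemma continuousOn_momentum (h : TonelliProblem M ℓ Dx Dv G DG) (hab : a ≤ b) (y : V)
    (hf : MemLp f 2 (volume.restrict (Ioc a b))) :
    ContinuousOn (momentum Dx DG a b y f) (Icc a b) :=
  (continuousOn_curveOf hab (h.intervalIntegrable_dx_curve hab y hf)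
    (momentum Dx DG a b y f a)).congr fun _ hs => h.momentum_eq hab y hf hs

lemma memLp_defect (h : TonelliProblem M ℓ Dx Dv G DG) (hab : a ≤ b) (y : V)
    (hf : MemLp f 2 (volume.restrict (Ioc a b))) :
    MemLp (fun s => Dv s (curveOf a y f s) (f s) - momentum Dx DG a b y f s) 2
      (volume.restrict (Ioc a b)) := by
  have hP := h.continuousOn_momentum hab y hf
  obtain ⟨B, hB⟩ := isCompact_Icc.exists_bound_of_continuousOn hP
  refine (h.memLp_dv hf (continuousOn_curveOf hab (hf.intervalIntegrable_of_two hab) y)).sub ?_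
  refine MemLp.of_bound ((hP.aestronglyMeasurable_of_isCompact isCompact_Icc
    measurableSet_Icc).mono_measure (Measure.restrict_mono Ioc_subset_Icc_self le_rfl)) B ?_
  exact (ae_restrict_mem measurableSet_Ioc).mono fun s hs => hB s (Ioc_subset_Icc_self hs)

/-- If `f` minimizes the action up to a penalization `δ ‖f' - f‖`, then it satisfies the integrated
Euler–Lagrange equation up to an error of size `δ` in `L²`. -/
lemma integral_defect_sq_le [CompleteSpace V] (h : TonelliProblem M ℓ Dx Dv G DG) (hab : a ≤ b)
    (y : V) (hf : MemLp f 2 (volume.restrict (Ioc a b))) {δ : ℝ} (hδ : 0 ≤ δ)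
    (hmin : ∀ f', MemLp f' 2 (volume.restrict (Ioc a b)) →
      action ℓ G a b y f ≤ action ℓ G a b y f' + δ * √(∫ s in a..b, ‖f' s - f s‖ ^ 2)) :
    ∫ s in a..b, ‖Dv s (curveOf a y f s) (f s) - momentum Dx DG a b y f s‖ ^ 2 ≤ δ ^ 2 := by
  set e : ℝ → V →L[ℝ] ℝ := fun s =>
    Dv s (curveOf a y f s) (f s) - momentum Dx DG a b y f s with he
  have heL : MemLp e 2 (volume.restrict (Ioc a b)) := h.memLp_defect hab y hf
  -- Steepest descent: minus the Riesz representative of the defect.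
  set η : ℝ → V := fun s => -(InnerProductSpace.toDual ℝ V).symm (e s) with hη
  have hηn : ∀ s, ‖η s‖ = ‖e s‖ := fun s => by
    rw [hη, norm_neg]; exact LinearIsometryEquiv.norm_map _ _
  have heη : ∀ s, e s (η s) = -‖e s‖ ^ 2 := fun s => by
    rw [hη, map_neg, ← InnerProductSpace.toDual_symm_apply (𝕜 := ℝ) (y := e s),
      real_inner_self_eq_norm_sq, LinearIsometryEquiv.norm_map]
  have hηL : MemLp η 2 (volume.restrict (Ioc a b)) :=
    heL.mono (((InnerProductSpace.toDual ℝ V).symm.continuous.neg).comp_aestronglyMeasurable heL.1)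
      (Eventually.of_forall fun s => (hηn s).le)
  have hηi := hηL.intervalIntegrable_of_two hab
  have hcc := continuousOn_curveOf hab (hf.intervalIntegrable_of_two hab) y
  have hDx := h.intervalIntegrable_dx_curve hab y hf
  have hd := h.hasDerivAt_action hab y hf hηL
  have hN := aestronglyMeasurable_primitive hab hηi
  have hi1 : IntervalIntegrable (fun s => Dx s (curveOf a y f s) (f s) (∫ r in a..s, η r))
      volume a b := by
    refine (hDx.norm.mul_const (∫ r in a..b, ‖η r‖)).mono_fun' ?_ ?_
    · rw [uIoc_of_le hab]
      exact (ContinuousLinearMap.id ℝ (V →L[ℝ] ℝ)).aestronglyMeasurable_comp₂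
        (aestronglyMeasurable_comp_curve h.cont_dx hcc hf.1) hN
    · rw [uIoc_of_le hab]
      refine (ae_restrict_mem measurableSet_Ioc).mono fun s hs => ?_
      exact (ContinuousLinearMap.le_opNorm _ _).trans (mul_le_mul_of_nonneg_left
        (norm_intervalIntegral_le_of_mem hηi (Ioc_subset_Icc_self hs)) (norm_nonneg _))
  have happ : ∀ {k : ℝ → V →L[ℝ] ℝ}, MemLp k 2 (volume.restrict (Ioc a b)) →
      IntervalIntegrable (fun s => k s (η s)) volume a b := by
    intro k hk
    refine ((hk.intervalIntegrable_norm_sq hab).add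
      (hηL.intervalIntegrable_norm_sq hab)).mono_fun' ?_ ?_
    · rw [uIoc_of_le hab]
      exact (ContinuousLinearMap.id ℝ (V →L[ℝ] ℝ)).aestronglyMeasurable_comp₂ hk.1 hηL.1
    · refine Eventually.of_forall fun s => ((k s).le_opNorm _).trans ?_
      nlinarith [sq_nonneg (‖k s‖ - ‖η s‖), sq_nonneg ‖k s‖, sq_nonneg ‖η s‖]
  have hDvL := h.memLp_dv hf hcc
  have hi2 := happ hDvL
  have hi3 := happ heL
  have hi4 : IntervalIntegrable (fun s => (e s - Dv s (curveOf a y f s) (f s)) (η s))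
      volume a b := happ (heL.sub hDvL)
  -- After the triangle swap the coefficient of η is D_vℓ + DG + ∫_s^b D_xℓ, which is the defect
  -- itself; hence the first variation is -∫‖e‖².
  have hderiv : (∫ s in a..b, (Dx s (curveOf a y f s) (f s) (∫ r in a..s, η r)
        + Dv s (curveOf a y f s) (f s) (η s))) + DG (curveOf a y f b) (∫ r in a..b, η r)
      = -∫ s in a..b, ‖e s‖ ^ 2 := by
    have hi5 : IntervalIntegrable (fun s => DG (curveOf a y f b) (η s)) volume a b :=
      happ (memLp_const _)
    have hi6 : IntervalIntegrable
        (fun s => (∫ r in s..b, Dx r (curveOf a y f r) (f r)) (η s)) volume a b := by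
      refine (hi4.sub hi5).congr (fun s _ => ?_)
      simp only [he, momentum, sub_apply, neg_apply, add_apply]
      ring
    rw [intervalIntegral.integral_add hi1 hi2, intervalIntegral_triangle_swap hab hDx hηi,
      ← ContinuousLinearMap.intervalIntegral_comp_comm _ hηi, add_right_comm,
      ← intervalIntegral.integral_add hi6 hi5, ← intervalIntegral.integral_add (hi6.add hi5) hi2,
      ← intervalIntegral.integral_neg]
    refine intervalIntegral.integral_congr fun s _ => ?_
    rw [← heη s]
    simp only [he, momentum, sub_apply, neg_apply, add_apply]
    ring
  rw [hderiv] at hd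
  set N := ∫ s in a..b, ‖e s‖ ^ 2 with hNdef
  have hN0 : 0 ≤ N := intervalIntegral_norm_sq_nonneg hab e
  have hNη : (∫ s in a..b, ‖η s‖ ^ 2) = N := by simp only [hηn, hNdef]
  -- Moving by τη changes the penalization by exactly τ δ √N. The penalized action is thus minimal
  -- at τ = 0 among τ ≥ 0, and its right derivative is nonnegative.
  have hineq : 0 ≤ -N + δ * √N := by
    have hd2 : HasDerivAt (fun τ : ℝ => action ℓ G a b y (fun s => f s + τ • η s) + τ * (δ * √N))
        (-N + δ * √N) 0 := by
      have := hd.add ((hasDerivAt_id (0 : ℝ)).mul_const (δ * √N))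
      rw [one_mul] at this
      exact this
    refine ge_of_tendsto hd2.tendsto_slope_zero_right ?_
    refine eventually_nhdsWithin_of_forall fun τ (hτ : 0 < τ) => ?_
    have h1 := hmin (fun s => f s + τ • η s) (hf.add (hηL.const_smul τ))
    have h2 : √(∫ s in a..b, ‖f s + τ • η s - f s‖ ^ 2) = τ * √N := by
      have : ∀ s, ‖f s + τ • η s - f s‖ ^ 2 = τ ^ 2 * ‖η s‖ ^ 2 := fun s => by
        rw [add_sub_cancel_left, norm_smul, Real.norm_eq_abs, mul_pow, sq_abs]
      simp only [this]
      rw [intervalIntegral.integral_const_mul, hNη, Real.sqrt_mul (sq_nonneg τ),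
        Real.sqrt_sq hτ.le]
    rw [h2] at h1
    simp only [zero_add, zero_smul, add_zero, zero_mul, smul_eq_mul]
    exact mul_nonneg (inv_nonneg.2 hτ.le) (by linarith)
  have hsq : √N * √N = N := Real.mul_self_sqrt hN0
  rcases (Real.sqrt_nonneg N).eq_or_lt with h0 | h0
  · rw [← hsq, ← h0]; nlinarith
  · have : √N ≤ δ := by
      by_contra! hc
      nlinarith
    nlinarith

/-- Near minimizers of the action are close in `L²` to approximate extremals. -/
lemma exists_approx_extremal [CompleteSpace V] (h : TonelliProblem M ℓ Dx Dv G DG) (hab : a ≤ b)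
    (y : V) (hf : MemLp f 2 (volume.restrict (Ioc a b))) {m δ : ℝ} (hδ : 0 < δ)
    (hm : ∀ f', MemLp f' 2 (volume.restrict (Ioc a b)) → m ≤ action ℓ G a b y f')
    (hfm : action ℓ G a b y f ≤ m + δ ^ 2) :
    ∃ w, MemLp w 2 (volume.restrict (Ioc a b)) ∧ action ℓ G a b y w ≤ m + δ ^ 2 ∧
      ∫ s in a..b, ‖w s - f s‖ ^ 2 ≤ δ ^ 2 ∧
      ∫ s in a..b, ‖Dv s (curveOf a y w s) (w s) - momentum Dx DG a b y w s‖ ^ 2 ≤ δ ^ 2 := by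
  have hM := h.pos
  set F : Lp V 2 (volume.restrict (Ioc a b)) → ℝ := fun w => action ℓ G a b y w with hFdef
  have hFtoLp : ∀ {k : ℝ → V} (hk : MemLp k 2 (volume.restrict (Ioc a b))),
      F (hk.toLp k) = action ℓ G a b y k := fun hk => action_congr_ae hab ℓ G hk.coeFn_toLp y
  have hnorm : ∀ w w' : Lp V 2 (volume.restrict (Ioc a b)),
      ‖w - w'‖ ^ 2 = ∫ s in a..b, ‖w s - w' s‖ ^ 2 := fun w w' => by
    conv_lhs => rw [← Lp.toLp_coeFn w (Lp.memLp w), ← Lp.toLp_coeFn w' (Lp.memLp w')]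
    exact norm_toLp_sub_sq hab _ _
  have hnorm0 : ∀ w : Lp V 2 (volume.restrict (Ioc a b)),
      ‖w‖ ^ 2 = ∫ s in a..b, ‖w s‖ ^ 2 := fun w => by
    rw [← real_inner_self_eq_norm_sq, L2.inner_def, intervalIntegral.integral_of_le hab]
    exact integral_congr_ae (Eventually.of_forall fun s => real_inner_self_eq_norm_sq _)
  have hcont : Continuous F := by
    rw [continuous_iff_continuousAt]
    intro w
    -- Lipschitz constant of the action on the unit ball around w.
    set K := 10 * M * (1 + (b - a)) ^ 2 * (1 + ‖w‖ ^ 2 + (‖w‖ + 1) ^ 2) with hK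
    refine continuousAt_of_locally_lipschitz one_pos K fun w' hw' => ?_
    rw [dist_eq_norm] at hw'
    rcases eq_or_ne w' w with rfl | hne
    · simp
    have hpos : 0 < ‖w' - w‖ := norm_pos_iff.2 (sub_ne_zero.2 hne)
    have h1 := h.abs_action_sub_le hab y (Lp.memLp w') (Lp.memLp w) hpos (hnorm w' w).ge
    rw [← hnorm0, ← hnorm0] at h1
    rw [Real.dist_eq, dist_eq_norm]
    refine h1.trans (mul_le_mul_of_nonneg_right ?_ hpos.le)
    have h2 : ‖w'‖ ≤ ‖w‖ + 1 := by
      have := norm_add_le (w' - w) w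
      rw [sub_add_cancel] at this
      linarith
    rw [hK]
    have h3 : ‖w'‖ ^ 2 ≤ (‖w‖ + 1) ^ 2 := by gcongr
    exact mul_le_mul_of_nonneg_left (by linarith) (by positivity)
  have hbdd : BddBelow (range F) := ⟨m, by
    rintro _ ⟨w, rfl⟩
    exact hm w (Lp.memLp w)⟩
  -- Slope δ against slack δ²: the displacement satisfies δ · dist ≤ δ², so it is at most δ.
  obtain ⟨z, hz1, hz2⟩ := ekeland_variational_principle hcont hbdd hδ (hf.toLp f)
  rw [hFtoLp hf] at hz1
  have hzm := hm z (Lp.memLp z)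
  have hdist0 : 0 ≤ dist z (hf.toLp f) := dist_nonneg
  refine ⟨z, Lp.memLp z, ?_, ?_, ?_⟩
  · have : F z = action ℓ G a b y z := rfl
    nlinarith [mul_nonneg hδ.le hdist0]
  · have h1 : dist z (hf.toLp f) ≤ δ := by
      refine le_of_mul_le_mul_left ?_ hδ
      have : F z = action ℓ G a b y z := rfl
      nlinarith
    have h2 : ∫ s in a..b, ‖z s - f s‖ ^ 2 = dist z (hf.toLp f) ^ 2 := by
      rw [dist_eq_norm]
      conv_rhs => rw [← Lp.toLp_coeFn z (Lp.memLp z)]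
      exact (norm_toLp_sub_sq hab (Lp.memLp z) hf).symm
    rw [h2]
    gcongr
  · refine h.integral_defect_sq_le hab y (Lp.memLp z) hδ.le fun f' hf' => ?_
    have h1 := hz2 (hf'.toLp f')
    rw [hFtoLp hf', dist_eq_norm] at h1
    have h2 : √(∫ s in a..b, ‖f' s - z s‖ ^ 2) = ‖hf'.toLp f' - z‖ := by
      rw [← Real.sqrt_sq (norm_nonneg (hf'.toLp f' - z))]
      conv_rhs => rw [← Lp.toLp_coeFn z (Lp.memLp z)]
      rw [norm_toLp_sub_sq hab hf' (Lp.memLp z)]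
    rw [h2]
    exact h1

end TonelliProblem

end EulerLagrange

/-- Grönwall's inequality in integral form. -/
lemma le_mul_exp_of_le_add_integral {a b α K : ℝ} {φ : ℝ → ℝ} (hφ : Continuous φ)
    (hφ0 : ∀ s, 0 ≤ φ s) (hK : 0 ≤ K)
    (h : ∀ s ∈ Icc a b, φ s ≤ α + K * ∫ r in a..s, φ r) {s : ℝ} (hs : s ∈ Icc a b) :
    φ s ≤ α * Real.exp (K * (s - a)) := by
  have hα : 0 ≤ α := by
    have := h a ⟨le_rfl, hs.1.trans hs.2⟩
    rw [intervalIntegral.integral_same, mul_zero, add_zero] at this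
    exact (hφ0 a).trans this
  -- The right-hand side is differentiable and satisfies Ψ' = Kφ ≤ KΨ, so the differential form
  -- applies to it.
  set Ψ : ℝ → ℝ := fun s => α + K * ∫ r in a..s, φ r with hΨ
  have hd : ∀ s, HasDerivAt Ψ (K * φ s) s := fun s =>
    ((hφ.integral_hasStrictDerivAt a s).hasDerivAt.const_mul K).const_add α
  have hpos : ∀ s ∈ Icc a b, 0 ≤ Ψ s := fun s hs => (hφ0 s).trans (h s hs)
  have hbound := norm_le_gronwallBound_of_norm_deriv_right_le (f := Ψ) (f' := fun s => K * φ s)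
    (δ := α) (K := K) (ε := 0) (a := a) (b := b)
    (fun s _ => (hd s).continuousAt.continuousWithinAt) (fun s _ => (hd s).hasDerivWithinAt)
    (by simp [hΨ, abs_of_nonneg hα]) (fun s hs => by
      have hs' := Ico_subset_Icc_self hs
      rw [add_zero, Real.norm_of_nonneg (mul_nonneg hK (hφ0 s)), Real.norm_of_nonneg (hpos s hs')]
      exact mul_le_mul_of_nonneg_left (h s hs') hK) s hs
  rw [gronwallBound_ε0] at hbound
  exact (h s hs).trans ((le_abs_self _).trans hbound)

/-! ### Stability of near minimizers at a point of differentiability -/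

section NearMinimizers

variable {V : Type*} [NormedAddCommGroup V] [InnerProductSpace ℝ V]

/-- Curves with energy close to the level `m` that satisfy the integrated Euler–Lagrange equation
up to a small error in `L²`. -/
structure IsApproxExtremal (ℓ : ℝ → V → V → ℝ) (Dx Dv : ℝ → V → V → V →L[ℝ] ℝ)
    (G : V → ℝ) (DG : V → V →L[ℝ] ℝ) (a b : ℝ) (y : V) (m δ : ℝ) (f : ℝ → V) : Prop where
  memLp : MemLp f 2 (volume.restrict (Ioc a b))
  action_le : action ℓ G a b y f ≤ m + δ ^ 2
  defect_le : ∫ s in a..b, ‖Dv s (curveOf a y f s) (f s) - momentum Dx DG a b y f s‖ ^ 2 ≤ δ ^ 2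

lemma IsApproxExtremal.mono {ℓ : ℝ → V → V → ℝ} {Dx Dv : ℝ → V → V → V →L[ℝ] ℝ}
    {G : V → ℝ} {DG : V → V →L[ℝ] ℝ} {a b : ℝ} {y : V} {m δ δ' : ℝ} {f : ℝ → V}
    (hδ0 : 0 ≤ δ) (hδ : δ ≤ δ')
    (hf : IsApproxExtremal ℓ Dx Dv G DG a b y m δ f) :
    IsApproxExtremal ℓ Dx Dv G DG a b y m δ' f where
  memLp := hf.memLp
  action_le := hf.action_le.trans (by gcongr)
  defect_le := hf.defect_le.trans (by gcongr)

namespace TonelliProblem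

variable {M : ℝ} {ℓ : ℝ → V → V → ℝ} {Dx Dv : ℝ → V → V → V →L[ℝ] ℝ}
  {G : V → ℝ} {DG : V → V →L[ℝ] ℝ} {a b : ℝ}

/-- Coercivity bounds ∫‖f‖², hence the position uniformly and, through the quadratic growth of D_xℓ,
the momentum. The bound depends only on the energy level, so the local Lipschitz constants can be
fixed once for all δ ≤ 1. -/
lemma exists_extremal_bound (h : TonelliProblem M ℓ Dx Dv G DG) (hab : a ≤ b) (y : V) (m : ℝ) :
    ∃ R, ∀ δ f, 0 ≤ δ → δ ≤ 1 → IsApproxExtremal ℓ Dx Dv G DG a b y m δ f → ∀ s ∈ Icc a b,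
      ‖curveOf a y f s‖ ≤ R ∧ ‖momentum Dx DG a b y f s‖ ≤ R := by
  have hM := h.pos
  obtain ⟨K, hK⟩ := h.exists_action_coercive hab y
  set N := 4 * M * (m + 1 + K) with hN
  refine ⟨max (‖y‖ + (N / 1 + 1 * (b - a)) / 2) (2 * M + M * ((b - a) + N)),
    fun δ f hδ0 hδ1 hf s hs => ?_⟩
  have hfi := hf.memLp.intervalIntegrable_of_two hab
  have h1 : ∫ s in a..b, ‖f s‖ ^ 2 ≤ N := by
    have h2 := hK f hf.memLp
    have h3 := hf.action_le
    have h4 : δ ^ 2 ≤ 1 := by nlinarith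
    have h5 := mul_le_mul_of_nonneg_left
      (by linarith : 1 / (4 * M) * (∫ s in a..b, ‖f s‖ ^ 2) ≤ m + 1 + K)
      (by positivity : 0 ≤ 4 * M)
    rwa [← mul_assoc, mul_one_div_cancel (by positivity), one_mul] at h5
  constructor
  · refine le_max_of_le_left ((norm_curveOf_le hfi y hs).trans (add_le_add le_rfl ?_))
    refine (intervalIntegral_norm_le_young hab hf.memLp one_pos).trans ?_
    gcongr
  · refine le_max_of_le_right ?_
    rw [momentum, norm_neg]
    refine (norm_add_le _ _).trans (add_le_add (h.dg_le _) ?_)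
    have hi := h.intervalIntegrable_dx_curve hab y hf.memLp
    refine (norm_intervalIntegral_le_of_mem' hi hs).trans ?_
    calc ∫ r in a..b, ‖Dx r (curveOf a y f r) (f r)‖
        ≤ ∫ r in a..b, M * (1 + ‖f r‖ ^ 2) :=
          intervalIntegral.integral_mono_on hab hi.norm
            ((intervalIntegrable_const.add (hf.memLp.intervalIntegrable_norm_sq hab)).const_mul M)
            fun r _ => h.dx_le _ _ _
      _ = M * ((b - a) + ∫ r in a..b, ‖f r‖ ^ 2) := by
          rw [intervalIntegral.integral_const_mul, intervalIntegral.integral_add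
            intervalIntegrable_const (hf.memLp.intervalIntegrable_norm_sq hab),
            intervalIntegral.integral_const, smul_eq_mul, mul_one]
      _ ≤ M * ((b - a) + N) := by gcongr

lemma intervalIntegrable_defect_sq (h : TonelliProblem M ℓ Dx Dv G DG) (hab : a ≤ b) (y : V)
    {f : ℝ → V} (hf : MemLp f 2 (volume.restrict (Ioc a b))) :
    IntervalIntegrable
      (fun s => ‖Dv s (curveOf a y f s) (f s) - momentum Dx DG a b y f s‖ ^ 2) volume a b :=
  (h.memLp_defect hab y hf).intervalIntegrable_norm_sq hab

/-- Effect on the action of a translation of an approximate extremal. -/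
lemma exists_action_translate_le (h : TonelliProblem M ℓ Dx Dv G DG) (hab : a ≤ b) (y : V)
    (m : ℝ) : ∃ C, 0 ≤ C ∧ ∀ ρ > 0, ∃ r > 0, ∀ δ f (z : V), 0 ≤ δ → δ ≤ 1 → ‖z‖ ≤ 1 → ‖z‖ < r →
      IsApproxExtremal ℓ Dx Dv G DG a b y m δ f →
      action ℓ G a b (y + z) f ≤ action ℓ G a b y f - momentum Dx DG a b y f a z
        + ‖z‖ * (C * ‖z‖ + C * δ ^ 2 + ρ) := by
  have hM := h.pos
  obtain ⟨R, hR⟩ := h.exists_extremal_bound hab y m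
  obtain ⟨C, hC0, hC⟩ := h.exists_dx_shift_le (R + 1)
  refine ⟨C * (1 + (b - a)), mul_nonneg hC0 (by linarith), fun ρ hρ => ?_⟩
  obtain ⟨r, hr, hDG⟩ := Metric.uniformContinuous_iff.1 h.dg_uc ρ hρ
  refine ⟨r, hr, fun δ f z hδ0 hδ1 hz1 hzr hf => ?_⟩
  set c := curveOf a y f with hc
  set P := momentum Dx DG a b y f with hP
  -- The velocity is kept, so the initial velocity and all v-arguments are unaffected; only the
  -- x-derivatives enter.
  have hcz : ∀ s, curveOf a (y + z) f s = c s + z := fun s => by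
    rw [hc, curveOf, curveOf]; abel
  have hDx := h.intervalIntegrable_dx_curve hab y hf.memLp
  have hE := h.intervalIntegrable_defect_sq hab y hf.memLp
  have hl := h.intervalIntegrable_curve hab y hf.memLp
  have hlz := h.intervalIntegrable_curve hab (y + z) hf.memLp
  have hpt : ∀ s ∈ Icc a b, ℓ s (curveOf a (y + z) f s) (f s) ≤
      ℓ s (c s) (f s) + Dx s (c s) (f s) z
        + C * (‖z‖ + ‖Dv s (c s) (f s) - P s‖ ^ 2) * ‖z‖ := by
    intro s hs
    obtain ⟨hc1, hP1⟩ := hR δ f hδ0 hδ1 hf s hs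
    rw [hcz]
    -- Taylor's formula in x, with the oscillation of D_xℓ controlled by ‖z‖ plus the squared
    -- defect.
    have h1 := (convex_closedBall (c s) ‖z‖).norm_image_sub_le_of_norm_hasFDerivWithin_le'
      (f := fun x => ℓ s x (f s)) (f' := fun x => Dx s x (f s)) (φ := Dx s (c s) (f s))
      (C := C * (‖z‖ + ‖Dv s (c s) (f s) - P s‖ ^ 2)) (x := c s) (y := c s + z)
      (fun x _ => (h.hasFDerivAt_left s x (f s)).hasFDerivWithinAt) (fun x hx => ?_)
      (Metric.mem_closedBall_self (norm_nonneg z)) (by simp)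
    · rw [add_sub_cancel_left] at h1
      have := (le_abs_self _).trans h1
      linarith
    · rw [mem_closedBall_iff_norm] at hx
      have hxR : ‖x‖ ≤ R + 1 := by
        have := norm_add_le (x - c s) (c s)
        rw [sub_add_cancel] at this
        linarith
      refine (hC s (c s) x (f s) (P s) (by linarith) hxR (by linarith)).trans ?_
      gcongr
  have hG : G (c b + z) ≤ G (c b) + DG (c b) z + ρ * ‖z‖ := by
    have h1 := (convex_closedBall (c b) ‖z‖).norm_image_sub_le_of_norm_hasFDerivWithin_le'
      (f := G) (f' := DG) (φ := DG (c b)) (C := ρ) (x := c b) (y := c b + z)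
      (fun x _ => (h.hasFDerivAt_terminal x).hasFDerivWithinAt) (fun x hx => ?_)
      (Metric.mem_closedBall_self (norm_nonneg z)) (by simp)
    · rw [add_sub_cancel_left] at h1
      have := (le_abs_self _).trans h1
      linarith
    · rw [← dist_eq_norm]
      exact (hDG (lt_of_le_of_lt (Metric.mem_closedBall.1 hx) hzr)).le
  have hDxz : IntervalIntegrable (fun s => Dx s (c s) (f s) z) volume a b :=
    ⟨(ContinuousLinearMap.apply ℝ ℝ z).integrable_comp hDx.1,
      (ContinuousLinearMap.apply ℝ ℝ z).integrable_comp hDx.2⟩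
  have hR3 : IntervalIntegrable (fun s => C * (‖z‖ + ‖Dv s (c s) (f s) - P s‖ ^ 2) * ‖z‖)
      volume a b := ((intervalIntegrable_const.add hE).const_mul C).mul_const ‖z‖
  have hint := intervalIntegral.integral_mono_on hab hlz ((hl.add hDxz).add hR3) hpt
  rw [intervalIntegral.integral_add (hl.add hDxz) hR3, intervalIntegral.integral_add hl hDxz,
    intervalIntegral.integral_mul_const, intervalIntegral.integral_const_mul,
    intervalIntegral.integral_add intervalIntegrable_const hE, intervalIntegral.integral_const,
    smul_eq_mul, ← ContinuousLinearMap.intervalIntegral_apply hDx] at hint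
  have hdef := hf.defect_le
  have hz0 := norm_nonneg z
  have hβ0 : 0 ≤ b - a := sub_nonneg.2 hab
  have hfin : C * ((b - a) * ‖z‖ + ∫ s in a..b, ‖Dv s (c s) (f s) - P s‖ ^ 2) * ‖z‖
      ≤ ‖z‖ * (C * (1 + (b - a)) * ‖z‖ + C * (1 + (b - a)) * δ ^ 2) := by
    rw [mul_comm]
    refine mul_le_mul_of_nonneg_left ?_ hz0
    have h1 := mul_le_mul_of_nonneg_left hdef hC0
    have h2 : 0 ≤ C * ‖z‖ := by positivity
    have h3 : 0 ≤ C * (b - a) * δ ^ 2 := by positivity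
    rw [mul_add]
    refine (add_le_add le_rfl h1).trans ?_
    linarith
  -- The first-order term of the translation is exactly -P(a), by the definition of the momentum.
  have hPz : P a z = -(DG (c b) z + (∫ s in a..b, Dx s (c s) (f s)) z) := by
    rw [hP, momentum, neg_apply, add_apply]
  unfold action
  rw [hPz, hcz b]
  linarith

/-- If the value function is differentiable at `x`, the initial momentum of the approximate
extremals starting at `x` is almost determined. -/
lemma exists_initial_momentum_close (h : TonelliProblem M ℓ Dx Dv G DG) (hab : a ≤ b)
    {U : V → ℝ} {x : V} {p : V →L[ℝ] ℝ}
    (hU : ∀ y f, MemLp f 2 (volume.restrict (Ioc a b)) → U y ≤ action ℓ G a b y f)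
    (hp : HasFDerivAt U p x) {ρ : ℝ} (hρ : 0 < ρ) :
    ∃ δ₀ > 0, δ₀ ≤ 1 ∧ ∀ δ f, 0 < δ → δ ≤ δ₀ →
      IsApproxExtremal ℓ Dx Dv G DG a b x (U x) δ f →
      ‖p + momentum Dx DG a b x f a‖ ≤ ρ := by
  obtain ⟨C, hC0, hC⟩ := h.exists_action_translate_le hab x (U x)
  obtain ⟨r, hr, hCr⟩ := hC (ρ / 4) (by positivity)
  have hlit := hp.isLittleO.def (by positivity : 0 < ρ / 4)
  obtain ⟨r', hr', hU'⟩ := Metric.eventually_nhds_iff.1 hlit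
  have hpos : 0 < ρ / (2 * (1 + 2 * C)) := by positivity
  -- The last entry ensures δ(1 + 2C) ≤ ρ/2; the remaining ρ/2 is shared by the modulus of DG and
  -- the differentiability error of U.
  refine ⟨min 1 (min (r / 2) (min (r' / 2) (ρ / (2 * (1 + 2 * C))))),
    by positivity, min_le_left _ _, fun δ f hδ0 hδ hf => ?_⟩
  obtain ⟨hδ1, hδ2⟩ := le_min_iff.1 hδ
  obtain ⟨hδr, hδ3⟩ := le_min_iff.1 hδ2
  obtain ⟨hδr', hδ4⟩ := le_min_iff.1 hδ3
  have hδ5 : δ * (1 + 2 * C) ≤ ρ / 2 := by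
    have := mul_le_mul_of_nonneg_right hδ4 (by positivity : 0 ≤ 1 + 2 * C)
    refine this.trans (le_of_eq ?_)
    field_simp
  set P := momentum Dx DG a b x f a with hP
  -- Translate by δu. The slack δ² of the action is of second order at this scale, so dividing
  -- U(x+δu) ≤ action by δ leaves (p + P)u ≤ δ + Cδ + Cδ² + ρ/2.
  have key : ∀ u : V, ‖u‖ = 1 → (p + P) u ≤ ρ := by
    intro u hu
    have hz : ‖δ • u‖ = δ := by rw [norm_smul, hu, mul_one, Real.norm_of_nonneg hδ0.le]
    have h1 := hCr δ f (δ • u) hδ0.le hδ1 (hz.le.trans hδ1) (by rw [hz]; linarith) hf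
    have h2 := hU (x + δ • u) f hf.memLp
    have h3 := hf.action_le
    have h4 := hU' (y := x + δ • u) (by rw [dist_eq_norm, add_sub_cancel_left, hz]; linarith)
    rw [add_sub_cancel_left, hz] at h4
    have h5 := neg_le_of_abs_le h4
    rw [hz] at h1
    rw [map_smul, smul_eq_mul] at h1 h5
    have h6 : δ * (p + P) u ≤ δ * (δ + (C * δ + C * δ ^ 2 + ρ / 4) + ρ / 4) := by
      rw [add_apply]
      nlinarith
    have h7 := le_of_mul_le_mul_left h6 hδ0
    have h8 : C * δ ^ 2 ≤ C * δ := mul_le_mul_of_nonneg_left (by nlinarith) hC0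
    linarith
  -- The one-sided bound suffices, since u may be replaced by -u.
  refine ContinuousLinearMap.opNorm_le_of_unit_norm hρ.le fun u hu => ?_
  rw [Real.norm_eq_abs, _root_.abs_le]
  have h1 := key (-u) (by rw [norm_neg, hu])
  rw [map_neg] at h1
  exact ⟨by linarith, key u hu⟩

/-- Approximate extremals depend continuously on their initial momentum. -/
lemma exists_extremal_close (h : TonelliProblem M ℓ Dx Dv G DG) (hab : a ≤ b) (y : V) (m : ℝ) :
    ∃ C, 0 ≤ C ∧ ∀ δ f f', 0 < δ → δ ≤ 1 → IsApproxExtremal ℓ Dx Dv G DG a b y m δ f →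
      IsApproxExtremal ℓ Dx Dv G DG a b y m δ f' → ∀ s ∈ Icc a b,
      ‖curveOf a y f s - curveOf a y f' s‖
        + ‖momentum Dx DG a b y f s - momentum Dx DG a b y f' s‖
      ≤ C * (‖momentum Dx DG a b y f a - momentum Dx DG a b y f' a‖ + δ) := by
  obtain ⟨R, hR⟩ := h.exists_extremal_bound hab y m
  obtain ⟨C, hC0, hC⟩ := h.exists_compare R
  have hβ0 : 0 ≤ b - a := sub_nonneg.2 hab
  set C₁ := 1 + 2 * C * (2 * (1 + (b - a)) + 2) with hC₁
  have hC₁0 : 0 ≤ C₁ := by positivity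
  refine ⟨C₁ * Real.exp (2 * C * (b - a)), by positivity, fun δ f f' hδ0 hδ1 hf hf' s hs => ?_⟩
  have hfi := hf.memLp.intervalIntegrable_of_two hab
  have hfi' := hf'.memLp.intervalIntegrable_of_two hab
  have hDx := h.intervalIntegrable_dx_curve hab y hf.memLp
  have hDx' := h.intervalIntegrable_dx_curve hab y hf'.memLp
  have hE := (h.memLp_defect hab y hf.memLp)
  have hE' := (h.memLp_defect hab y hf'.memLp)
  have hc := continuousOn_curveOf hab hfi y
  have hc' := continuousOn_curveOf hab hfi' y
  have hPc := h.continuousOn_momentum hab y hf.memLp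
  have hPc' := h.continuousOn_momentum hab y hf'.memLp
  set c := curveOf a y f
  set c' := curveOf a y f'
  set P := momentum Dx DG a b y f
  set P' := momentum Dx DG a b y f'
  set e : ℝ → V →L[ℝ] ℝ := fun s => Dv s (c s) (f s) - P s
  set e' : ℝ → V →L[ℝ] ℝ := fun s => Dv s (c' s) (f' s) - P' s
  set φ : ℝ → ℝ := fun s => ‖c s - c' s‖ + ‖P s - P' s‖ with hφ
  have hφc : ContinuousOn φ (Icc a b) := (hc.sub hc').norm.add (hPc.sub hPc').norm
  -- Constant extension beyond [a,b], as `le_mul_exp_of_le_add_integral` asks for continuity on ℝ.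
  set ψ : ℝ → ℝ := fun s => φ (projIcc a b hab s) with hψ
  have hψc : Continuous ψ :=
    (continuousOn_iff_continuous_domRestrict.1 hφc).comp continuous_projIcc
  have hψφ : ∀ s ∈ Icc a b, ψ s = φ s := fun s hs => by
    simp only [hψ, projIcc_of_mem hab hs]
  set err : ℝ → ℝ := fun s => ‖e s‖ + ‖e' s‖ + ‖e s‖ ^ 2 + ‖e' s‖ ^ 2 with herr
  have herri : IntervalIntegrable err volume a b :=
    (((hE.intervalIntegrable_of_two hab).norm.add (hE'.intervalIntegrable_of_two hab).norm).add
      (hE.intervalIntegrable_norm_sq hab)).add (hE'.intervalIntegrable_norm_sq hab)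
  -- The two L¹ norms give δ(1 + (b - a)) each; the two squares give δ² ≤ δ each.
  have herr_le : ∫ s in a..b, err s ≤ (2 * (1 + (b - a)) + 2) * δ := by
    have h1 := intervalIntegral_norm_le_of_sq_le hab hE hδ0 hf.defect_le
    have h2 := intervalIntegral_norm_le_of_sq_le hab hE' hδ0 hf'.defect_le
    have h3 := hf.defect_le
    have h4 := hf'.defect_le
    have h5 : δ ^ 2 ≤ δ := by nlinarith
    rw [herr, intervalIntegral.integral_add
      (((hE.intervalIntegrable_of_two hab).norm.add (hE'.intervalIntegrable_of_two hab).norm).add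
      (hE.intervalIntegrable_norm_sq hab)) (hE'.intervalIntegrable_norm_sq hab),
      intervalIntegral.integral_add
      ((hE.intervalIntegrable_of_two hab).norm.add (hE'.intervalIntegrable_of_two hab).norm)
      (hE.intervalIntegrable_norm_sq hab), intervalIntegral.integral_add
      (hE.intervalIntegrable_of_two hab).norm (hE'.intervalIntegrable_of_two hab).norm]
    linarith
  have hineq : ∀ s ∈ Icc a b, ψ s ≤
      C₁ * (‖P a - P' a‖ + δ) + (2 * C) * ∫ r in a..s, ψ r := by
    intro s hs
    have hsub : Icc a s ⊆ Icc a b := Icc_subset_Icc_right hs.2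
    rw [hψφ s hs]
    have h1 : ‖c s - c' s‖ ≤ ∫ r in a..s, ‖f r - f' r‖ :=
      norm_curveOf_sub_le (hfi.mono_left_of_mem hs) (hfi'.mono_left_of_mem hs) y
        (right_mem_Icc.2 hs.1)
    have h2 : ‖P s - P' s‖ ≤ ‖P a - P' a‖
        + ∫ r in a..s, ‖Dx r (c r) (f r) - Dx r (c' r) (f' r)‖ := by
      have hPs : P s = P a + ∫ r in a..s, Dx r (c r) (f r) := h.momentum_eq hab y hf.memLp hs
      have hPs' : P' s = P' a + ∫ r in a..s, Dx r (c' r) (f' r) :=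
        h.momentum_eq hab y hf'.memLp hs
      have e1 : P s - P' s = (P a - P' a)
          + ∫ r in a..s, (Dx r (c r) (f r) - Dx r (c' r) (f' r)) := by
        rw [intervalIntegral.integral_sub (hDx.mono_left_of_mem hs) (hDx'.mono_left_of_mem hs),
          hPs, hPs']
        abel
      rw [e1]
      exact (norm_add_le _ _).trans (add_le_add le_rfl
        (intervalIntegral.norm_integral_le_integral_norm hs.1))
    have hpt : ∀ r ∈ Icc a s, ‖f r - f' r‖ + ‖Dx r (c r) (f r) - Dx r (c' r) (f' r)‖ ≤
        2 * C * (ψ r + err r) := by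
      intro r hr
      have hr' := hsub hr
      obtain ⟨hb1, hb2⟩ := hR δ f hδ0.le hδ1 hf r hr'
      obtain ⟨hb1', hb2'⟩ := hR δ f' hδ0.le hδ1 hf' r hr'
      obtain ⟨k1, k2⟩ := hC r (c r) (c' r) (f r) (f' r) (P r) (P' r) hb1 hb1' hb2 hb2'
      rw [hψφ r hr']
      have k3 : 0 ≤ C * (‖e r‖ ^ 2 + ‖e' r‖ ^ 2) := by positivity
      simp only [hφ, herr]
      have k4 := add_le_add k1 k2
      refine k4.trans ?_
      change C * (_ + _ + ‖e r‖ + ‖e' r‖) + C * (_ + _ + ‖e r‖ + ‖e' r‖ + ‖e r‖ ^ 2 + ‖e' r‖ ^ 2)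
        ≤ _
      linarith
    have hi1 := (hfi.mono_left_of_mem hs).sub (hfi'.mono_left_of_mem hs)
    have hi2 := (hDx.mono_left_of_mem hs).sub (hDx'.mono_left_of_mem hs)
    have hi3 : IntervalIntegrable ψ volume a s := hψc.intervalIntegrable _ _
    have hint := intervalIntegral.integral_mono_on hs.1 (hi1.norm.add hi2.norm)
      ((hi3.add (herri.mono_left_of_mem hs)).const_mul (2 * C)) hpt
    rw [intervalIntegral.integral_add hi1.norm hi2.norm, intervalIntegral.integral_const_mul,
      intervalIntegral.integral_add hi3 (herri.mono_left_of_mem hs)] at hint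
    have herrs : ∫ r in a..s, err r ≤ (2 * (1 + (b - a)) + 2) * δ :=
      (intervalIntegral.integral_mono_interval le_rfl hs.1 hs.2
        (Eventually.of_forall fun r => by positivity) herri).trans herr_le
    have h3 := mul_le_mul_of_nonneg_left herrs (by positivity : 0 ≤ 2 * C)
    have h4 : 0 ≤ 2 * C * (2 * (1 + (b - a)) + 2) * ‖P a - P' a‖ := by positivity
    have h5 : C₁ * (‖P a - P' a‖ + δ) = ‖P a - P' a‖ + δ
        + 2 * C * (2 * (1 + (b - a)) + 2) * ‖P a - P' a‖
        + 2 * C * ((2 * (1 + (b - a)) + 2) * δ) := by rw [hC₁]; ring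
    rw [h5]
    change ‖c s - c' s‖ + ‖P s - P' s‖ ≤ _
    linarith
  have hgr := le_mul_exp_of_le_add_integral hψc
    (fun s => add_nonneg (norm_nonneg _) (norm_nonneg _)) (by positivity : 0 ≤ 2 * C) hineq hs
  rw [hψφ s hs] at hgr
  refine hgr.trans ?_
  rw [mul_right_comm]
  gcongr
  exact hs.2

/-- If the value function is differentiable at `x`, near minimizers starting at `x` are close to
one another. -/
theorem near_minimizers_close [CompleteSpace V] (h : TonelliProblem M ℓ Dx Dv G DG) (hab : a ≤ b)
    {U : V → ℝ} {x : V} (hU : ∀ y f, MemLp f 2 (volume.restrict (Ioc a b)) → U y ≤ action ℓ G a b y f)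
    (hdiff : DifferentiableAt ℝ U x) {ρ : ℝ} (hρ : 0 < ρ) :
    ∃ δ > 0, ∀ f f', MemLp f 2 (volume.restrict (Ioc a b)) →
      MemLp f' 2 (volume.restrict (Ioc a b)) → action ℓ G a b x f ≤ U x + δ →
      action ℓ G a b x f' ≤ U x + δ →
      ∀ s ∈ Icc a b, ‖curveOf a x f s - curveOf a x f' s‖ ≤ ρ := by
  obtain ⟨C, hC0, hC⟩ := h.exists_extremal_close hab x (U x)
  have hβ0 : 0 ≤ b - a := sub_nonneg.2 hab
  -- Chain f, w, w', f'. The outer links cost δ(1 + (b - a)) each; the middle one C times two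
  -- momentum errors ρ/D plus δ ≤ ρ/D.
  set D := 3 * C + 2 * (1 + (b - a)) with hD
  have hD0 : 0 < D := by positivity
  obtain ⟨δ₀, hδ₀, hδ₀1, hini⟩ := h.exists_initial_momentum_close hab hU hdiff.hasFDerivAt
    (div_pos hρ hD0)
  set δ := min δ₀ (ρ / D) with hδ
  have hδ0 : 0 < δ := lt_min hδ₀ (div_pos hρ hD0)
  have hδle : δ ≤ δ₀ := min_le_left _ _
  have hδρ : δ ≤ ρ / D := min_le_right _ _
  refine ⟨δ ^ 2, by positivity, fun f f' hf hf' ha ha' s hs => ?_⟩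
  obtain ⟨w, hw1, hw2, hw3, hw4⟩ := h.exists_approx_extremal hab x hf hδ0 (hU x) ha
  obtain ⟨w', hw1', hw2', hw3', hw4'⟩ := h.exists_approx_extremal hab x hf' hδ0 (hU x) ha'
  have hw : IsApproxExtremal ℓ Dx Dv G DG a b x (U x) δ w := ⟨hw1, hw2, hw4⟩
  have hw' : IsApproxExtremal ℓ Dx Dv G DG a b x (U x) δ w' := ⟨hw1', hw2', hw4'⟩
  have h1 := hini δ w hδ0 hδle hw
  have h2 := hini δ w' hδ0 hδle hw'
  have h3 := hC δ w w' hδ0 (hδle.trans hδ₀1) hw hw' s hs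
  have hclose : ∀ {k k' : ℝ → V}, MemLp k 2 (volume.restrict (Ioc a b)) →
      MemLp k' 2 (volume.restrict (Ioc a b)) → ∫ s in a..b, ‖k s - k' s‖ ^ 2 ≤ δ ^ 2 →
      ‖curveOf a x k s - curveOf a x k' s‖ ≤ δ * (1 + (b - a)) := fun hk hk' hkk' =>
    (norm_curveOf_sub_le (hk.intervalIntegrable_of_two hab) (hk'.intervalIntegrable_of_two hab)
      x hs).trans (intervalIntegral_norm_le_of_sq_le hab (hk.sub hk') hδ0 hkk')
  have h4 := hclose hw1 hf hw3
  have h5 := hclose hw1' hf' hw3'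
  have h6 : ‖momentum Dx DG a b x w a - momentum Dx DG a b x w' a‖ ≤ ρ / D + ρ / D := by
    have : momentum Dx DG a b x w a - momentum Dx DG a b x w' a
        = (fderiv ℝ U x + momentum Dx DG a b x w a) - (fderiv ℝ U x + momentum Dx DG a b x w' a) := by
      abel
    rw [this]
    exact (norm_sub_le _ _).trans (add_le_add h1 h2)
  have h7 : ‖curveOf a x f s - curveOf a x f' s‖ ≤ ‖curveOf a x w s - curveOf a x f s‖
      + ‖curveOf a x w s - curveOf a x w' s‖ + ‖curveOf a x w' s - curveOf a x f' s‖ := by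
    have : curveOf a x f s - curveOf a x f' s = -(curveOf a x w s - curveOf a x f s)
      + (curveOf a x w s - curveOf a x w' s) + (curveOf a x w' s - curveOf a x f' s) := by abel
    rw [this]
    refine (norm_add_le _ _).trans (add_le_add ((norm_add_le _ _).trans ?_) le_rfl)
    rw [norm_neg]
  have h8 := norm_nonneg (momentum Dx DG a b x w s - momentum Dx DG a b x w' s)
  have h9 : C * (‖momentum Dx DG a b x w a - momentum Dx DG a b x w' a‖ + δ) ≤
      C * (ρ / D + ρ / D + ρ / D) := by gcongr
  have h10 : δ * (1 + (b - a)) ≤ ρ / D * (1 + (b - a)) := by gcongr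
  have h11 : ρ / D * D = ρ := div_mul_cancel₀ _ hD0.ne'
  have h12 : ρ / D * D = C * (ρ / D + ρ / D + ρ / D) + 2 * (ρ / D * (1 + (b - a))) := by
    rw [hD]; ring
  linarith

end TonelliProblem

end NearMinimizers

/-! ### Existence of a minimizer with continuous velocity -/

section Existence

variable {V : Type*} [NormedAddCommGroup V] [InnerProductSpace ℝ V]

namespace TonelliProblem

variable {M : ℝ} {ℓ : ℝ → V → V → ℝ} {Dx Dv : ℝ → V → V → V →L[ℝ] ℝ}
  {G : V → ℝ} {DG : V → V →L[ℝ] ℝ} {a b : ℝ}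

/-- The Legendre transform: every momentum is attained by some velocity. -/
lemma exists_dv_eq [FiniteDimensional ℝ V] (h : TonelliProblem M ℓ Dx Dv G DG) (s : ℝ) (x : V)
    (P : V →L[ℝ] ℝ) : ∃ v, Dv s x v = P := by
  have hM := h.pos
  have : ProperSpace V := FiniteDimensional.proper_real V
  obtain ⟨A, hA0, hA⟩ := h.bdd
  have hd : ∀ v, HasFDerivAt (fun v => ℓ s x v - P v) (Dv s x v - P) v :=
    fun v => (h.hasFDerivAt_right s x v).sub P.hasFDerivAt
  have hc : Continuous fun v => ℓ s x v - P v :=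
    continuous_iff_continuousAt.2 fun v => (hd v).continuousAt
  -- Quadratic growth makes v ↦ ℓ(s,x,v) - Pv attain its minimum, and the critical point equation
  -- there is D_vℓ = P.
  have hlim : Tendsto (fun v => ℓ s x v - P v) (cocompact V) atTop := by
    have h1 : Tendsto (fun r : ℝ => r * (1 / (2 * M) * r + -(M + ‖P‖)) + (-A - M * ‖x‖)) atTop
        atTop := by
      refine tendsto_atTop_add_const_right _ _ (Tendsto.atTop_mul_atTop₀ tendsto_id ?_)
      exact tendsto_atTop_add_const_right _ _
        (tendsto_id.const_mul_atTop (by positivity : 0 < 1 / (2 * M)))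
    refine tendsto_atTop_mono (fun v => ?_) (h1.comp (tendsto_norm_cocompact_atTop (E := V)))
    have h2 := h.coercive hA s x v
    have h3 := (le_abs_self _).trans (P.le_opNorm v)
    simp only [Function.comp_apply]
    nlinarith
  obtain ⟨v, hv⟩ := hc.exists_forall_le hlim
  refine ⟨v, sub_eq_zero.1 ?_⟩
  exact IsLocalMin.hasFDerivAt_eq_zero (Eventually.of_forall hv) (hd v)

/-- The velocity determined by a continuous position and momentum is continuous. -/
lemma continuousOn_of_dv_eq (h : TonelliProblem M ℓ Dx Dv G DG) {S : Set ℝ} {c W : ℝ → V}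
    {P : ℝ → V →L[ℝ] ℝ} (hc : ContinuousOn c S) (hP : ContinuousOn P S)
    (hW : ∀ s ∈ S, Dv s (c s) (W s) = P s) : ContinuousOn W S := by
  intro s hs
  -- Keep the velocity W(s) fixed: the mismatch with P(r) tends to 0 and dominates ‖W(r) - W(s)‖ by
  -- strong monotonicity.
  have h1 : Tendsto (fun r => M * ‖P r - Dv r (c r) (W s)‖) (𝓝[S] s) (𝓝 0) := by
    have h2 : ContinuousOn (fun r => M * ‖P r - Dv r (c r) (W s)‖) S := by
      refine continuousOn_const.mul (ContinuousOn.norm (hP.sub ?_))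
      exact h.cont_dv.comp_continuousOn
        (continuousOn_id.prodMk (hc.prodMk continuousOn_const))
    have h3 := h2 s hs
    have h4 : M * ‖P s - Dv s (c s) (W s)‖ = 0 := by rw [hW s hs, sub_self, norm_zero, mul_zero]
    rw [ContinuousWithinAt, h4] at h3
    exact h3
  rw [ContinuousWithinAt, tendsto_iff_norm_sub_tendsto_zero]
  refine squeeze_zero' (Eventually.of_forall fun _ => norm_nonneg _) ?_ h1
  filter_upwards [self_mem_nhdsWithin] with r hr
  rw [← hW r hr]
  exact h.norm_sub_le_dv r (c r) (W s) (W r)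

/-- Lower semicontinuity of the action at a curve with bounded velocity. -/
lemma action_le_of_close (h : TonelliProblem M ℓ Dx Dv G DG) (hab : a ≤ b) (y : V)
    {f w : ℝ → V} (hf : MemLp f 2 (volume.restrict (Ioc a b)))
    (hw : MemLp w 2 (volume.restrict (Ioc a b))) {B η : ℝ} (hB : ∀ s ∈ Icc a b, ‖w s‖ ≤ B)
    (hη : ∫ s in a..b, ‖f s - w s‖ ≤ η) :
    action ℓ G a b y w ≤ action ℓ G a b y f
      + M * ((1 + B ^ 2) * (b - a) + (1 + B) + 2) * η := by
  have hM := h.pos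
  have hβ0 : 0 ≤ b - a := sub_nonneg.2 hab
  have hB0 : 0 ≤ B := (norm_nonneg _).trans (hB a (left_mem_Icc.2 hab))
  have hfi := hf.intervalIntegrable_of_two hab
  have hwi := hw.intervalIntegrable_of_two hab
  have hc : ∀ s ∈ Icc a b, ‖curveOf a y w s - curveOf a y f s‖ ≤ η := fun s hs => by
    rw [norm_sub_rev]
    exact (norm_curveOf_sub_le hfi hwi y hs).trans hη
  have hpt : ∀ s ∈ Icc a b, ℓ s (curveOf a y w s) (w s) ≤ ℓ s (curveOf a y f s) (f s)
      + M * (1 + B ^ 2) * η + M * (1 + B) * ‖f s - w s‖ := by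
    intro s hs
    have h1 := (le_abs_self _).trans (h.abs_sub_le_left s (curveOf a y w s) (curveOf a y f s) (w s))
    -- Convexity is used at the bounded velocity w, so the error is linear in f - w and closeness in
    -- L¹ is enough.
    have h2 := h.quadratic_lower s (curveOf a y f s) (w s) (f s)
    have h3 := neg_le_of_abs_le
      ((Dv s (curveOf a y f s) (w s)).le_of_opNorm_le (h.dv_le _ _ _) (f s - w s))
    have h4 : M * (1 + ‖w s‖ ^ 2) * ‖curveOf a y w s - curveOf a y f s‖ ≤ M * (1 + B ^ 2) * η := by
      gcongr
      · exact hB s hs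
      · exact hc s hs
    have h5 : M * (1 + ‖w s‖) * ‖f s - w s‖ ≤ M * (1 + B) * ‖f s - w s‖ := by
      gcongr
      exact hB s hs
    have h6 : 0 ≤ 1 / (2 * M) * ‖f s - w s‖ ^ 2 := by positivity
    linarith
  have hl := h.intervalIntegrable_curve hab y hf
  have hd : IntervalIntegrable (fun s => ‖f s - w s‖) volume a b := (hfi.sub hwi).norm
  have hint := intervalIntegral.integral_mono_on hab (h.intervalIntegrable_curve hab y hw)
    ((hl.add intervalIntegrable_const).add (hd.const_mul (M * (1 + B)))) hpt
  rw [intervalIntegral.integral_add (hl.add intervalIntegrable_const) (hd.const_mul _),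
    intervalIntegral.integral_add hl intervalIntegrable_const, intervalIntegral.integral_const,
    intervalIntegral.integral_const_mul, smul_eq_mul] at hint
  have hG := (le_abs_self _).trans (h.abs_terminal_sub_le (curveOf a y w b) (curveOf a y f b))
  have hG' := mul_le_mul_of_nonneg_left (hc b (right_mem_Icc.2 hab)) (by positivity : 0 ≤ 2 * M)
  have h7 := mul_le_mul_of_nonneg_left hη (by positivity : 0 ≤ M * (1 + B))
  unfold action
  linarith

/-- If the value function is differentiable at `x`, the infimum of the action over the curves
starting at `x` is attained by a curve with continuous velocity. -/
theorem exists_continuous_minimizer [FiniteDimensional ℝ V] (h : TonelliProblem M ℓ Dx Dv G DG)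
    (hab : a ≤ b) {U : V → ℝ} {x : V}
    (hU : ∀ y f, MemLp f 2 (volume.restrict (Ioc a b)) → U y ≤ action ℓ G a b y f)
    (hUx : ∀ δ > 0, ∃ f, MemLp f 2 (volume.restrict (Ioc a b)) ∧ action ℓ G a b x f ≤ U x + δ)
    (hdiff : DifferentiableAt ℝ U x) :
    ∃ w : ℝ → V, Continuous w ∧ action ℓ G a b x w ≤ U x := by
  have hM := h.pos
  have : CompleteSpace V := FiniteDimensional.complete ℝ V
  have hβ0 : 0 ≤ b - a := sub_nonneg.2 hab
  set δ : ℕ → ℝ := fun n => 1 / ((n : ℝ) + 1) with hδdef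
  have hδ0 : ∀ n, 0 < δ n := fun n => Nat.one_div_pos_of_nat
  have hδ1 : ∀ n, δ n ≤ 1 := fun n => by
    rw [hδdef]
    exact div_le_one_of_le₀ (by linarith [(Nat.cast_nonneg n : (0 : ℝ) ≤ n)]) (by positivity)
  have hδanti : Antitone δ := fun n m hnm => Nat.one_div_le_one_div hnm
  have hδlim : Tendsto δ atTop (𝓝 0) := tendsto_one_div_add_atTop_nhds_zero_nat
  have hseq : ∀ n, ∃ f, IsApproxExtremal ℓ Dx Dv G DG a b x (U x) (δ n) f := fun n => by
    obtain ⟨f, hf, hfa⟩ := hUx (δ n ^ 2) (pow_pos (hδ0 n) 2)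
    obtain ⟨w, hw1, hw2, -, hw3⟩ := h.exists_approx_extremal hab x hf (hδ0 n) (hU x) hfa
    exact ⟨w, hw1, hw2, hw3⟩
  choose w hw using hseq
  set c : ℕ → ℝ → V := fun n => curveOf a x (w n) with hc
  set P : ℕ → ℝ → V →L[ℝ] ℝ := fun n => momentum Dx DG a b x (w n) with hP
  obtain ⟨C, hC0, hC⟩ := h.exists_extremal_close hab x (U x)
  obtain ⟨R, hR⟩ := h.exists_extremal_bound hab x (U x)
  -- Both curves are approximate extremals at the coarser level δ_N, and both initial momenta are
  -- close to -DU(x); the factor 3 counts two momentum errors and δ_N.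
  have hcauchy : ∀ ρ > 0, ∃ N, ∀ n ≥ N, ∀ k ≥ N, ∀ s ∈ Icc a b,
      ‖c n s - c k s‖ + ‖P n s - P k s‖ ≤ ρ := by
    intro ρ hρ
    have hσ : 0 < ρ / (3 * (C + 1)) := by positivity
    obtain ⟨δ₀, hδ₀, -, hini⟩ := h.exists_initial_momentum_close hab hU hdiff.hasFDerivAt hσ
    obtain ⟨N, hN⟩ := (hδlim.eventually (gt_mem_nhds (lt_min hδ₀ hσ))).exists
    obtain ⟨hN1, hN2⟩ := lt_min_iff.1 hN
    refine ⟨N, fun n hn k hk s hs => ?_⟩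
    have hn' : IsApproxExtremal ℓ Dx Dv G DG a b x (U x) (δ N) (w n) :=
      IsApproxExtremal.mono (hδ0 n).le (hδanti hn) (hw n)
    have hk' : IsApproxExtremal ℓ Dx Dv G DG a b x (U x) (δ N) (w k) :=
      IsApproxExtremal.mono (hδ0 k).le (hδanti hk) (hw k)
    have h1 := hini _ _ (hδ0 N) hN1.le hn'
    have h2 := hini _ _ (hδ0 N) hN1.le hk'
    refine (hC _ _ _ (hδ0 N) (hδ1 N) hn' hk' s hs).trans ?_
    have h3 : momentum Dx DG a b x (w n) a - momentum Dx DG a b x (w k) a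
        = (fderiv ℝ U x + momentum Dx DG a b x (w n) a)
          - (fderiv ℝ U x + momentum Dx DG a b x (w k) a) := by abel
    have h4 : ‖momentum Dx DG a b x (w n) a - momentum Dx DG a b x (w k) a‖ + δ N
        ≤ 3 * (ρ / (3 * (C + 1))) := by
      rw [h3]
      linarith [norm_sub_le (fderiv ℝ U x + momentum Dx DG a b x (w n) a)
        (fderiv ℝ U x + momentum Dx DG a b x (w k) a)]
    calc C * _ ≤ (C + 1) * (3 * (ρ / (3 * (C + 1)))) :=
          mul_le_mul (by linarith) h4 (by positivity) (by positivity)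
      _ = ρ := by field_simp
  have hcU : UniformCauchySeqOn c atTop (Icc a b) := by
    rw [Metric.uniformCauchySeqOn_iff]
    intro ρ hρ
    obtain ⟨N, hN⟩ := hcauchy (ρ / 2) (by positivity)
    refine ⟨N, fun n hn k hk s hs => ?_⟩
    rw [dist_eq_norm]
    linarith [hN n hn k hk s hs, norm_nonneg (P n s - P k s)]
  have hPU : UniformCauchySeqOn P atTop (Icc a b) := by
    rw [Metric.uniformCauchySeqOn_iff]
    intro ρ hρ
    obtain ⟨N, hN⟩ := hcauchy (ρ / 2) (by positivity)
    refine ⟨N, fun n hn k hk s hs => ?_⟩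
    rw [dist_eq_norm]
    linarith [hN n hn k hk s hs, norm_nonneg (c n s - c k s)]
  have hlimc : ∀ s, ∃ z, s ∈ Icc a b → Tendsto (fun n => c n s) atTop (𝓝 z) := fun s => by
    by_cases hs : s ∈ Icc a b
    · obtain ⟨z, hz⟩ := cauchySeq_tendsto_of_complete (hcU.cauchySeq hs)
      exact ⟨z, fun _ => hz⟩
    · exact ⟨0, fun hs' => absurd hs' hs⟩
  have hlimP : ∀ s, ∃ z, s ∈ Icc a b → Tendsto (fun n => P n s) atTop (𝓝 z) := fun s => by
    by_cases hs : s ∈ Icc a b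
    · obtain ⟨z, hz⟩ := cauchySeq_tendsto_of_complete (hPU.cauchySeq hs)
      exact ⟨z, fun _ => hz⟩
    · exact ⟨0, fun hs' => absurd hs' hs⟩
  choose c₀ hc₀ using hlimc
  choose P₀ hP₀ using hlimP
  have hcT := hcU.tendstoUniformlyOn_of_tendsto (f := c₀) fun s hs => hc₀ s hs
  have hPT := hPU.tendstoUniformlyOn_of_tendsto (f := P₀) fun s hs => hP₀ s hs
  have hcn : ∀ n, ContinuousOn (c n) (Icc a b) := fun n =>
    continuousOn_curveOf hab ((hw n).memLp.intervalIntegrable_of_two hab) x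
  have hPn : ∀ n, ContinuousOn (P n) (Icc a b) := fun n =>
    h.continuousOn_momentum hab x (hw n).memLp
  have hc₀c : ContinuousOn c₀ (Icc a b) := hcT.continuousOn (Frequently.of_forall hcn)
  have hP₀c : ContinuousOn P₀ (Icc a b) := hPT.continuousOn (Frequently.of_forall hPn)
  -- The limit velocity is recovered from the limits of position and momentum by the Legendre
  -- transform; its continuity is inherited from theirs.
  choose W hW using fun s => h.exists_dv_eq s (c₀ s) (P₀ s)
  have hWc : ContinuousOn W (Icc a b) := h.continuousOn_of_dv_eq hc₀c hP₀c fun s _ => hW s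
  set w₀ : ℝ → V := fun s => W (projIcc a b hab s) with hw₀
  have hw₀c : Continuous w₀ :=
    (continuousOn_iff_continuous_domRestrict.1 hWc).comp continuous_projIcc
  have hw₀W : ∀ s ∈ Icc a b, w₀ s = W s := fun s hs => by simp only [hw₀, projIcc_of_mem hab hs]
  obtain ⟨B, hB⟩ := isCompact_Icc.exists_bound_of_continuousOn hw₀c.continuousOn (s := Icc a b)
  have hw₀L : MemLp w₀ 2 (volume.restrict (Ioc a b)) :=
    MemLp.of_bound hw₀c.aestronglyMeasurable B
      ((ae_restrict_mem measurableSet_Ioc).mono fun s hs => hB s (Ioc_subset_Icc_self hs))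
  obtain ⟨C', hC'0, hC'⟩ := h.lip (max R B)
  have hRc₀ : ∀ s ∈ Icc a b, ‖c₀ s‖ ≤ R := fun s hs =>
    le_of_tendsto (hc₀ s hs).norm (Eventually.of_forall fun n =>
      (hR (δ n) (w n) (hδ0 n).le (hδ1 n) (hw n) s hs).1)
  have hwlim : ∀ ρ > 0, ∀ᶠ n in atTop, ∫ s in a..b, ‖w n s - w₀ s‖ ≤ ρ := by
    intro ρ hρ
    set D := M * ((1 + (b - a)) + (1 + C') * (b - a)) + 1 with hD
    have hD0 : 0 < D := by positivity
    have hσ : 0 < ρ / D := by positivity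
    filter_upwards [Metric.tendstoUniformlyOn_iff.1 hcT _ hσ,
      Metric.tendstoUniformlyOn_iff.1 hPT _ hσ, hδlim.eventually (gt_mem_nhds hσ)] with n h1 h2 h3
    have hE := h.memLp_defect hab x (hw n).memLp
    have hEi := hE.intervalIntegrable_of_two hab
    have hpt : ∀ s ∈ Icc a b, ‖w n s - w₀ s‖ ≤
        M * (‖Dv s (c n s) (w n s) - P n s‖ + (1 + C') * (ρ / D)) := by
      intro s hs
      refine (h.norm_sub_le_dv s (c n s) (w₀ s) (w n s)).trans
        (mul_le_mul_of_nonneg_left ?_ hM.le)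
      -- Defect, convergence of the momenta, and convergence of the positions; D_vℓ is Lipschitz in
      -- x at the bounded velocity w₀.
      have k1 : Dv s (c n s) (w n s) - Dv s (c n s) (w₀ s) =
          (Dv s (c n s) (w n s) - P n s) + (P n s - P₀ s)
            + (Dv s (c₀ s) (w₀ s) - Dv s (c n s) (w₀ s)) := by
        rw [hw₀W s hs, hW]; abel
      rw [k1]
      have k2 := (hC' s (c₀ s) (c n s) (w₀ s) (w₀ s) (le_max_of_le_left (hRc₀ s hs))
        (le_max_of_le_left (hR (δ n) (w n) (hδ0 n).le (hδ1 n) (hw n) s hs).1)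
        (le_max_of_le_right (hB s hs)) (le_max_of_le_right (hB s hs))).2
      rw [sub_self, norm_zero, add_zero, ← dist_eq_norm (c₀ s)] at k2
      have k3 := mul_le_mul_of_nonneg_left (h1 s hs).le hC'0
      have k4 := (h2 s hs).le
      rw [dist_comm, dist_eq_norm] at k4
      refine (norm_add_le _ _).trans ((add_le_add (norm_add_le _ _) le_rfl).trans ?_)
      linarith
    have hint := intervalIntegral.integral_mono_on hab
      (((hw n).memLp.intervalIntegrable_of_two hab).sub
        (hw₀L.intervalIntegrable_of_two hab)).norm
      ((hEi.norm.add intervalIntegrable_const).const_mul M) hpt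
    rw [intervalIntegral.integral_const_mul, intervalIntegral.integral_add hEi.norm
      intervalIntegrable_const, intervalIntegral.integral_const, smul_eq_mul] at hint
    have h4 := intervalIntegral_norm_le_of_sq_le hab hE (hδ0 n) (hw n).defect_le
    have h5 : δ n * (1 + (b - a)) ≤ ρ / D * (1 + (b - a)) := by gcongr
    have h6 := mul_le_mul_of_nonneg_left (add_le_add (h4.trans h5) (le_refl
      ((b - a) * ((1 + C') * (ρ / D))))) hM.le
    have h7 : ρ / D * D = ρ := div_mul_cancel₀ _ hD0.ne'
    have h8 : ρ / D * D = M * (ρ / D * (1 + (b - a)) + (b - a) * ((1 + C') * (ρ / D)))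
        + ρ / D := by rw [hD]; ring
    exact (hint.trans h6).trans (by linarith)
  refine ⟨w₀, hw₀c, le_of_forall_pos_le_add fun ρ hρ => ?_⟩
  have hB0 : 0 ≤ B := (norm_nonneg _).trans (hB a (left_mem_Icc.2 hab))
  set D := M * ((1 + B ^ 2) * (b - a) + (1 + B) + 2) with hD
  have hD0 : 0 < D := by positivity
  obtain ⟨n, hn1, hn2⟩ := ((hwlim (ρ / (2 * D)) (by positivity)).and
    (hδlim.eventually (gt_mem_nhds (by positivity : 0 < ρ / 2)))).exists
  have h1 := h.action_le_of_close hab x (hw n).memLp hw₀L hB hn1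
  have h2 := (hw n).action_le
  have h3 : δ n ^ 2 ≤ δ n := by nlinarith [hδ0 n, hδ1 n]
  have h4 : M * ((1 + B ^ 2) * (b - a) + (1 + B) + 2) * (ρ / (2 * D)) = ρ / 2 := by
    rw [← hD]; field_simp
  linarith

end TonelliProblem

end Existence

/-! ### Density of smooth velocities with prescribed initial value -/

section SmoothApproximation

variable {V : Type*} [NormedAddCommGroup V] [InnerProductSpace ℝ V] {a b : ℝ}

lemma integral_exp_neg_sq_le {n : ℝ} (hn : 0 < n) :
    ∫ s in a..b, Real.exp (-n * (s - a)) ^ 2 ≤ 1 / n := by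
  have hd : ∀ s, HasDerivAt (fun s => -(1 / (2 * n)) * Real.exp (-(2 * n) * (s - a)))
      (Real.exp (-n * (s - a)) ^ 2) s := by
    intro s
    have h1 : HasDerivAt (fun s => -(2 * n) * (s - a)) (-(2 * n)) s := by
      simpa using ((hasDerivAt_id s).sub_const a).const_mul (-(2 * n))
    have h2 := h1.exp.const_mul (-(1 / (2 * n)))
    have h3 : Real.exp (-n * (s - a)) ^ 2 = Real.exp (-(2 * n) * (s - a)) := by
      rw [← Real.exp_nat_mul]; congr 1; push_cast; ring
    rw [h3]
    convert! h2 using 1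
    field_simp
  rw [intervalIntegral.integral_eq_sub_of_hasDerivAt (fun s _ => hd s)
    ((by fun_prop : Continuous fun s => Real.exp (-n * (s - a)) ^ 2).intervalIntegrable _ _)]
  rw [sub_self, mul_zero, Real.exp_zero]
  have h1 : 0 ≤ 1 / (2 * n) * Real.exp (-(2 * n) * (b - a)) := by positivity
  have h2 : 1 / n = 1 / (2 * n) + 1 / (2 * n) := by field_simp; ring
  have h3 : 0 < 1 / (2 * n) := by positivity
  linarith

/-- Functions of class `C¹` with prescribed initial value are dense in `L²`. -/
lemma exists_contDiff_integral_sub_sq_le (hab : a ≤ b) {f : ℝ → V}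
    (hf : MemLp f 2 (volume.restrict (Ioc a b))) (v : V) {τ : ℝ} (hτ : 0 < τ) :
    ∃ w : ℝ → V, ContDiff ℝ 1 w ∧ w a = v ∧ MemLp w 2 (volume.restrict (Ioc a b)) ∧
      ∫ s in a..b, ‖f s - w s‖ ^ 2 ≤ τ ^ 2 := by
  obtain ⟨g, hgc, hg, hfg⟩ := hf.exist_eLpNorm_sub_le ENNReal.ofNat_ne_top one_le_two
    (by positivity : 0 < τ / 2)
  have hgL : MemLp g 2 (volume.restrict (Ioc a b)) := hg.continuous.memLp_of_hasCompactSupport hgc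
  have hfg2 : ∫ s in a..b, ‖f s - g s‖ ^ 2 ≤ (τ / 2) ^ 2 := by
    rw [← norm_toLp_sub_sq hab hf hgL, ← MemLp.toLp_sub, Lp.norm_toLp]
    gcongr
    exact ENNReal.toReal_le_of_le_ofReal (by positivity) hfg
  set B := ‖v - g a‖ with hB
  -- Rate of the boundary layer correcting the initial value to v: its squared L² norm is at most
  -- B²/n ≤ τ²/4. Together with the τ/2 approximation this gives 2(τ/2)² + 2τ²/4 = τ².
  set n := 4 * (B ^ 2 + 1) / τ ^ 2 with hn
  have hn0 : 0 < n := by positivity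
  set k : ℝ → V := fun s => Real.exp (-n * (s - a)) • (v - g a) with hk
  have hkc : ContDiff ℝ 1 k := by fun_prop
  have hkL : MemLp k 2 (volume.restrict (Ioc a b)) := by
    obtain ⟨K, hK⟩ := isCompact_Icc.exists_bound_of_continuousOn hkc.continuous.continuousOn
      (s := Icc a b)
    exact MemLp.of_bound hkc.continuous.aestronglyMeasurable K
      ((ae_restrict_mem measurableSet_Ioc).mono fun s hs => hK s (Ioc_subset_Icc_self hs))
  refine ⟨fun s => g s + k s, (hg.of_le (by exact_mod_cast le_top)).add hkc, by simp [hk],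
    hgL.add hkL, ?_⟩
  have h1 : ∫ s in a..b, ‖f s - (g s + k s)‖ ^ 2 ≤
      ∫ s in a..b, (2 * ‖f s - g s‖ ^ 2 + 2 * (B ^ 2 * Real.exp (-n * (s - a)) ^ 2)) := by
    have hexp : IntervalIntegrable (fun s => Real.exp (-n * (s - a)) ^ 2) volume a b :=
      (by fun_prop : Continuous fun s => Real.exp (-n * (s - a)) ^ 2).intervalIntegrable _ _
    refine intervalIntegral.integral_mono_on hab
      ((hf.sub (hgL.add hkL)).intervalIntegrable_norm_sq hab)
      ((((hf.sub hgL).intervalIntegrable_norm_sq hab).const_mul 2).add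
        ((hexp.const_mul (B ^ 2)).const_mul 2)) fun s _ => ?_
    have h2 : ‖f s - (g s + k s)‖ ≤ ‖f s - g s‖ + ‖k s‖ := by
      rw [← sub_sub]; exact norm_sub_le _ _
    have h3 : ‖k s‖ ^ 2 = B ^ 2 * Real.exp (-n * (s - a)) ^ 2 := by
      rw [hk, norm_smul, Real.norm_of_nonneg (Real.exp_nonneg _)]; ring
    rw [← h3]
    have h4 : ‖f s - (g s + k s)‖ ^ 2 ≤ (‖f s - g s‖ + ‖k s‖) ^ 2 := by gcongr
    nlinarith [sq_nonneg (‖f s - g s‖ - ‖k s‖)]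
  have hexp : IntervalIntegrable (fun s => Real.exp (-n * (s - a)) ^ 2) volume a b :=
    (by fun_prop : Continuous fun s => Real.exp (-n * (s - a)) ^ 2).intervalIntegrable _ _
  have hfgi : IntervalIntegrable (fun s => ‖f s - g s‖ ^ 2) volume a b :=
    (hf.sub hgL).intervalIntegrable_norm_sq hab
  rw [intervalIntegral.integral_add (hfgi.const_mul 2) ((hexp.const_mul (B ^ 2)).const_mul 2),
    intervalIntegral.integral_const_mul, intervalIntegral.integral_const_mul,
    intervalIntegral.integral_const_mul] at h1
  have h2 := mul_le_mul_of_nonneg_left (integral_exp_neg_sq_le (a := a) (b := b) hn0) (sq_nonneg B)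
  have h3 : B ^ 2 * (1 / n) ≤ τ ^ 2 / 4 := by
    rw [hn, mul_one_div, div_div_eq_mul_div, div_le_div_iff₀ (by positivity) (by positivity)]
    nlinarith [sq_nonneg B, sq_nonneg τ]
  nlinarith

namespace TonelliProblem

variable {M : ℝ} {ℓ : ℝ → V → V → ℝ} {Dx Dv : ℝ → V → V → V →L[ℝ] ℝ}
  {G : V → ℝ} {DG : V → V →L[ℝ] ℝ}

/-- Neither smoothness of the velocity nor a prescribed initial velocity raises the infimum. This is
why v disappears in the limit problem. -/
lemma exists_contDiff_action_le (h : TonelliProblem M ℓ Dx Dv G DG) (hab : a ≤ b) (y : V)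
    {f : ℝ → V} (hf : MemLp f 2 (volume.restrict (Ioc a b))) (v : V) {ρ : ℝ} (hρ : 0 < ρ) :
    ∃ w : ℝ → V, ContDiff ℝ 1 w ∧ w a = v ∧ action ℓ G a b y w ≤ action ℓ G a b y f + ρ := by
  have hM := h.pos
  have hβ0 : 0 ≤ b - a := sub_nonneg.2 hab
  set N := ∫ s in a..b, ‖f s‖ ^ 2 with hN
  have hN0 : 0 ≤ N := intervalIntegral_norm_sq_nonneg hab f
  -- `2 * N + 2` bounds the energy of w, because τ ≤ 1.
  set D := 10 * M * (1 + (b - a)) ^ 2 * (1 + N + (2 * N + 2)) with hD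
  have hD0 : 0 < D := by positivity
  set τ := min 1 (ρ / D) with hτ
  have hτ0 : 0 < τ := lt_min one_pos (by positivity)
  obtain ⟨w, hw, hwa, hwL, hfw⟩ := exists_contDiff_integral_sub_sq_le hab hf v hτ0
  refine ⟨w, hw, hwa, ?_⟩
  have h1 := h.abs_action_sub_le hab y hf hwL hτ0 hfw
  have hfwi : IntervalIntegrable (fun s => ‖f s - w s‖ ^ 2) volume a b :=
    (hf.sub hwL).intervalIntegrable_norm_sq hab
  have h2 : ∫ s in a..b, ‖w s‖ ^ 2 ≤ ∫ s in a..b, (2 * ‖f s‖ ^ 2 + 2 * ‖f s - w s‖ ^ 2) := by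
    refine intervalIntegral.integral_mono_on hab (hwL.intervalIntegrable_norm_sq hab)
      (((hf.intervalIntegrable_norm_sq hab).const_mul 2).add (hfwi.const_mul 2)) fun s _ => ?_
    have h3 : ‖w s‖ ≤ ‖f s‖ + ‖f s - w s‖ := by
      have := norm_sub_le (f s) (f s - w s)
      rwa [sub_sub_cancel] at this
    have h4 : ‖w s‖ ^ 2 ≤ (‖f s‖ + ‖f s - w s‖) ^ 2 := by gcongr
    nlinarith [sq_nonneg (‖f s‖ - ‖f s - w s‖)]
  rw [intervalIntegral.integral_add ((hf.intervalIntegrable_norm_sq hab).const_mul 2)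
    (hfwi.const_mul 2), intervalIntegral.integral_const_mul,
    intervalIntegral.integral_const_mul] at h2
  have hτ1 : τ ≤ 1 := min_le_left _ _
  have h3 : ∫ s in a..b, ‖w s‖ ^ 2 ≤ 2 * N + 2 := by nlinarith
  have h4 : 10 * M * (1 + (b - a)) ^ 2 * (1 + N + ∫ s in a..b, ‖w s‖ ^ 2) * τ ≤ D * τ := by
    rw [hD]
    gcongr
  have h5 : D * τ ≤ ρ := by
    have := mul_le_mul_of_nonneg_left (min_le_right 1 (ρ / D)) hD0.le
    rwa [mul_div_cancel₀ _ hD0.ne'] at this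
  have h6 := neg_le_of_abs_le (h1.trans (h4.trans h5))
  linarith

end TonelliProblem

end SmoothApproximation

/-! ### First derivatives depending continuously on a parameter -/

section ParametricDerivative

variable {Q : Type*} [NormedAddCommGroup Q] [NormedSpace ℝ Q] [FiniteDimensional ℝ Q]
  {T : ℝ} {hT : 0 ≤ T} {Lam : ℝ → Q → ℝ}

/-- A family of functions of class `C²` depending continuously on a parameter in a compact interval
has locally uniformly Lipschitz derivatives. -/
lemma exists_fderiv_lipschitz (hproj : ∀ s, Lam (projIcc 0 T hT s) = Lam s)
    (hsm : ∀ s, ContDiff ℝ 2 (Lam s))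
    (hD2 : Continuous fun p : ℝ × Q => fderiv ℝ (fderiv ℝ (Lam p.1)) p.2) (R : ℝ) :
    ∃ C, 0 ≤ C ∧ ∀ s q q', ‖q‖ ≤ R → ‖q'‖ ≤ R →
      ‖fderiv ℝ (Lam s) q - fderiv ℝ (Lam s) q'‖ ≤ C * ‖q - q'‖ := by
  have : ProperSpace Q := FiniteDimensional.proper_real Q
  obtain ⟨C, hC⟩ := (isCompact_Icc.prod (isCompact_closedBall (0 : Q) R)).exists_bound_of_continuousOn
    (s := Icc 0 T ×ˢ Metric.closedBall (0 : Q) R)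
    (f := fun p : ℝ × Q => fderiv ℝ (fderiv ℝ (Lam p.1)) p.2) hD2.continuousOn
  refine ⟨|C|, abs_nonneg C, fun s q q' hq hq' => ?_⟩
  rw [← hproj s]
  have hdiff : Differentiable ℝ (fderiv ℝ (Lam (projIcc 0 T hT s))) :=
    ((hsm _).fderiv_right (m := 1) (by norm_num)).differentiable (by norm_num)
  refine (convex_closedBall (0 : Q) R).norm_image_sub_le_of_norm_fderiv_le (𝕜 := ℝ)
    (fun z _ => hdiff z) (fun z hz => ?_) (mem_closedBall_zero_iff.2 hq')
    (mem_closedBall_zero_iff.2 hq)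
  exact (hC (_, z) ⟨(projIcc 0 T hT s).2, hz⟩).trans (le_abs_self C)

/-- Only the function and its second derivative are assumed continuous in the parameter. With second
derivatives locally bounded, difference quotients converge to the first derivative uniformly in s,
which makes it continuous in s; the local Lipschitz bound in q then gives joint continuity. -/
lemma continuous_fderiv_of_param (hproj : ∀ s, Lam (projIcc 0 T hT s) = Lam s)
    (hsm : ∀ s, ContDiff ℝ 2 (Lam s)) (hc : Continuous fun p : ℝ × Q => Lam p.1 p.2)
    (hD2 : Continuous fun p : ℝ × Q => fderiv ℝ (fderiv ℝ (Lam p.1)) p.2) :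
    Continuous fun p : ℝ × Q => fderiv ℝ (Lam p.1) p.2 := by
  have hd : ∀ s, Differentiable ℝ (Lam s) := fun s => (hsm s).differentiable (by norm_num)
  have hpoint : ∀ q, Continuous fun s => fderiv ℝ (Lam s) q := by
    intro q
    rw [continuous_clm_apply]
    intro v
    obtain ⟨C, hC0, hC⟩ := exists_fderiv_lipschitz hproj hsm hD2 (‖q‖ + ‖v‖)
    refine continuous_of_uniform_approx_of_continuous fun u hu => ?_
    obtain ⟨ρ, hρ, hρu⟩ := Metric.mem_uniformity_dist.1 hu
    set τ := min 1 (ρ / (C * ‖v‖ ^ 2 + 1)) with hτ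
    have hpos : 0 < C * ‖v‖ ^ 2 + 1 := by positivity
    have hτ0 : 0 < τ := lt_min one_pos (by positivity)
    refine ⟨fun s => τ⁻¹ * (Lam s (q + τ • v) - Lam s q), ?_, fun s => hρu ?_⟩
    · exact continuous_const.mul ((hc.comp (by fun_prop : Continuous fun s : ℝ => (s, q + τ • v))).sub
        (hc.comp (by fun_prop : Continuous fun s : ℝ => (s, q))))
    · have hτv : ‖τ • v‖ = τ * ‖v‖ := by rw [norm_smul, Real.norm_of_nonneg hτ0.le]
      have hτv1 : τ * ‖v‖ ≤ ‖v‖ := mul_le_of_le_one_left (norm_nonneg _) (min_le_left _ _)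
      have h1 := (convex_closedBall q (τ * ‖v‖)).norm_image_sub_le_of_norm_fderiv_le' (𝕜 := ℝ)
        (f := Lam s) (φ := fderiv ℝ (Lam s) q) (C := C * (τ * ‖v‖)) (x := q) (y := q + τ • v)
        (fun z _ => hd s z) (fun z hz => ?_)
        (Metric.mem_closedBall_self (by positivity)) (by simp [hτv])
      · rw [add_sub_cancel_left, hτv, map_smul, smul_eq_mul] at h1
        have h2 : fderiv ℝ (Lam s) q v - τ⁻¹ * (Lam s (q + τ • v) - Lam s q)
            = -(τ⁻¹ * (Lam s (q + τ • v) - Lam s q - τ * fderiv ℝ (Lam s) q v)) := by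
          field_simp; ring
        rw [Real.dist_eq, h2, abs_neg, abs_mul, abs_of_pos (inv_pos.2 hτ0)]
        have h3 := mul_le_mul_of_nonneg_left h1 (inv_nonneg.2 hτ0.le)
        have h4 : τ⁻¹ * (C * (τ * ‖v‖) * (τ * ‖v‖)) = τ * (C * ‖v‖ ^ 2) := by
          field_simp
        rw [h4] at h3
        refine lt_of_le_of_lt h3 ?_
        have h5 : τ * (C * ‖v‖ ^ 2 + 1) ≤ ρ := by
          have := mul_le_mul_of_nonneg_right (min_le_right 1 (ρ / (C * ‖v‖ ^ 2 + 1))) hpos.le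
          rwa [div_mul_cancel₀ _ hpos.ne'] at this
        linarith
      · rw [mem_closedBall_iff_norm] at hz
        have hz' : ‖z‖ ≤ ‖q‖ + ‖v‖ := by
          have := norm_add_le (z - q) q
          rw [sub_add_cancel] at this
          linarith
        refine (hC s z q hz' (by linarith [norm_nonneg v])).trans ?_
        gcongr
  rw [continuous_iff_continuousAt]
  rintro ⟨s, q⟩
  obtain ⟨C, hC0, hC⟩ := exists_fderiv_lipschitz hproj hsm hD2 (‖q‖ + 1)
  rw [ContinuousAt, tendsto_iff_norm_sub_tendsto_zero]
  have hlim : Tendsto (fun p : ℝ × Q => C * ‖p.2 - q‖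
      + ‖fderiv ℝ (Lam p.1) q - fderiv ℝ (Lam s) q‖) (𝓝 (s, q)) (𝓝 0) := by
    have h1 : Continuous fun p : ℝ × Q => C * ‖p.2 - q‖
      + ‖fderiv ℝ (Lam p.1) q - fderiv ℝ (Lam s) q‖ := by
      have := (hpoint q).comp (continuous_fst (X := ℝ) (Y := Q))
      exact (by fun_prop : Continuous fun p : ℝ × Q => C * ‖p.2 - q‖).add
        (this.sub continuous_const).norm
    simpa using h1.tendsto (s, q)
  refine squeeze_zero' (Eventually.of_forall fun _ => norm_nonneg _) ?_ hlim
  have hball : ∀ᶠ p : ℝ × Q in 𝓝 (s, q), ‖p.2‖ < ‖q‖ + 1 :=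
    (continuous_snd.norm.tendsto (s, q)).eventually (gt_mem_nhds (lt_add_one ‖q‖))
  filter_upwards [hball] with p hp
  have h1 := hC p.1 p.2 q hp.le (by linarith)
  calc ‖fderiv ℝ (Lam p.1) p.2 - fderiv ℝ (Lam s) q‖
      = ‖(fderiv ℝ (Lam p.1) p.2 - fderiv ℝ (Lam p.1) q)
        + (fderiv ℝ (Lam p.1) q - fderiv ℝ (Lam s) q)‖ := by congr 1; abel
    _ ≤ _ := (norm_add_le _ _).trans (add_le_add h1 le_rfl)

end ParametricDerivative

/-! ### From flows of measures to Tonelli problems -/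

namespace SingularMFG

section Wasserstein

variable {X : Type} [PseudoMetricSpace X] [MeasurableSpace X] [OpensMeasurableSpace X]
  [SecondCountableTopology X]

/-- The product plan has finite cost by the triangle inequality. Finiteness matters because `W1` is
a `toReal`, for which an infinite infimum would read 0. -/
lemma exists_finite_plan (m m' : P1 X) :
    ∃ lam : Measure (X × X), (lam.map Prod.fst = m.1 ∧ lam.map Prod.snd = m'.1) ∧
      ∫⁻ p, edist p.1 p.2 ∂lam < ⊤ := by
  obtain ⟨m, hm, x, hx⟩ := m
  obtain ⟨m', hm', x', hx'⟩ := m'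
  refine ⟨m.prod m', ⟨by simp [Measure.map_fst_prod], by simp [Measure.map_snd_prod]⟩, ?_⟩
  have hle : ∀ p : X × X, edist p.1 p.2 ≤ edist x p.1 + (edist x x' + edist x' p.2) := by
    intro p
    calc edist p.1 p.2 ≤ edist p.1 x + edist x p.2 := edist_triangle _ _ _
      _ ≤ edist p.1 x + (edist x x' + edist x' p.2) := by gcongr; exact edist_triangle _ _ _
      _ = _ := by rw [edist_comm p.1 x]
  refine lt_of_le_of_lt (lintegral_mono hle) ?_
  have h1 : ∫⁻ p : X × X, edist x p.1 ∂(m.prod m') = ∫⁻ z, edist x z ∂m := by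
    conv_rhs => rw [← show (m.prod m').map Prod.fst = m by simp [Measure.map_fst_prod]]
    rw [lintegral_map (by fun_prop) measurable_fst]
  have h2 : ∫⁻ p : X × X, edist x' p.2 ∂(m.prod m') = ∫⁻ z, edist x' z ∂m' := by
    conv_rhs => rw [← show (m.prod m').map Prod.snd = m' by simp [Measure.map_snd_prod]]
    rw [lintegral_map (by fun_prop) measurable_snd]
  rw [lintegral_add_left (by fun_prop), lintegral_add_left (by fun_prop), h1, h2,
    lintegral_const, measure_univ, mul_one]
  exact ENNReal.add_lt_top.2 ⟨hx, ENNReal.add_lt_top.2 ⟨edist_lt_top _ _, hx'⟩⟩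

end Wasserstein

variable {d : ℕ}

/-- Push a plan forward by the projection, which is 1-Lipschitz for the max distance on the product.
-/
lemma W1_fst_le (m m' : P1 (E d × E d)) : W1 m.fst m'.fst ≤ W1 m m' := by
  unfold W1
  obtain ⟨lam₀, hlam₀, hfin⟩ := exists_finite_plan m m'
  refine ENNReal.toReal_mono ((iInf₂_le lam₀ hlam₀).trans_lt hfin).ne
    (le_iInf₂ fun lam hlam => ?_)
  have hmeas : Measurable fun p : (E d × E d) × (E d × E d) => (p.1.1, p.2.1) := by fun_prop
  refine iInf₂_le_of_le (lam.map fun p => (p.1.1, p.2.1)) ⟨?_, ?_⟩ ?_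
  · rw [Measure.map_map measurable_fst hmeas]
    change _ = m.1.map Prod.fst
    rw [← hlam.1, Measure.map_map measurable_fst measurable_fst]
    rfl
  · rw [Measure.map_map measurable_snd hmeas]
    change _ = m'.1.map Prod.fst
    rw [← hlam.2, Measure.map_map measurable_fst measurable_snd]
    rfl
  · rw [lintegral_map (by fun_prop) hmeas]
    refine lintegral_mono fun p => ?_
    simp only [Prod.edist_eq]
    exact le_max_left _ _

lemma ContinuousFlow.fst {T : ℝ} {μ : ℝ → P1 (E d × E d)} (h : ContinuousFlow T μ) :
    ContinuousFlow T fun s => (μ s).fst := fun s hs η hη => by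
  obtain ⟨δ, hδ, hδ'⟩ := h s hs η hη
  exact ⟨δ, hδ, fun r hr hrs => (W1_fst_le _ _).trans_lt (hδ' r hr hrs)⟩

/-- `P1` carries no topology here, only the numbers `W1`, so the composition is done by hand.
Clamping the time to [0,T] gives continuity on all of ℝ. -/
lemma JointlyContinuous.continuous_flow {W : Type} [PseudoMetricSpace W]
    {F : E d → E d → P1 (E d) → W} (hF : JointlyContinuous F) {T : ℝ} (hT : 0 ≤ T)
    {m : ℝ → P1 (E d)} (hm : ContinuousFlow T m) :
    Continuous fun q : ℝ × E d × E d => F q.2.1 q.2.2 (m (projIcc 0 T hT q.1)) := by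
  rw [Metric.continuous_iff]
  rintro ⟨s, x, v⟩ η hη
  obtain ⟨δ, hδ, hδF⟩ := hF x v (m (projIcc 0 T hT s)) η hη
  obtain ⟨δ', hδ', hδm⟩ := hm _ (projIcc 0 T hT s).2 δ hδ
  refine ⟨min δ δ', lt_min hδ hδ', fun q hq => ?_⟩
  obtain ⟨r, y, w⟩ := q
  rw [Prod.dist_eq, Prod.dist_eq, max_lt_iff, max_lt_iff] at hq
  refine hδF y w _ (hq.2.1.trans_le (min_le_left _ _)) (hq.2.2.trans_le (min_le_left _ _))
    (hδm _ (projIcc 0 T hT r).2 ?_)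
  refine (abs_projIcc_sub_projIcc hT).trans_lt ?_
  rw [← Real.dist_eq]
  exact hq.1.trans_le (min_le_right _ _)

/-- The Lagrangian along a flow of measures, frozen outside of `[0,T]`. -/
noncomputable def flowLagrangian {T : ℝ} (hT : 0 ≤ T) (L : E d → E d → P1 (E d) → ℝ)
    (m : ℝ → P1 (E d)) (s : ℝ) (x v : E d) : ℝ := L x v (m (projIcc 0 T hT s))

lemma flowLagrangian_of_mem {T : ℝ} (hT : 0 ≤ T) (L : E d → E d → P1 (E d) → ℝ)
    (m : ℝ → P1 (E d)) {s : ℝ} (hs : s ∈ Icc 0 T) (x v : E d) :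
    flowLagrangian hT L m s x v = L x v (m s) := by
  rw [flowLagrangian, projIcc_of_mem hT hs]

theorem tonelliProblem_of_flow {T M₀ : ℝ} (hT : 0 ≤ T) {L : E d → E d → P1 (E d) → ℝ}
    {g : E d → P1 (E d) → ℝ} (hL : LagrangianRegular L) (hLg : LagrangianConvexGrowth M₀ L)
    (hg : TerminalCost M₀ g) {m : ℝ → P1 (E d)} (hm : ContinuousFlow T m) :
    TonelliProblem M₀ (flowLagrangian hT L m)
      (fun s x v => fderiv ℝ (fun y => flowLagrangian hT L m s y v) x)
      (fun s x v => fderiv ℝ (fun w => flowLagrangian hT L m s x w) v)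
      (fun x => g x (m T)) (fun x => fderiv ℝ (fun y => g y (m T)) x) := by
  set Lam : ℝ → E d × E d → ℝ := fun s q => flowLagrangian hT L m s q.1 q.2 with hLam
  have hproj : ∀ s, Lam (projIcc 0 T hT s) = Lam s := fun s => by
    ext q
    simp only [hLam, flowLagrangian, projIcc_val]
  have hsm : ∀ s, ContDiff ℝ 2 (Lam s) := fun s => hL.smooth _
  have hc : Continuous fun p : ℝ × E d × E d => Lam p.1 p.2 := hL.cont.continuous_flow hT hm
  have hD2 : Continuous fun p : ℝ × E d × E d => fderiv ℝ (fderiv ℝ (Lam p.1)) p.2 :=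
    hL.cont_second.continuous_flow hT hm
  have hd : ∀ s q, HasFDerivAt (Lam s) (fderiv ℝ (Lam s) q) q := fun s q =>
    ((hsm s).differentiable (by norm_num) q).hasFDerivAt
  have hleft : ∀ s x v, fderiv ℝ (fun y => flowLagrangian hT L m s y v) x
      = (fderiv ℝ (Lam s) (x, v)).comp (ContinuousLinearMap.inl ℝ (E d) (E d)) := fun s x v =>
    (HasFDerivAt.comp (f := fun y : E d => (y, v)) x (hd s (x, v))
      (hasFDerivAt_prodMk_left x v)).fderiv
  have hright : ∀ s x v, fderiv ℝ (fun w => flowLagrangian hT L m s x w) v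
      = (fderiv ℝ (Lam s) (x, v)).comp (ContinuousLinearMap.inr ℝ (E d) (E d)) := fun s x v =>
    (HasFDerivAt.comp (f := fun w : E d => (x, w)) v (hd s (x, v))
      (hasFDerivAt_prodMk_right x v)).fderiv
  have hDc := continuous_fderiv_of_param hproj hsm hc hD2
  refine ⟨hLg.pos, hc, ?_, ?_, ?_, ?_, ?_, fun s x v => hLg.grad_x x v _,
    fun s x v => hLg.grad_v x v _, ?_, ?_, ?_, hg.grad_uc _⟩
  · simp only [hleft]
    exact hDc.clm_comp continuous_const
  · simp only [hright]
    exact hDc.clm_comp continuous_const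
  · intro s x v
    have h1 := hd s (x, v)
    rw [hleft, hright]
    convert! h1 using 1
    ext z <;> simp
  · intro s x v w
    have hv2 : ContDiff ℝ 2 fun w => flowLagrangian hT L m s x w :=
      (hsm s).comp (contDiff_const.prodMk contDiff_id)
    have hdiff : Differentiable ℝ (fderiv ℝ fun w => flowLagrangian hT L m s x w) :=
      (hv2.fderiv_right (m := 1) (by norm_num)).differentiable (by norm_num)
    set D := fderiv ℝ fun w => flowLagrangian hT L m s x w with hD
    have hderiv : ∀ τ : ℝ, HasDerivAt (fun τ : ℝ => D (v + τ • (w - v)) (w - v))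
        (fderiv ℝ D (v + τ • (w - v)) (w - v) (w - v)) τ := by
      intro τ
      have h1 : HasDerivAt (fun τ : ℝ => v + τ • (w - v)) (w - v) τ := by
        simpa using ((hasDerivAt_id τ).smul_const (w - v)).const_add v
      have h2 := (hdiff (v + τ • (w - v))).hasFDerivAt.comp_hasDerivAt τ h1
      exact ((ContinuousLinearMap.apply ℝ ℝ (w - v)).hasFDerivAt.comp_hasDerivAt τ h2)
    -- Strong monotonicity is the lower Hessian bound integrated along the segment from v to w.
    have h3 := mul_sub_le_image_sub_of_le_deriv (fun τ => (hderiv τ).differentiableAt)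
      (C := 1 / M₀ * ‖w - v‖ ^ 2) (fun τ => by
        rw [(hderiv τ).deriv]
        exact hLg.convex x _ _ _) zero_le_one
    simpa using h3
  · intro R
    obtain ⟨C, hC0, hC⟩ := exists_fderiv_lipschitz hproj hsm hD2 R
    refine ⟨C, hC0, fun s x y v w hx hy hv hw => ?_⟩
    have h1 := hC s (x, v) (y, w) (by simp [hx, hv]) (by simp [hy, hw])
    have h2 : ‖((x, v) - (y, w) : E d × E d)‖ ≤ ‖x - y‖ + ‖v - w‖ := by
      rw [Prod.mk_sub_mk, Prod.norm_mk]
      exact max_le_add_of_nonneg (norm_nonneg _) (norm_nonneg _)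
    have h3 := h1.trans (mul_le_mul_of_nonneg_left h2 hC0)
    rw [hleft, hleft, hright, hright, ← ContinuousLinearMap.sub_comp,
      ← ContinuousLinearMap.sub_comp]
    constructor
    · refine (ContinuousLinearMap.opNorm_comp_le _ _).trans (le_trans ?_ h3)
      exact mul_le_of_le_one_right (norm_nonneg _) (ContinuousLinearMap.norm_inl_le_one ℝ _ _)
    · refine (ContinuousLinearMap.opNorm_comp_le _ _).trans (le_trans ?_ h3)
      exact mul_le_of_le_one_right (norm_nonneg _) (ContinuousLinearMap.norm_inr_le_one ℝ _ _)
  · have h1 : Continuous fun s : ℝ => Lam s (0, 0) :=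
      hc.comp (by fun_prop : Continuous fun s : ℝ => (s, (0 : E d × E d)))
    obtain ⟨A, hA⟩ := isCompact_Icc.exists_bound_of_continuousOn h1.continuousOn (s := Icc 0 T)
    refine ⟨|A|, abs_nonneg A, fun s => ?_⟩
    have h2 := hA _ (projIcc 0 T hT s).2
    rw [hproj] at h2
    exact h2.trans (le_abs_self A)
  · exact fun x => ((hg.smooth _).differentiable (by norm_num) x).hasFDerivAt
  · intro x
    linarith [hg.grad_le (m T) x]

end SingularMFG

namespace SingularMFG

variable {d : ℕ} {T t : ℝ} {x : E d}

/-! ### Correspondence between C¹ curves and their velocities -/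

section Curves

lemma memLp_of_continuousOn {f : ℝ → E d} (hf : ContinuousOn f (Icc t T)) :
    MemLp f 2 (volume.restrict (Ioc t T)) := by
  obtain ⟨B, hB⟩ := isCompact_Icc.exists_bound_of_continuousOn hf
  exact MemLp.of_bound ((hf.aestronglyMeasurable_of_isCompact isCompact_Icc
    measurableSet_Icc).mono_measure (Measure.restrict_mono Ioc_subset_Icc_self le_rfl)) B
    ((ae_restrict_mem measurableSet_Ioc).mono fun s hs => hB s (Ioc_subset_Icc_self hs))

lemma continuousOn_vel (hT : 0 < T) {γ : ℝ → E d} (hγ : γ ∈ curves T t x) :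
    ContinuousOn (vel T γ) (Icc 0 T) :=
  hγ.1.continuousOn_derivWithin (uniqueDiffOn_Icc hT) le_rfl

lemma memLp_vel (hT : 0 < T) (ht : t ∈ Icc 0 T) {γ : ℝ → E d} (hγ : γ ∈ curves T t x) :
    MemLp (vel T γ) 2 (volume.restrict (Ioc t T)) :=
  memLp_of_continuousOn ((continuousOn_vel hT hγ).mono (Icc_subset_Icc_left ht.1))

lemma curveOf_vel (hT : 0 < T) (ht : t ∈ Icc 0 T) {γ : ℝ → E d} (hγ : γ ∈ curves T t x) {s : ℝ}
    (hs : s ∈ Icc t T) : curveOf t x (vel T γ) s = γ s := by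
  have hsub : Icc t s ⊆ Icc 0 T := Icc_subset_Icc ht.1 hs.2
  have h1 : ∫ r in t..s, vel T γ r = γ s - γ t := by
    refine intervalIntegral.integral_eq_sub_of_hasDerivAt_of_le hs.1
      (hγ.1.continuousOn.mono hsub) (fun r hr => ?_) ?_
    · have hr0 : r ∈ Icc 0 T := hsub (Ioo_subset_Icc_self hr)
      exact ((hγ.1.differentiableOn one_ne_zero) r hr0).hasDerivWithinAt.hasDerivAt
        (Icc_mem_nhds (ht.1.trans_lt hr.1) (hr.2.trans_le hs.2))
    · refine ContinuousOn.intervalIntegrable ?_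
      rw [uIcc_of_le hs.1]
      exact (continuousOn_vel hT hγ).mono hsub
  rw [curveOf, h1, hγ.2]
  abel

lemma hasDerivAt_curveOf {w : ℝ → E d} (hw : Continuous w) (t : ℝ) (y : E d) (s : ℝ) :
    HasDerivAt (curveOf t y w) (w s) s :=
  (hw.integral_hasStrictDerivAt t s).hasDerivAt.const_add y

lemma contDiff_curveOf {w : ℝ → E d} (hw : Continuous w) (t : ℝ) (y : E d) :
    ContDiff ℝ 1 (curveOf t y w) := by
  rw [contDiff_one_iff_deriv]
  refine ⟨fun s => (hasDerivAt_curveOf hw t y s).differentiableAt, ?_⟩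
  rwa [show deriv (curveOf t y w) = w from funext fun s => (hasDerivAt_curveOf hw t y s).deriv]

lemma curveOf_mem_curves {w : ℝ → E d} (hw : Continuous w) (T t : ℝ) (y : E d) :
    curveOf t y w ∈ curves T t y :=
  ⟨(contDiff_curveOf hw t y).contDiffOn, curveOf_self t y w⟩

lemma vel_curveOf (hT : 0 < T) {w : ℝ → E d} (hw : Continuous w) (t : ℝ) (y : E d) {s : ℝ}
    (hs : s ∈ Icc 0 T) : vel T (curveOf t y w) s = w s :=
  (hasDerivAt_curveOf hw t y s).hasDerivWithinAt.derivWithin (uniqueDiffOn_Icc hT s hs)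

lemma curveOf_mem_admissible (hT : 0 < T) {w : ℝ → E d} (hw : ContDiff ℝ 1 w)
    (ht : t ∈ Icc 0 T) (y : E d) : curveOf t y w ∈ admissible T t y (w t) := by
  have hacc : ∀ s ∈ Icc 0 T, acc T (curveOf t y w) s = deriv w s := fun s hs => by
    rw [acc, derivWithin_congr (fun r hr => vel_curveOf hT hw.continuous t y hr)
      (vel_curveOf hT hw.continuous t y hs)]
    exact ((hw.differentiable one_ne_zero) s).hasDerivAt.hasDerivWithinAt.derivWithin
      (uniqueDiffOn_Icc hT s hs)
  have hdw : Continuous (deriv w) := hw.continuous_deriv le_rfl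
  refine ⟨⟨curveOf_mem_curves hw.continuous T t y, vel_curveOf hT hw.continuous t y ht⟩, ?_, ?_⟩
  · obtain ⟨B, hB⟩ := isCompact_Icc.exists_bound_of_continuousOn hdw.continuousOn (s := Icc 0 T)
    have h1 : MemLp (deriv w) 2 (volume.restrict (Icc 0 T)) :=
      MemLp.of_bound hdw.aestronglyMeasurable B
        ((ae_restrict_mem measurableSet_Icc).mono fun s hs => hB s hs)
    exact h1.ae_eq ((ae_restrict_mem measurableSet_Icc).mono fun s hs => (hacc s hs).symm)
  · intro s hs
    rw [vel_curveOf hT hw.continuous t y hs, vel_curveOf hT hw.continuous t y ⟨le_rfl, hT.le⟩]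
    have h1 : ∫ r in (0 : ℝ)..s, acc T (curveOf t y w) r = ∫ r in (0 : ℝ)..s, deriv w r := by
      refine intervalIntegral.integral_congr fun r hr => hacc r ?_
      rw [uIcc_of_le hs.1] at hr
      exact ⟨hr.1, hr.2.trans hs.2⟩
    rw [h1, intervalIntegral.integral_deriv_eq_sub (fun r _ => hw.differentiable one_ne_zero r)
      (hdw.intervalIntegrable _ _)]
    abel

end Curves

/-! ### The limit value function as an infimum over L² velocities -/

section LimitProblem

variable {M₀ : ℝ} {L : E d → E d → P1 (E d) → ℝ} {g : E d → P1 (E d) → ℝ} {m : ℝ → P1 (E d)}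

lemma costLim_eq_action (hT : 0 < T) (ht : t ∈ Icc 0 T) {γ : ℝ → E d} (hγ : γ ∈ curves T t x) :
    costLim T L g m t γ =
      action (flowLagrangian hT.le L m) (fun z => g z (m T)) t T x (vel T γ) := by
  unfold costLim action
  rw [curveOf_vel hT ht hγ (right_mem_Icc.2 ht.2)]
  congr 1
  refine intervalIntegral.integral_congr fun s hs => ?_
  rw [uIcc_of_le ht.2] at hs
  simp only [curveOf_vel hT ht hγ hs,
    flowLagrangian_of_mem hT.le L m (Icc_subset_Icc_left ht.1 hs)]

lemma action_vel_curveOf (hT : 0 < T) (ht : t ∈ Icc 0 T) {w : ℝ → E d} (hw : Continuous w)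
    (ℓ : ℝ → E d → E d → ℝ) (G : E d → ℝ) :
    action ℓ G t T x (vel T (curveOf t x w)) = action ℓ G t T x w :=
  action_congr_ae ht.2 _ _ ((ae_restrict_mem measurableSet_Ioc).mono fun _ hs =>
    vel_curveOf hT hw t x ⟨ht.1.trans hs.1.le, hs.2⟩) x

lemma costLim_curveOf (hT : 0 < T) (ht : t ∈ Icc 0 T) {w : ℝ → E d} (hw : Continuous w) :
    costLim T L g m t (curveOf t x w) =
      action (flowLagrangian hT.le L m) (fun z => g z (m T)) t T x w := by
  rw [costLim_eq_action hT ht (curveOf_mem_curves hw T t x), action_vel_curveOf hT ht hw]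

variable {Dx Dv : ℝ → E d → E d → E d →L[ℝ] ℝ} {DG : E d → E d →L[ℝ] ℝ}

/-- Needed because `sInf` of a set unbounded below is 0, not -∞. -/
lemma bddBelow_costLim (hT : 0 < T) (ht : t ∈ Icc 0 T)
    (h : TonelliProblem M₀ (flowLagrangian hT.le L m) Dx Dv (fun z => g z (m T)) DG) (y : E d) :
    BddBelow (costLim T L g m t '' curves T t y) := by
  obtain ⟨K, hK⟩ := h.exists_action_coercive ht.2 y
  refine ⟨-K, ?_⟩
  rintro _ ⟨γ, hγ, rfl⟩
  have hM := h.pos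
  have h1 := hK _ (memLp_vel hT ht hγ)
  have h2 : 0 ≤ 1 / (4 * M₀) * ∫ s in t..T, ‖vel T γ s‖ ^ 2 :=
    mul_nonneg (by positivity) (intervalIntegral_norm_sq_nonneg ht.2 _)
  rw [costLim_eq_action hT ht hγ]
  linarith

/-- Enlarging the class of C¹ curves to curves with L² velocity does not lower the infimum, by
density of smooth velocities. -/
lemma valueLim_le_action (hT : 0 < T) (ht : t ∈ Icc 0 T)
    (h : TonelliProblem M₀ (flowLagrangian hT.le L m) Dx Dv (fun z => g z (m T)) DG) (y : E d)
    {f : ℝ → E d} (hf : MemLp f 2 (volume.restrict (Ioc t T))) :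
    valueLim T L g m t y ≤ action (flowLagrangian hT.le L m) (fun z => g z (m T)) t T y f := by
  refine le_of_forall_pos_le_add fun ρ hρ => ?_
  obtain ⟨w, hw, -, hle⟩ := h.exists_contDiff_action_le ht.2 y hf 0 hρ
  refine (csInf_le (bddBelow_costLim hT ht h y)
    (mem_image_of_mem _ (curveOf_mem_curves hw.continuous T t y))).trans ?_
  rwa [costLim_curveOf hT ht hw.continuous]

lemma exists_action_le_valueLim (hT : 0 < T) (ht : t ∈ Icc 0 T) {δ : ℝ} (hδ : 0 < δ) :
    ∃ f, MemLp f 2 (volume.restrict (Ioc t T)) ∧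
      action (flowLagrangian hT.le L m) (fun z => g z (m T)) t T x f
        ≤ valueLim T L g m t x + δ := by
  have hne : (curves T t x).Nonempty := ⟨fun _ => x, contDiffOn_const, rfl⟩
  obtain ⟨_, ⟨γ, hγ, rfl⟩, hlt⟩ := exists_lt_of_csInf_lt (hne.image (costLim T L g m t))
    (lt_add_of_pos_right (valueLim T L g m t x) hδ)
  refine ⟨vel T γ, memLp_vel hT ht hγ, ?_⟩
  rw [← costLim_eq_action hT ht hγ]
  exact hlt.le

end LimitProblem

/-! ### Perturbed minimizers as a minimizing sequence -/

section SingularLimit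

variable {M₀ : ℝ} {L : E d → E d → P1 (E d) → ℝ} {g : E d → P1 (E d) → ℝ}
  {m : ℕ → ℝ → P1 (E d)} {m₀ : ℝ → P1 (E d)}

lemma eventually_lagrangian_close (hL : LagrangianMeasureModulus L)
    (hconv : ∀ η > 0, ∀ᶠ k in atTop, ∀ s ∈ Icc 0 T, W1 (m k s) (m₀ s) < η) (R : ℝ) {η : ℝ}
    (hη : 0 < η) :
    ∀ᶠ k in atTop, ∀ s ∈ Icc 0 T, ∀ y v, ‖y‖ ≤ R → |L y v (m k s) - L y v (m₀ s)| ≤ η := by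
  obtain ⟨θ, ω₀, hθ, hω₀, hmono, hlim, hle⟩ := hL
  rcases lt_or_ge R 0 with hR | hR
  · exact Eventually.of_forall fun k s _ y v hy => absurd (norm_nonneg y) (by linarith)
  -- The 1 guards against θ(R) = 0. The modulus ω₀ need not be monotone: only its limit at 0 is
  -- used.
  have hpos : 0 < η / (θ R + 1) := div_pos hη (by linarith [hθ R hR])
  obtain ⟨δ, hδ, hδω₀⟩ := Metric.mem_nhdsWithin_iff.1 (hlim.eventually (gt_mem_nhds hpos))
  filter_upwards [hconv δ hδ] with k hk s hs y v hy
  have hW : 0 ≤ W1 (m k s) (m₀ s) := ENNReal.toReal_nonneg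
  have h1 : ω₀ (W1 (m k s) (m₀ s)) < η / (θ R + 1) := hδω₀ ⟨by
    rw [Metric.mem_ball, Real.dist_eq, sub_zero, abs_of_nonneg hW]
    exact hk s hs, hW⟩
  calc |L y v (m k s) - L y v (m₀ s)| ≤ θ ‖y‖ * ω₀ (W1 (m k s) (m₀ s)) := hle y v _ _
    _ ≤ (θ R + 1) * (η / (θ R + 1)) := by
        refine mul_le_mul ?_ h1.le (hω₀ _ hW) (by linarith [hθ R hR])
        linarith [hmono (norm_nonneg y) hR hy]
    _ = η := mul_div_cancel₀ _ (by linarith [hθ R hR])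

lemma TerminalCost.abs_sub_le (hg : TerminalCost M₀ g) (n : P1 (E d)) (y z : E d) :
    |g y n - g z n| ≤ 2 * M₀ * ‖y - z‖ :=
  convex_univ.norm_image_sub_le_of_norm_fderiv_le (𝕜 := ℝ) (f := fun y => g y n)
    (fun q _ => (hg.smooth n).differentiable (by norm_num) q)
    (fun q _ => by linarith [hg.grad_le n q]) (mem_univ z) (mem_univ y)

/-- Continuity in the measure is assumed point by point in x. The Lipschitz constant 2M₀ in x,
common to all measures, upgrades it to uniformity on balls through a finite net. -/
lemma eventually_terminal_close (hT : 0 < T) (hg : TerminalCost M₀ g)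
    (hconv : ∀ η > 0, ∀ᶠ k in atTop, ∀ s ∈ Icc 0 T, W1 (m k s) (m₀ s) < η) (R : ℝ) {η : ℝ}
    (hη : 0 < η) :
    ∀ᶠ k in atTop, ∀ y, ‖y‖ ≤ R → |g y (m k T) - g y (m₀ T)| ≤ η := by
  have hM : 0 < M₀ := by linarith [hg.half_le]
  obtain ⟨S, -, hS, hcov⟩ := (isCompact_closedBall (0 : E d) R).finite_cover_balls
    (by positivity : 0 < η / (8 * M₀))
  have hnet : ∀ᶠ k in atTop, ∀ z ∈ S, |g z (m k T) - g z (m₀ T)| < η / 2 := by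
    rw [eventually_all_finite hS]
    intro z _
    obtain ⟨δ, hδ, hδg⟩ := hg.unif_cont z (η / 2) (by positivity)
    exact (hconv δ hδ).mono fun k hk => hδg _ _ (hk T ⟨hT.le, le_rfl⟩)
  filter_upwards [hnet] with k hk y hy
  obtain ⟨z, hz, hyz⟩ := mem_iUnion₂.1 (hcov (mem_closedBall_zero_iff.2 hy))
  rw [mem_ball_iff_norm] at hyz
  have h1 := hg.abs_sub_le (m k T) y z
  have h2 := hg.abs_sub_le (m₀ T) y z
  have h3 : 2 * M₀ * ‖y - z‖ ≤ η / 4 := by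
    refine (mul_le_mul_of_nonneg_left hyz.le (by positivity)).trans (le_of_eq ?_)
    field_simp
    norm_num
  have h4 := abs_lt.1 (hk z hz)
  have h5 := abs_le.1 (h1.trans h3)
  have h6 := abs_le.1 (h2.trans h3)
  rw [abs_le]
  constructor <;> linarith [h4.1, h4.2, h5.1, h5.2, h6.1, h6.2]

lemma intervalIntegrable_acc_sq {γ : ℝ → E d} (ht : t ∈ Icc 0 T) (hγ : IsH2 T γ) :
    IntervalIntegrable (fun s => ‖acc T γ s‖ ^ 2) volume t T :=
  (hγ.1.mono_measure (Measure.restrict_mono (Ioc_subset_Icc_self.trans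
    (Icc_subset_Icc_left ht.1)) le_rfl)).intervalIntegrable_norm_sq ht.2

lemma costEps_eq_action {Dx Dv : ℝ → E d → E d → E d →L[ℝ] ℝ} {DG : E d → E d →L[ℝ] ℝ}
    {n : ℝ → P1 (E d)} (hT : 0 < T) (ht : t ∈ Icc 0 T)
    (h : TonelliProblem M₀ (flowLagrangian hT.le L n) Dx Dv (fun z => g z (n T)) DG) (ε : ℝ)
    {v : E d} {γ : ℝ → E d} (hγ : γ ∈ admissible T t x v) :
    costEps T ε L g n t γ = ε / 2 * (∫ s in t..T, ‖acc T γ s‖ ^ 2) +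
      action (flowLagrangian hT.le L n) (fun z => g z (n T)) t T x (vel T γ) := by
  have hc := hγ.1.1
  unfold costEps action
  rw [curveOf_vel hT ht hc (right_mem_Icc.2 ht.2), ← add_assoc,
    ← intervalIntegral.integral_const_mul, ← intervalIntegral.integral_add
    ((intervalIntegrable_acc_sq ht hγ.2).const_mul _)
    (h.intervalIntegrable_curve ht.2 x (memLp_vel hT ht hc))]
  congr 1
  refine intervalIntegral.integral_congr fun s hs => ?_
  rw [uIcc_of_le ht.2] at hs
  simp only [curveOf_vel hT ht hc hs,
    flowLagrangian_of_mem hT.le L n (Icc_subset_Icc_left ht.1 hs)]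

lemma abs_action_flow_sub_le {Dx Dv Dx' Dv' : ℝ → E d → E d → E d →L[ℝ] ℝ}
    {DG DG' : E d → E d →L[ℝ] ℝ} {n n' : ℝ → P1 (E d)} (hT : 0 < T) (ht : t ∈ Icc 0 T)
    (h : TonelliProblem M₀ (flowLagrangian hT.le L n) Dx Dv (fun z => g z (n T)) DG)
    (h' : TonelliProblem M₀ (flowLagrangian hT.le L n') Dx' Dv' (fun z => g z (n' T)) DG')
    {R η : ℝ} (hL : ∀ s ∈ Icc 0 T, ∀ y v, ‖y‖ ≤ R → |L y v (n s) - L y v (n' s)| ≤ η)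
    (hg : ∀ y, ‖y‖ ≤ R → |g y (n T) - g y (n' T)| ≤ η) {f : ℝ → E d}
    (hf : MemLp f 2 (volume.restrict (Ioc t T))) (hR : ∀ s ∈ Icc t T, ‖curveOf t x f s‖ ≤ R) :
    |action (flowLagrangian hT.le L n) (fun z => g z (n T)) t T x f
      - action (flowLagrangian hT.le L n') (fun z => g z (n' T)) t T x f| ≤ η * (T - t + 1) := by
  have h1 : ‖∫ s in t..T, (flowLagrangian hT.le L n s (curveOf t x f s) (f s)
      - flowLagrangian hT.le L n' s (curveOf t x f s) (f s))‖ ≤ η * |T - t| := by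
    refine intervalIntegral.norm_integral_le_of_norm_le_const fun s hs => ?_
    rw [uIoc_of_le ht.2] at hs
    have hs0 : s ∈ Icc 0 T := ⟨ht.1.trans hs.1.le, hs.2⟩
    rw [flowLagrangian_of_mem hT.le L n hs0, flowLagrangian_of_mem hT.le L n' hs0]
    exact hL s hs0 _ _ (hR s (Ioc_subset_Icc_self hs))
  rw [intervalIntegral.integral_sub (h.intervalIntegrable_curve ht.2 x hf)
    (h'.intervalIntegrable_curve ht.2 x hf), abs_of_nonneg (sub_nonneg.2 ht.2)] at h1
  have h2 := hg _ (hR T (right_mem_Icc.2 ht.2))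
  unfold action
  rw [add_sub_add_comm]
  refine (abs_add_le _ _).trans ((add_le_add h1 h2).trans (le_of_eq ?_))
  ring

/-- Minimizers of the singularly perturbed functionals form a minimizing sequence of the limit
problem. -/
theorem eventually_action_vel_le (hT : 0 < T) (ht : t ∈ Icc 0 T) (hM1 : LagrangianRegular L)
    (hM2 : LagrangianConvexGrowth M₀ L) (hM3 : LagrangianMeasureModulus L)
    (hg : TerminalCost M₀ g) (hm : ∀ k, ContinuousFlow T (m k)) (hm₀ : ContinuousFlow T m₀)
    (hconv : ∀ η > 0, ∀ᶠ k in atTop, ∀ s ∈ Icc 0 T, W1 (m k s) (m₀ s) < η)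
    {ε : ℕ → ℝ} (hε : ∀ k, 0 < ε k) (hε0 : Tendsto ε atTop (𝓝 0)) {v : E d} {γ : ℕ → ℝ → E d}
    (hγ : ∀ k, IsMinimizerEps T (ε k) L g (m k) t x v (γ k)) {δ : ℝ} (hδ : 0 < δ) :
    ∀ᶠ k in atTop, action (flowLagrangian hT.le L m₀) (fun z => g z (m₀ T)) t T x (vel T (γ k))
      ≤ valueLim T L g m₀ t x + δ := by
  have hM := hM2.pos
  have h0 := tonelliProblem_of_flow hT.le hM1 hM2 hg hm₀
  have hk := fun k => tonelliProblem_of_flow hT.le hM1 hM2 hg (hm k)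
  have hβ0 : 0 ≤ T - t := sub_nonneg.2 ht.2
  -- Five errors of size δ/5: choice of f, its smoothing w, the acceleration cost of w, and the
  -- exchange of m_k for m₀ along w and along γ_k.
  set U := valueLim T L g m₀ t x with hU
  obtain ⟨f, hf, hfU⟩ := exists_action_le_valueLim (L := L) (g := g) (m := m₀) (x := x) hT ht
    (by positivity : 0 < δ / 5)
  obtain ⟨w, hw, hwt, hwf⟩ := h0.exists_contDiff_action_le ht.2 x hf v (by positivity : 0 < δ / 5)
  have hwL : MemLp w 2 (volume.restrict (Ioc t T)) :=
    memLp_of_continuousOn hw.continuous.continuousOn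
  -- One competitor for all k, so its acceleration energy is a fixed number and ε_k times it
  -- vanishes.
  have hadm : curveOf t x w ∈ admissible T t x v := hwt ▸ curveOf_mem_admissible hT hw ht x
  obtain ⟨Rw, hRw⟩ := isCompact_Icc.exists_bound_of_continuousOn
    (continuousOn_curveOf ht.2 (hwL.intervalIntegrable_of_two ht.2) x)
  set A := ∫ s in t..T, ‖acc T (curveOf t x w) s‖ ^ 2 with hA
  obtain ⟨B, hB0, hB⟩ := h0.bdd
  -- Constants uniform in k: eventually ℓ_k(s,0,0) and g(x,m_k(T)) differ from their limits by at
  -- most 1, whence `B + 1` here and the -1 in `N`.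
  obtain ⟨K, hK⟩ := exists_integral_coercive ht.2 hM (B + 1) (2 * M₀) x (by positivity)
  set N := 4 * M₀ * (U + δ - (g x (m₀ T) - 1) + K) with hN
  set R := ‖x‖ + (N / 1 + 1 * (T - t)) / 2 with hR
  set η := δ / (5 * (T - t + 1)) with hη
  have hη0 : 0 < η := by positivity
  have hηT : η * (T - t + 1) = δ / 5 := by rw [hη]; field_simp
  have hεA : ∀ᶠ k in atTop, ε k / 2 * A ≤ δ / 5 := by
    have h1 : Tendsto (fun k => ε k / 2 * A) atTop (𝓝 (0 / 2 * A)) :=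
      (hε0.div_const 2).mul_const A
    rw [zero_div, zero_mul] at h1
    exact (h1.eventually (gt_mem_nhds (by positivity : 0 < δ / 5))).mono fun k hk => hk.le
  filter_upwards [hεA, eventually_lagrangian_close hM3 hconv Rw hη0,
    eventually_terminal_close hT hg hconv Rw hη0, eventually_lagrangian_close hM3 hconv R hη0,
    eventually_terminal_close hT hg hconv R hη0, eventually_lagrangian_close hM3 hconv 0 one_pos,
    eventually_terminal_close hT hg hconv ‖x‖ one_pos] with k h1 hLw hgw hLR hgR hL0 hg0
  have hγk := (hγ k).1
  have hvL := memLp_vel hT ht hγk.1.1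
  have hmin := (hγ k).2 hadm
  simp only [mem_ofPred_eq] at hmin
  rw [costEps_eq_action hT ht (hk k) (ε k) hadm, costEps_eq_action hT ht (hk k) (ε k) hγk,
    action_vel_curveOf hT ht hw.continuous] at hmin
  have hcw := (abs_le.1 (abs_action_flow_sub_le hT ht (hk k) h0 hLw hgw hwL hRw)).2
  rw [hηT] at hcw
  have hacc0 : 0 ≤ ε k / 2 * ∫ s in t..T, ‖acc T (γ k) s‖ ^ 2 :=
    mul_nonneg (half_pos (hε k)).le (intervalIntegral_norm_sq_nonneg ht.2 _)
  have hup : action (flowLagrangian hT.le L (m k)) (fun z => g z (m k T)) t T x (vel T (γ k))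
      ≤ U + 4 / 5 * δ := by linarith
  have hB' : ∀ s, |flowLagrangian hT.le L (m k) s 0 0| ≤ B + 1 := fun s => by
    have h2 := hB s
    have h3 := hL0 (projIcc 0 T hT.le s) (projIcc 0 T hT.le s).2 0 0 (by simp)
    unfold flowLagrangian at h2 ⊢
    have h4 := abs_sub_abs_le_abs_sub (L 0 0 (m k (projIcc 0 T hT.le s)))
      (L 0 0 (m₀ (projIcc 0 T hT.le s)))
    linarith
  have hvi := hvL.intervalIntegrable_of_two ht.2
  have hcoer := hK (vel T (γ k)) _ hvL ((hk k).intervalIntegrable_curve ht.2 x hvL)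
    fun s _ => (hk k).coercive hB' s _ _
  have hgk := neg_le_of_abs_le ((hk k).abs_terminal_sub_le (curveOf t x (vel T (γ k)) T) x)
  have hgx := neg_le_of_abs_le (hg0 x le_rfl)
  have hdist : ‖curveOf t x (vel T (γ k)) T - x‖ ≤ ∫ s in t..T, ‖vel T (γ k) s‖ := by
    rw [curveOf, add_sub_cancel_left]
    exact norm_intervalIntegral_le_of_mem hvi (right_mem_Icc.2 ht.2)
  have hdist' := mul_le_mul_of_nonneg_left hdist (by positivity : 0 ≤ 2 * M₀)
  have hNk : ∫ s in t..T, ‖vel T (γ k) s‖ ^ 2 ≤ N := by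
    have h2 : 1 / (4 * M₀) * ∫ s in t..T, ‖vel T (γ k) s‖ ^ 2
        ≤ U + δ - (g x (m₀ T) - 1) + K := by
      unfold action at hup
      linarith
    have h3 := mul_le_mul_of_nonneg_left h2 (by positivity : 0 ≤ 4 * M₀)
    rwa [← mul_assoc, mul_one_div_cancel (by positivity), one_mul] at h3
  -- The data for m_k and m₀ are close only on balls in x, so the curves γ_k must first be confined
  -- to a common one.
  have hRk : ∀ s ∈ Icc t T, ‖curveOf t x (vel T (γ k)) s‖ ≤ R := fun s hs => by
    refine (norm_curveOf_le hvi x hs).trans (add_le_add le_rfl ?_)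
    refine (intervalIntegral_norm_le_young ht.2 hvL one_pos).trans ?_
    gcongr
  have hcγ := (abs_le.1 (abs_action_flow_sub_le hT ht (hk k) h0 hLR hgR hvL hRk)).1
  rw [hηT] at hcγ
  linarith

end SingularLimit

end SingularMFG

/-! ### Conclusion -/

theorem proposition4p9 (d : ℕ) (T M₀ : ℝ) (hT : 0 < T)
    (L : E d → E d → P1 (E d) → ℝ)
    (g : E d → P1 (E d) → ℝ)
    (μ₀ : Measure (E d × E d))
    (hM1 : LagrangianRegular L) (hM2 : LagrangianConvexGrowth M₀ L)
    (hM3 : LagrangianMeasureModulus L)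
    (hBC1 : InitialDatum μ₀) (hBC2 : TerminalCost M₀ g)
    -- for every `ε > 0`, a solution `(u^ε, μ^ε)` of the mean field game system
    (u : ℝ → ℝ → E d → E d → ℝ)
    (μ : ℝ → ℝ → P1 (E d × E d))
    (hsol : ∀ ε > 0, IsMFGSolution T ε L g μ₀ (u ε) (μ ε))
    -- `m^{ε_k} → m⁰` in `C([0,T]; P_1(ℝ^d))` along `ε_k → 0`
    (ε : ℕ → ℝ) (hε : ∀ k, 0 < ε k) (hε0 : Tendsto ε atTop (𝓝 0))
    (m₀ : ℝ → P1 (E d)) (hm₀ : ContinuousFlow T m₀)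
    (hconv : ∀ η > 0, ∀ᶠ k in atTop, ∀ s ∈ Icc 0 T,
      W1 (μ (ε k) s).fst (m₀ s) < η)
    -- `u⁰` is differentiable at `(t,x)`, as a function on `[0,T] × ℝ^d`
    (t : ℝ) (ht : t ∈ Icc 0 T) (x v : E d)
    (hdiff : DifferentiableWithinAt ℝ
      (fun q : ℝ × E d => valueLim T L g m₀ q.1 q.2)
      (Icc 0 T ×ˢ univ) (t, x))
    -- minimizers for `u^{ε_k}(t,x,v)`
    (γ : ℕ → ℝ → E d)
    (hγ : ∀ k, IsMinimizerEps T (ε k) L g (fun s => (μ (ε k) s).fst) t x v (γ k)) :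
    ∃ γ₀ : ℝ → E d,
      AbsolutelyContinuousOnInterval γ₀ 0 T ∧
      TendstoUniformlyOn γ γ₀ atTop (Icc t T) ∧
      IsMinimizerLim T L g m₀ t x γ₀ ∧
      costLim T L g m₀ t γ₀ = valueLim T L g m₀ t x ∧
      ∀ γ₁, IsMinimizerLim T L g m₀ t x γ₁ → EqOn γ₁ γ₀ (Icc t T) := by

  have h0 := tonelliProblem_of_flow hT.le hM1 hM2 hBC2 hm₀
  have hU : ∀ y f, MemLp f 2 (volume.restrict (Ioc t T)) → valueLim T L g m₀ t y ≤
      action (flowLagrangian hT.le L m₀) (fun z => g z (m₀ T)) t T y f :=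
    fun y f hf => valueLim_le_action hT ht h0 y hf
  -- Only the spatial derivative is used. The slice y ↦ (t,y) stays in [0,T] × ℝ^d, so this is full
  -- differentiability even at t = 0 or t = T.
  have hdiffU : DifferentiableAt ℝ (fun y => valueLim T L g m₀ t y) x := by
    have h1 : DifferentiableWithinAt ℝ (fun y : E d => (t, y)) univ x :=
      ((differentiableAt_const t).prodMk differentiableAt_id).differentiableWithinAt
    have h2 := DifferentiableWithinAt.comp (f := fun y : E d => (t, y)) x hdiff h1
      fun y _ => ⟨ht, mem_univ y⟩
    exact differentiableWithinAt_univ.1 h2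
  obtain ⟨w, hw, hwU⟩ := h0.exists_continuous_minimizer ht.2 hU
    (fun δ hδ => exists_action_le_valueLim hT ht hδ) hdiffU
  have hwL : MemLp w 2 (volume.restrict (Ioc t T)) := memLp_of_continuousOn hw.continuousOn
  have hmem := curveOf_mem_curves hw T t x
  have hcost : costLim T L g m₀ t (curveOf t x w) = valueLim T L g m₀ t x := by
    rw [costLim_curveOf hT ht hw]
    exact le_antisymm hwU (hU x w hwL)
  have hlower : ∀ γ' ∈ curves T t x, valueLim T L g m₀ t x ≤ costLim T L g m₀ t γ' :=
    fun γ' hγ' => csInf_le (bddBelow_costLim hT ht h0 x) (mem_image_of_mem _ hγ')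
  refine ⟨curveOf t x w, (contDiff_curveOf hw t x).contDiffOn.absolutelyContinuousOnInterval,
    ?_, ⟨hmem, fun γ' hγ' => hcost.trans_le (hlower γ' hγ')⟩, hcost, fun γ₁ hγ₁ s hs => ?_⟩
  · rw [Metric.tendstoUniformlyOn_iff]
    intro ρ hρ
    -- The limit curve is itself a near minimizer, so every γ_k of nearly minimal action is close to
    -- it; no subsequence is extracted.
    obtain ⟨δ, hδ, hclose⟩ := h0.near_minimizers_close ht.2 hU hdiffU (half_pos hρ)
    filter_upwards [eventually_action_vel_le hT ht hM1 hM2 hM3 hBC2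
      (fun k => (hsol (ε k) (hε k)).continuous.fst) hm₀ hconv hε hε0 hγ hδ] with k hk s hs
    have hγk := (hγ k).1.1.1
    have h1 := hclose w (vel T (γ k)) hwL (memLp_vel hT ht hγk) (by linarith) hk s hs
    rw [curveOf_vel hT ht hγk hs] at h1
    rw [dist_eq_norm]
    linarith
  · rw [← sub_eq_zero, ← norm_le_zero_iff]
    refine le_of_forall_pos_le_add fun ρ hρ => ?_
    -- Two exact minimizers are near minimizers at every level, hence at distance at most ρ for
    -- every ρ.
    obtain ⟨δ, hδ, hclose⟩ := h0.near_minimizers_close ht.2 hU hdiffU hρ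
    have h1 : action (flowLagrangian hT.le L m₀) (fun z => g z (m₀ T)) t T x (vel T γ₁)
        ≤ valueLim T L g m₀ t x := by
      rw [← costLim_eq_action hT ht hγ₁.1, ← hcost]
      exact hγ₁.2 hmem
    have h2 := hclose (vel T γ₁) w (memLp_vel hT ht hγ₁.1) hwL (by linarith) (by linarith) s hs
    rw [curveOf_vel hT ht hγ₁.1 hs] at h2
    linarith
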